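/- Let $\Gamma\subseteq\mathbb{N}^2$ be finite (with $0\in\mathbb{N}$) and let $\varphi_\Gamma(z,w)=\sum_{(\alpha,\beta)\in\Gamma}|z^\alpha w^\beta|^2$ on $\mathbb{C}^2$. For $\varphi=\varphi_\Gamma$ let $L^2(\mathbb{C}^2,\varphi)$ be the $L^2$ space of the measure $e^{-2\varphi}d\mathcal{L}$, where $\mathcal{L}$ is Lebesgue measure, and let $$L^2(\mathbb{C}^2,\varphi)\xrightarrow{\ \overline\partial\ }L^2_{(0,1)}(\mathbb{C}^2,\varphi)\xrightarrow{\ \overline\partial\ }L^2_{(0,2)}(\mathbb{C}^2,\varphi)$$ be the $\overline\partial$-complex on forms with coefficients in $L^2(\mathbb{C}^2,\varphi)$, where each $\overline\partial$ is taken in the sense of distributions on its maximal domain. Let $\overline\partial^*_\varphi$ denote the Hilbert space adjoints, and let the weighted Kohn Laplacian be the operator $$\Box_\varphi=\overline\partial^*_\varphi\overline\partial+\overline\partial\,\overline\partial^*_\varphi$$ on $L^2_{(0,1)}(\mathbb{C}^2,\varphi)$, with domain the set of all $u$ in the domains of $\overline\partial$ and $\overline\partial^*_\varphi$ such that $\overline\partial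 u$ is in the domain of $\overline\partial^*_\varphi$ and $\overline\partial^*_\varphi u$ is in the domain of $\overline\partial$. Such an operator has discrete spectrum if its spectrum is a discrete subset of $\mathbb{R}$ consisting of eigenvalues of finite multiplicity. **Theorem.** Assume that there are $m,n\geq2$ such that $(m,0),(0,n)\in\Gamma$. Then $\Box_{\varphi_\Gamma}$ has discrete spectrum if and only if $\varphi_\Gamma$ is not decoupled, that is, if and only if $\Gamma\not\subseteq(\mathbb{N}\times\{0\})\cup(\{0\}\times\mathbb{N})$ (equivalently, $\Gamma$ contains some $(\alpha,\beta)$ with $\alpha\neq0$ and $\beta\neq0$). -/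

import Mathlib

open MeasureTheory Complex
open scoped ContDiff LinearPMap

noncomputable section

namespace KohnLaplacian

/-! ### Weighted `L²` spaces on `ℂ²` -/

/-- The measure `e^{-2φ} dℒ` on `ℂ²`, where `ℒ` is Lebesgue measure. -/
abbrev weightedMeasure (φ : C(ℂ × ℂ, ℝ)) : Measure (ℂ × ℂ) :=
  (volume : Measure (ℂ × ℂ)).withDensity (fun p => ENNReal.ofReal (Real.exp (-2 * φ p)))

/-- The space `L²(ℂ², φ)`. It also serves as the space of `(0,2)`-forms, `g` standing for
`g dz̄ ∧ dw̄`. -/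
abbrev L2 (φ : C(ℂ × ℂ, ℝ)) : Type := Lp ℂ 2 (weightedMeasure φ)

/-- The Hilbert space of `(0,1)`-forms `u = u₁ dz̄ + u₂ dw̄` with coefficients in `L²(ℂ², φ)`;
`u₁ = u.fst`, `u₂ = u.snd`, and `‖u‖² = ‖u₁‖² + ‖u₂‖²`. -/
abbrev L2Form (φ : C(ℂ × ℂ, ℝ)) : Type := WithLp 2 (L2 φ × L2 φ)

/-! ### Wirtinger derivatives, classical and weak -/

/-- `∂η/∂z̄ = (∂η/∂x + i ∂η/∂y) / 2` with `z = x + iy`, for `η = η(z, w)`. -/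
def dbarZ (η : ℂ × ℂ → ℂ) (p : ℂ × ℂ) : ℂ :=
  (fderiv ℝ η p (1, 0) + I * fderiv ℝ η p (I, 0)) / 2

/-- `∂η/∂w̄ = (∂η/∂s + i ∂η/∂t) / 2` with `w = s + it`, for `η = η(z, w)`. -/
def dbarW (η : ℂ × ℂ → ℂ) (p : ℂ × ℂ) : ℂ :=
  (fderiv ℝ η p (0, 1) + I * fderiv ℝ η p (0, I)) / 2

/-- Test functions: complex-valued smooth functions with compact support. -/
structure IsTest (η : ℂ × ℂ → ℂ) : Prop where
  smooth : ContDiff ℝ ∞ η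
  compact : HasCompactSupport η

/-- `∂f/∂z̄ = g` in the sense of distributions. -/
def HasWeakDbarZ (f g : ℂ × ℂ → ℂ) : Prop :=
  ∀ η : ℂ × ℂ → ℂ, IsTest η → ∫ p, f p * dbarZ η p = -∫ p, g p * η p

/-- `∂f/∂w̄ = g` in the sense of distributions. -/
def HasWeakDbarW (f g : ℂ × ℂ → ℂ) : Prop :=
  ∀ η : ℂ × ℂ → ℂ, IsTest η → ∫ p, f p * dbarW η p = -∫ p, g p * η p

/-- `∂u₂/∂z̄ - ∂u₁/∂w̄ = g` in the sense of distributions. -/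
def HasWeakDbarForm (u₁ u₂ g : ℂ × ℂ → ℂ) : Prop :=
  ∀ η : ℂ × ℂ → ℂ, IsTest η →
    ∫ p, (u₂ p * dbarZ η p - u₁ p * dbarW η p) = -∫ p, g p * η p

/-! ### Auxiliary facts -/

section Aux

variable {φ : C(ℂ × ℂ, ℝ)}

theorem weightedMeasure_ac : weightedMeasure φ ≪ (volume : Measure (ℂ × ℂ)) :=
  withDensity_absolutelyContinuous _ _

theorem ac_weightedMeasure : (volume : Measure (ℂ × ℂ)) ≪ weightedMeasure φ := by
  refine withDensity_absolutelyContinuous' (by fun_prop) ?_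
  filter_upwards with p
  simp [Real.exp_pos]

instance : IsLocallyFiniteMeasure (weightedMeasure φ) :=
  IsLocallyFiniteMeasure.withDensity_ofReal (by fun_prop)

theorem locallyIntegrable (f : L2 φ) :
    LocallyIntegrable (fun p => f p) (volume : Measure (ℂ × ℂ)) := by
  have h1 : LocallyIntegrable (fun p => f p) (weightedMeasure φ) :=
    (Lp.memLp f).locallyIntegrable (by norm_num)
  have h2 : LocallyIntegrable (fun p => Real.exp (-2 * φ p) • f p)
      (volume : Measure (ℂ × ℂ)) := by
    rw [locallyIntegrable_iff]
    intro K hK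
    have h3 := h1.integrableOn_isCompact hK
    rw [IntegrableOn, restrict_withDensity hK.measurableSet,
      integrable_withDensity_iff_integrable_smul' (by fun_prop) (by simp)] at h3
    refine h3.congr ?_
    filter_upwards with p
    rw [ENNReal.toReal_ofReal (Real.exp_pos _).le]
  have h4 := h2.continuous_smul (g := fun p => Real.exp (2 * φ p)) (by fun_prop)
  refine h4.congr ?_
  filter_upwards with p
  simp only [smul_smul, ← Real.exp_add]
  simp

theorem IsTest.dbarZ {η : ℂ × ℂ → ℂ} (h : IsTest η) : IsTest (dbarZ η) := by
  have hd : ContDiff ℝ ∞ (fderiv ℝ η) := h.smooth.fderiv_right (by simp)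
  refine ⟨?_, ?_⟩
  · unfold KohnLaplacian.dbarZ
    fun_prop
  · refine (h.compact.fderiv (𝕜 := ℝ)).mono fun p hp => ?_
    contrapose! hp
    simp only [Function.mem_support, ne_eq, not_not] at hp
    simp [KohnLaplacian.dbarZ, hp]

theorem IsTest.dbarW {η : ℂ × ℂ → ℂ} (h : IsTest η) : IsTest (dbarW η) := by
  have hd : ContDiff ℝ ∞ (fderiv ℝ η) := h.smooth.fderiv_right (by simp)
  refine ⟨?_, ?_⟩
  · unfold KohnLaplacian.dbarW
    fun_prop
  · refine (h.compact.fderiv (𝕜 := ℝ)).mono fun p hp => ?_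
    contrapose! hp
    simp only [Function.mem_support, ne_eq, not_not] at hp
    simp [KohnLaplacian.dbarW, hp]

theorem integrable_mul (f : L2 φ) {η : ℂ × ℂ → ℂ} (h : IsTest η) :
    Integrable (fun p => f p * η p) (volume : Measure (ℂ × ℂ)) := by
  have := (locallyIntegrable f).integrable_smul_left_of_hasCompactSupport
    h.smooth.continuous h.compact
  refine this.congr ?_
  filter_upwards with p
  simp [mul_comm]

theorem coeFn_add (f g : L2 φ) : ∀ᵐ p, (f + g : L2 φ) p = f p + g p :=
  ac_weightedMeasure.ae_le (Lp.coeFn_add f g)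

theorem coeFn_smul (c : ℂ) (f : L2 φ) : ∀ᵐ p, (c • f : L2 φ) p = c * f p :=
  ac_weightedMeasure.ae_le (Lp.coeFn_smul c f)

theorem coeFn_zero : ∀ᵐ p, (0 : L2 φ) p = 0 :=
  ac_weightedMeasure.ae_le (Lp.coeFn_zero ℂ 2 (weightedMeasure φ))

theorem integral_zero_mul (ψ : ℂ × ℂ → ℂ) : ∫ p, (0 : L2 φ) p * ψ p = 0 :=
  integral_eq_zero_of_ae ((coeFn_zero (φ := φ)).mono fun p hp => by simp only [hp, zero_mul, Pi.zero_apply])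

theorem integral_add_mul (f g : L2 φ) {η : ℂ × ℂ → ℂ} (h : IsTest η) :
    ∫ p, (f + g : L2 φ) p * η p = (∫ p, f p * η p) + ∫ p, g p * η p := by
  rw [← integral_add (integrable_mul f h) (integrable_mul g h)]
  exact integral_congr_ae ((coeFn_add f g).mono fun p hp => by simp only [hp]; ring)

theorem integral_smul_mul (c : ℂ) (f : L2 φ) (ψ : ℂ × ℂ → ℂ) :
    ∫ p, (c • f : L2 φ) p * ψ p = c * ∫ p, f p * ψ p := by
  rw [← integral_const_mul]
  exact integral_congr_ae ((coeFn_smul c f).mono fun p hp => by simp only [hp]; ring)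

theorem eq_zero_of_integral_eq_zero (f : L2 φ)
    (h : ∀ η : ℂ × ℂ → ℂ, IsTest η → ∫ p, f p * η p = 0) : f = 0 := by
  have h1 := ae_eq_zero_of_integral_contDiff_smul_eq_zero (locallyIntegrable f)
    (fun g hg hc => by
      have ht : IsTest (fun p => (g p : ℂ)) :=
        ⟨Complex.ofRealCLM.contDiff.comp hg, hc.comp_left (g := ((↑) : ℝ → ℂ)) (by simp)⟩
      rw [← h _ ht]
      exact integral_congr_ae (Filter.Eventually.of_forall fun p => by simp [mul_comm]))
  exact (Lp.eq_zero_iff_ae_eq_zero).2 (weightedMeasure_ac.ae_le h1)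

theorem hasWeakDbarForm_iff (u₁ u₂ g : L2 φ) : HasWeakDbarForm u₁ u₂ g ↔
    ∀ η : ℂ × ℂ → ℂ, IsTest η →
      (∫ p, u₂ p * dbarZ η p) - (∫ p, u₁ p * dbarW η p) = -∫ p, g p * η p := by
  refine forall₂_congr fun η hη => ?_
  rw [integral_sub (integrable_mul u₂ hη.dbarZ) (integrable_mul u₁ hη.dbarW)]

/-- The `L²` function given by a test function. -/
def IsTest.toL2 (φ : C(ℂ × ℂ, ℝ)) {η : ℂ × ℂ → ℂ} (h : IsTest η) : L2 φ :=
  (h.smooth.continuous.memLp_of_hasCompactSupport h.compact).toLp η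

theorem IsTest.coeFn_toL2 {η : ℂ × ℂ → ℂ} (h : IsTest η) : ∀ᵐ p, h.toL2 φ p = η p :=
  ac_weightedMeasure.ae_le (MemLp.coeFn_toLp _)

theorem integral_mul_fderiv {η ψ : ℂ × ℂ → ℂ} (h : IsTest η) (h' : IsTest ψ) (v : ℂ × ℂ) :
    ∫ p, η p * fderiv ℝ ψ p v = -∫ p, fderiv ℝ η p v * ψ p := by
  have hd : Continuous (fderiv ℝ η) := h.smooth.continuous_fderiv (by simp)
  have hd' : Continuous (fderiv ℝ ψ) := h'.smooth.continuous_fderiv (by simp)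
  have hη := h.smooth.continuous
  have hψ := h'.smooth.continuous
  have : (volume : Measure (ℂ × ℂ)).IsAddHaarMeasure :=
    inferInstanceAs ((volume : Measure ℂ).prod (volume : Measure ℂ)).IsAddHaarMeasure
  refine integral_mul_fderiv_eq_neg_fderiv_mul_of_integrable ?_ ?_ ?_
    (fun x _ => h.smooth.differentiable (by simp) x)
    (fun x _ => h'.smooth.differentiable (by simp) x)
  · exact Continuous.integrable_of_hasCompactSupport (by fun_prop) h'.compact.mul_left
  · exact Continuous.integrable_of_hasCompactSupport (by fun_prop) h.compact.mul_right
  · exact Continuous.integrable_of_hasCompactSupport (by fun_prop) h.compact.mul_right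

theorem integrable_fderiv_mul {η ψ : ℂ × ℂ → ℂ} (h : IsTest η) (h' : IsTest ψ) (v : ℂ × ℂ) :
    Integrable (fun p => fderiv ℝ η p v * ψ p) (volume : Measure (ℂ × ℂ)) := by
  have hd : Continuous (fderiv ℝ η) := h.smooth.continuous_fderiv (by simp)
  have hψ := h'.smooth.continuous
  exact Continuous.integrable_of_hasCompactSupport (by fun_prop) h'.compact.mul_left

theorem integral_mul_dbar {η ψ : ℂ × ℂ → ℂ} (h : IsTest η) (h' : IsTest ψ) (v w : ℂ × ℂ) :
    ∫ p, η p * ((fderiv ℝ ψ p v + I * fderiv ℝ ψ p w) / 2) =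
      -∫ p, (fderiv ℝ η p v + I * fderiv ℝ η p w) / 2 * ψ p := by
  have e1 : ∀ p, η p * ((fderiv ℝ ψ p v + I * fderiv ℝ ψ p w) / 2) =
      (1 / 2) * (fderiv ℝ ψ p v * η p) + (I / 2) * (fderiv ℝ ψ p w * η p) := fun p => by ring
  have e2 : ∀ p, (fderiv ℝ η p v + I * fderiv ℝ η p w) / 2 * ψ p =
      (1 / 2) * (fderiv ℝ η p v * ψ p) + (I / 2) * (fderiv ℝ η p w * ψ p) := fun p => by ring
  simp only [e1, e2]
  rw [integral_add ((integrable_fderiv_mul h' h v).const_mul _)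
      ((integrable_fderiv_mul h' h w).const_mul _),
    integral_add ((integrable_fderiv_mul h h' v).const_mul _)
      ((integrable_fderiv_mul h h' w).const_mul _)]
  simp only [integral_const_mul]
  have i1 := integral_mul_fderiv h h' v
  have i2 := integral_mul_fderiv h h' w
  simp only [mul_comm (η _)] at i1 i2
  rw [i1, i2]
  ring

theorem IsTest.hasWeakDbarZ {η : ℂ × ℂ → ℂ} (h : IsTest η) :
    HasWeakDbarZ (h.toL2 φ) (h.dbarZ.toL2 φ) := by
  intro ψ hψ
  rw [integral_congr_ae ((h.coeFn_toL2 (φ := φ)).mono fun p hp => by simp only [hp] :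
      (fun p => h.toL2 φ p * KohnLaplacian.dbarZ ψ p) =ᵐ[volume]
        fun p => η p * KohnLaplacian.dbarZ ψ p),
    integral_congr_ae ((h.dbarZ.coeFn_toL2 (φ := φ)).mono fun p hp => by simp only [hp] :
      (fun p => h.dbarZ.toL2 φ p * ψ p) =ᵐ[volume]
        fun p => KohnLaplacian.dbarZ η p * ψ p)]
  exact integral_mul_dbar h hψ _ _

theorem IsTest.hasWeakDbarW {η : ℂ × ℂ → ℂ} (h : IsTest η) :
    HasWeakDbarW (h.toL2 φ) (h.dbarW.toL2 φ) := by
  intro ψ hψ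
  rw [integral_congr_ae ((h.coeFn_toL2 (φ := φ)).mono fun p hp => by simp only [hp] :
      (fun p => h.toL2 φ p * KohnLaplacian.dbarW ψ p) =ᵐ[volume]
        fun p => η p * KohnLaplacian.dbarW ψ p),
    integral_congr_ae ((h.dbarW.coeFn_toL2 (φ := φ)).mono fun p hp => by simp only [hp] :
      (fun p => h.dbarW.toL2 φ p * ψ p) =ᵐ[volume]
        fun p => KohnLaplacian.dbarW η p * ψ p)]
  exact integral_mul_dbar h hψ _ _

theorem eq_zero_of_inner_eq_zero (f : L2 φ)
    (h : ∀ (η : ℂ × ℂ → ℂ) (hη : IsTest η), inner ℂ (hη.toL2 φ) f = 0) : f = 0 := by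
  have h0 : LocallyIntegrable (fun p => Real.exp (-2 * φ p) • f p)
      (volume : Measure (ℂ × ℂ)) :=
    (locallyIntegrable f).continuous_smul (g := fun p => Real.exp (-2 * φ p)) (by fun_prop)
  have h1 := ae_eq_zero_of_integral_contDiff_smul_eq_zero h0
    (fun g hg hc => by
      have ht : IsTest (fun p => (g p : ℂ)) :=
        ⟨Complex.ofRealCLM.contDiff.comp hg, hc.comp_left (g := ((↑) : ℝ → ℂ)) (by simp)⟩
      have h2 := h _ ht
      rw [L2.inner_def, integral_withDensity_eq_integral_toReal_smul (by fun_prop)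
        (by simp)] at h2
      rw [← h2]
      refine integral_congr_ae ((ht.coeFn_toL2 (φ := φ)).mono fun p hp => ?_)
      simp only [hp, ENNReal.toReal_ofReal (Real.exp_pos _).le, RCLike.inner_apply,
        Complex.conj_ofReal, Complex.real_smul]
      ring)
  refine (Lp.eq_zero_iff_ae_eq_zero).2 (weightedMeasure_ac.ae_le (h1.mono fun p hp => ?_))
  exact (smul_eq_zero.1 hp).resolve_left (Real.exp_pos _).ne'

end Aux

/-! ### The weighted `∂̄`-complex and the Kohn Laplacian -/

/-- The graph of `∂̄ : L²(ℂ², φ) → L²_{(0,1)}(ℂ², φ)`: the pairs `(f, u)` such that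
`∂f/∂z̄ = u₁` and `∂f/∂w̄ = u₂` weakly. -/
def dbar0Graph (φ : C(ℂ × ℂ, ℝ)) : Submodule ℂ (L2 φ × L2Form φ) where
  carrier := {q | HasWeakDbarZ q.1 q.2.fst ∧ HasWeakDbarW q.1 q.2.snd}
  zero_mem' := by
    constructor <;> intro η hη
    · exact (integral_zero_mul _).trans (neg_eq_zero.2 (integral_zero_mul _)).symm
    · exact (integral_zero_mul _).trans (neg_eq_zero.2 (integral_zero_mul _)).symm
  add_mem' := by
    rintro a b ⟨ha, ha'⟩ ⟨hb, hb'⟩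
    constructor <;> intro η hη
    · simp only [Prod.fst_add, Prod.snd_add, WithLp.add_fst, integral_add_mul _ _ hη,
        integral_add_mul _ _ hη.dbarZ, ha η hη, hb η hη]
      ring
    · simp only [Prod.fst_add, Prod.snd_add, WithLp.add_snd, integral_add_mul _ _ hη,
        integral_add_mul _ _ hη.dbarW, ha' η hη, hb' η hη]
      ring
  smul_mem' := by
    rintro c a ⟨ha, ha'⟩
    constructor <;> intro η hη
    · simp only [Prod.smul_fst, Prod.smul_snd, WithLp.smul_fst, integral_smul_mul, ha η hη]
      ring
    · simp only [Prod.smul_fst, Prod.smul_snd, WithLp.smul_snd, integral_smul_mul, ha' η hη]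
      ring

/-- The graph of `∂̄ : L²_{(0,1)}(ℂ², φ) → L²_{(0,2)}(ℂ², φ)`: the pairs `(u, g)` such that
`∂u₂/∂z̄ - ∂u₁/∂w̄ = g` weakly. -/
def dbar1Graph (φ : C(ℂ × ℂ, ℝ)) : Submodule ℂ (L2Form φ × L2 φ) where
  carrier := {q | HasWeakDbarForm q.1.fst q.1.snd q.2}
  zero_mem' := by
    refine (hasWeakDbarForm_iff _ _ _).2 fun η hη => ?_
    simp only [Prod.fst_zero, Prod.snd_zero, WithLp.zero_fst, WithLp.zero_snd,
      integral_zero_mul, sub_zero, neg_zero]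
  add_mem' := by
    intro a b ha hb
    refine (hasWeakDbarForm_iff _ _ _).2 fun η hη => ?_
    have h1 := (hasWeakDbarForm_iff _ _ _).1 ha η hη
    have h2 := (hasWeakDbarForm_iff _ _ _).1 hb η hη
    simp only [Prod.fst_add, Prod.snd_add, WithLp.add_fst, WithLp.add_snd,
      integral_add_mul _ _ hη, integral_add_mul _ _ hη.dbarZ, integral_add_mul _ _ hη.dbarW]
    linear_combination h1 + h2
  smul_mem' := by
    intro c a ha
    refine (hasWeakDbarForm_iff _ _ _).2 fun η hη => ?_
    have h1 := (hasWeakDbarForm_iff _ _ _).1 ha η hη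
    simp only [Prod.smul_fst, Prod.smul_snd, WithLp.smul_fst, WithLp.smul_snd,
      integral_smul_mul]
    linear_combination c * h1

/-- `∂̄` on functions, as an unbounded operator with its maximal domain. -/
def dbar0 (φ : C(ℂ × ℂ, ℝ)) : L2 φ →ₗ.[ℂ] L2Form φ := (dbar0Graph φ).toLinearPMap

/-- `∂̄` on `(0,1)`-forms, as an unbounded operator with its maximal domain. -/
def dbar1 (φ : C(ℂ × ℂ, ℝ)) : L2Form φ →ₗ.[ℂ] L2 φ := (dbar1Graph φ).toLinearPMap

/-- `dbar0 φ` really has the graph `dbar0Graph φ`: weak derivatives are unique. -/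
theorem dbar0_graph (φ : C(ℂ × ℂ, ℝ)) : (dbar0 φ).graph = dbar0Graph φ := by
  refine Submodule.toLinearPMap_graph_eq _ ?_
  rintro ⟨f, u⟩ ⟨h1, h2⟩ (rfl : f = 0)
  have e1 : u.fst = 0 := eq_zero_of_integral_eq_zero _ fun η hη => by
    have := h1 η hη
    simp only [integral_zero_mul] at this
    exact neg_eq_zero.1 this.symm
  have e2 : u.snd = 0 := eq_zero_of_integral_eq_zero _ fun η hη => by
    have := h2 η hη
    simp only [integral_zero_mul] at this
    exact neg_eq_zero.1 this.symm
  exact WithLp.ofLp_injective 2 (Prod.ext e1 e2)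

/-- `dbar1 φ` really has the graph `dbar1Graph φ`. -/
theorem dbar1_graph (φ : C(ℂ × ℂ, ℝ)) : (dbar1 φ).graph = dbar1Graph φ := by
  refine Submodule.toLinearPMap_graph_eq _ ?_
  rintro ⟨u, g⟩ h (rfl : u = 0)
  refine eq_zero_of_integral_eq_zero _ fun η hη => ?_
  have := (hasWeakDbarForm_iff _ _ _).1 h η hη
  simp only [WithLp.zero_fst, WithLp.zero_snd, integral_zero_mul, sub_zero] at this
  exact neg_eq_zero.1 this.symm

/-- `∂̄` on functions is densely defined, so that its adjoint is the genuine one. -/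
theorem dense_dbar0 (φ : C(ℂ × ℂ, ℝ)) : Dense ((dbar0 φ).domain : Set (L2 φ)) := by
  rw [Submodule.dense_iff_topologicalClosure_eq_top, Submodule.topologicalClosure_eq_top_iff,
    Submodule.eq_bot_iff]
  intro f hf
  refine eq_zero_of_inner_eq_zero f fun η hη => hf _ ?_
  refine Submodule.mem_map.2
    ⟨(hη.toL2 φ, WithLp.toLp 2 (hη.dbarZ.toL2 φ, hη.dbarW.toL2 φ)), ?_, rfl⟩
  exact ⟨hη.hasWeakDbarZ, hη.hasWeakDbarW⟩

/-- `∂̄` on `(0,1)`-forms is densely defined. -/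
theorem dense_dbar1 (φ : C(ℂ × ℂ, ℝ)) : Dense ((dbar1 φ).domain : Set (L2Form φ)) := by
  rw [Submodule.dense_iff_topologicalClosure_eq_top, Submodule.topologicalClosure_eq_top_iff,
    Submodule.eq_bot_iff]
  intro u hu
  have e1 : u.fst = 0 := eq_zero_of_inner_eq_zero _ fun η hη => by
    have := hu (WithLp.toLp 2 (hη.toL2 φ, 0)) (Submodule.mem_map.2
      ⟨(WithLp.toLp 2 (hη.toL2 φ, 0), -hη.dbarW.toL2 φ), by
        refine (hasWeakDbarForm_iff _ _ _).2 fun ψ hψ => ?_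
        simp only [← neg_one_smul ℂ (hη.dbarW.toL2 φ), integral_smul_mul, WithLp.toLp_fst,
          WithLp.toLp_snd, integral_zero_mul, hη.hasWeakDbarW ψ hψ]
        ring, rfl⟩)
    simpa [WithLp.prod_inner_apply] using this
  have e2 : u.snd = 0 := eq_zero_of_inner_eq_zero _ fun η hη => by
    have := hu (WithLp.toLp 2 (0, hη.toL2 φ)) (Submodule.mem_map.2
      ⟨(WithLp.toLp 2 (0, hη.toL2 φ), hη.dbarZ.toL2 φ), by
        refine (hasWeakDbarForm_iff _ _ _).2 fun ψ hψ => ?_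
        simp only [WithLp.toLp_fst, WithLp.toLp_snd, integral_zero_mul, sub_zero,
          hη.hasWeakDbarZ ψ hψ], rfl⟩)
    simpa [WithLp.prod_inner_apply] using this
  exact WithLp.ofLp_injective 2 (Prod.ext e1 e2)

/-- The composition `g ∘ f` of unbounded operators, with domain `{x ∈ D(f) | f x ∈ D(g)}`. -/
def pcomp {E F G : Type*} [AddCommGroup E] [Module ℂ E] [AddCommGroup F] [Module ℂ F]
    [AddCommGroup G] [Module ℂ G] (g : F →ₗ.[ℂ] G) (f : E →ₗ.[ℂ] F) : E →ₗ.[ℂ] G :=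
  g.comp (f.domRestrict ((g.domain.comap f.toFun).map f.domain.subtype)) (by
    rintro ⟨x, ⟨y, hy, hyx⟩, hx⟩
    have : f.domRestrict ((g.domain.comap f.toFun).map f.domain.subtype) ⟨x, ⟨y, hy, hyx⟩, hx⟩
        = f y := LinearPMap.domRestrict_apply hyx.symm
    rw [this]
    exact hy)

/-- The weighted Kohn Laplacian `□_φ = ∂̄*_φ ∂̄ + ∂̄ ∂̄*_φ` on `(0,1)`-forms. Here `†` is the Hilbert
space adjoint, and the sum is defined on the intersection of the two domains. -/
def box (φ : C(ℂ × ℂ, ℝ)) : L2Form φ →ₗ.[ℂ] L2Form φ :=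
  pcomp (dbar1 φ)† (dbar1 φ) + pcomp (dbar0 φ) (dbar0 φ)†

/-! ### Spectrum of an unbounded operator -/

section Spectrum

variable {H : Type*} [NormedAddCommGroup H] [InnerProductSpace ℂ H]

/-- The resolvent set of `T`: the `ζ` for which `T - ζ : D(T) → H` is a bijection with bounded
inverse. -/
def resolvent (T : H →ₗ.[ℂ] H) : Set ℂ :=
  {ζ | ∃ R : H →L[ℂ] H,
    (∀ y : H, ∃ h : R y ∈ T.domain, T ⟨R y, h⟩ - ζ • R y = y) ∧
    ∀ x : T.domain, R (T x - ζ • (x : H)) = x}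

/-- The spectrum of an unbounded operator. -/
def spec (T : H →ₗ.[ℂ] H) : Set ℂ := (resolvent T)ᶜ

/-- The eigenspace `{x ∈ D(T) | T x = ζ x}`. -/
def eigenspace (T : H →ₗ.[ℂ] H) (ζ : ℂ) : Submodule ℂ T.domain :=
  LinearMap.ker (T.toFun - ζ • T.domain.subtype)

/-- The spectrum is a discrete subset of `ℝ` consisting of eigenvalues of finite multiplicity. -/
structure HasDiscreteSpectrum (T : H →ₗ.[ℂ] H) : Prop where
  real : spec T ⊆ Set.range ((↑) : ℝ → ℂ)
  discrete : IsDiscrete (spec T)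
  eigenvalue : ∀ ζ ∈ spec T, eigenspace T ζ ≠ ⊥
  finite_multiplicity : ∀ ζ ∈ spec T, FiniteDimensional ℂ (eigenspace T ζ)

end Spectrum

/-! ### Model monomial weights -/

/-- The model monomial weight `φ_Γ(z, w) = ∑_{(α, β) ∈ Γ} |z^α w^β|²`. -/
def modelWeight (Γ : Finset (ℕ × ℕ)) : C(ℂ × ℂ, ℝ) where
  toFun p := ∑ γ ∈ Γ, ‖p.1 ^ γ.1 * p.2 ^ γ.2‖ ^ 2
  continuous_toFun := by fun_prop

/-- `φ_Γ` is decoupled: `Γ ⊆ ℕ × {0} ∪ {0} × ℕ`. -/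
def IsDecoupled (Γ : Finset (ℕ × ℕ)) : Prop :=
  ∀ γ ∈ Γ, γ.2 = 0 ∨ γ.1 = 0

end KohnLaplacian

end

open MeasureTheory Complex
open scoped ContDiff LinearPMap ComplexConjugate

noncomputable section

namespace KohnLaplacian

/-! ### Unbounded operators between Hilbert spaces -/

section Abstract

variable {E F : Type*} [NormedAddCommGroup E] [InnerProductSpace ℂ E] [CompleteSpace E]
  [NormedAddCommGroup F] [InnerProductSpace ℂ F]

/-! A nonnegative self-adjoint operator has discrete spectrum exactly when its resolvent is compact.
For `□` this is a statement about the energy `‖∂̄u‖² + ‖∂̄*u‖²`: for every `ε`, finitely many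
orthogonality conditions on `u` must force `‖u‖² ≤ ε (‖u‖² + ‖∂̄u‖² + ‖∂̄*u‖²)`.
`IsHilbertComplex.hasDiscreteSpectrum` turns such an estimate into discreteness, and
`IsHilbertComplex.exists_finiteRank` extracts a version of it from discreteness.

Not decoupled. For a test form `f dz̄ + g dw̄` the Kohn–Morrey formula writes the energy as the
weighted norms of all `∂̄`-derivatives plus twice the integral of the Levi form `∑ |∂_z m_γ f + ∂_w
m_γ g|²`, where `m_γ` are the monomials. On balls Rellich's lemma applies, so mass escaping to
infinity must be excluded (`exists_tail`). The pure powers `z^m` and `w^n` control `f` where `|z|`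
is large and `g` where `|w|` is large. There remains `g` for large `|z|`, where the Levi form may
degenerate near `w = 0`, and the mirror case. Take a mixed monomial `z^a w^b` with `a / b` maximal.
Where it is bounded below, it bounds `g` together with the pure powers. Where `|z^a w^b| ≤ 1` and
`|z| ≥ s^{-b}`, the variable `w` stays in a disc of radius `s`, and every monomial containing `w` is
bounded by 1. The weight is then comparable to `φ(z, 0)`, which `∂̄_w` does not see, and the
Poincaré inequality in `w` gains `s²` (`exists_tail_snd`). The estimate passes to all forms because
test forms are dense in the graph norm (`exists_testForm_approx`).

Decoupled. The weight factors, so for polynomials `P` the forms `P(z) dw̄` are `∂̄`-closed, and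
`∂̄*` multiplies them by a function of `w` alone. By Fubini the ratio of energy to squared norm does
not depend on `P`: an infinite-dimensional space of forms has uniformly bounded energy, which
contradicts compactness (`not_hasDiscreteSpectrum_of_isDecoupled`). -/

theorem mem_adjoint_graph {A : E →ₗ.[ℂ] F} (hA : Dense (A.domain : Set E)) {y : F} {w : E} :
    (y, w) ∈ A†.graph ↔ ∀ x z, (x, z) ∈ A.graph → inner ℂ w x = inner ℂ y z := by
  rw [LinearPMap.adjoint_graph_eq_graph_adjoint hA, Submodule.mem_adjoint_iff]
  refine forall₃_congr fun a b _ => ?_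
  rw [sub_eq_zero, ← inner_conj_symm w a, ← inner_conj_symm y b]
  exact ⟨fun h => by simp only [h], fun h => (star_injective h).symm⟩

/-- A closed densely defined operator coincides with its double adjoint. -/
theorem mem_graph_of_adjoint [CompleteSpace F] {A : E →ₗ.[ℂ] F} (hA : Dense (A.domain : Set E))
    (hc : A.IsClosed) {y : E} {w : F}
    (h : ∀ b a, (b, a) ∈ A†.graph → inner ℂ a y = inner ℂ b w) : (y, w) ∈ A.graph := by
  let G : Submodule ℂ (WithLp 2 (E × F)) :=
    A.graph.comap (WithLp.linearEquiv 2 ℂ (E × F)).toLinearMap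
  have hG : IsClosed (G : Set (WithLp 2 (E × F))) :=
    IsClosed.preimage (WithLp.prod_continuous_ofLp 2 E F) hc
  have hGG : Gᗮᗮ = G := by
    rw [Submodule.orthogonal_orthogonal_eq_closure, hG.submodule_topologicalClosure_eq]
  suffices WithLp.toLp 2 (y, w) ∈ Gᗮᗮ by
    rw [hGG] at this
    exact this
  rw [Submodule.mem_orthogonal]
  intro q hq
  -- The orthogonal complement of the graph of `A` is the graph of `A†` turned by a quarter turn, so
  -- `h` says exactly that `(y, w)` is orthogonal to every `q ∈ Gᗮ`.
  have hq' : (q.snd, -q.fst) ∈ A†.graph := by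
    refine (mem_adjoint_graph hA).2 fun x z hxz => ?_
    have := (Submodule.mem_orthogonal' _ _).1 hq (WithLp.toLp 2 (x, z)) hxz
    rw [WithLp.prod_inner_apply] at this
    rw [inner_neg_left, neg_eq_iff_add_eq_zero]
    exact this
  have := h _ _ hq'
  rw [WithLp.prod_inner_apply]
  rw [inner_neg_left, neg_eq_iff_add_eq_zero] at this
  exact this

end Abstract

/-! ### The Laplacian of a Hilbert complex and its weak solutions -/

section Laplacian

variable {H₀ H₁ H₂ : Type*} [NormedAddCommGroup H₀] [InnerProductSpace ℂ H₀] [CompleteSpace H₀]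
  [NormedAddCommGroup H₁] [InnerProductSpace ℂ H₁] [CompleteSpace H₁]
  [NormedAddCommGroup H₂] [InnerProductSpace ℂ H₂] [CompleteSpace H₂]
  (S : H₀ →ₗ.[ℂ] H₁) (T : H₁ →ₗ.[ℂ] H₂)

/-- The Laplacian `T*T + SS*` of a complex `H₀ → H₁ → H₂` of unbounded operators. -/
def laplacian : H₁ →ₗ.[ℂ] H₁ := pcomp T† T + pcomp S S†

theorem mem_pcomp_graph {E F G : Type*} [AddCommGroup E] [Module ℂ E] [AddCommGroup F]
    [Module ℂ F] [AddCommGroup G] [Module ℂ G] {g : F →ₗ.[ℂ] G} {f : E →ₗ.[ℂ] F} {x : E} {z : G} :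
    (x, z) ∈ (pcomp g f).graph ↔ ∃ y, (x, y) ∈ f.graph ∧ (y, z) ∈ g.graph := by
  simp only [LinearPMap.mem_graph_iff]
  constructor
  · rintro ⟨⟨x', ⟨y, hy, hyx⟩, hx⟩, rfl, h2⟩
    have : f.domRestrict ((g.domain.comap f.toFun).map f.domain.subtype) ⟨x', ⟨y, hy, hyx⟩, hx⟩
        = f y := LinearPMap.domRestrict_apply hyx.symm
    refine ⟨f y, ⟨y, hyx, rfl⟩, ⟨f y, hy⟩, rfl, ?_⟩
    rw [← h2]
    refine congrArg g (Subtype.ext ?_)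
    exact this.symm
  · rintro ⟨_, ⟨x', rfl, rfl⟩, y', hy', rfl⟩
    have hm : f x' ∈ g.domain := hy' ▸ y'.2
    have hx : (x' : E) ∈ (pcomp g f).domain := ⟨⟨x', hm, rfl⟩, x'.2⟩
    refine ⟨⟨x', hx⟩, rfl, congrArg g (Subtype.ext ?_)⟩
    rw [hy']
    exact LinearPMap.domRestrict_apply rfl

theorem mem_laplacian_graph {u f : H₁} : (u, f) ∈ (laplacian S T).graph ↔
    ∃ g h a b, (u, g) ∈ T.graph ∧ (g, a) ∈ T†.graph ∧ (u, h) ∈ S†.graph ∧ (h, b) ∈ S.graph ∧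
      f = a + b := by
  constructor
  · intro h
    obtain ⟨x, rfl, rfl⟩ := (LinearPMap.mem_graph_iff _).1 h
    obtain ⟨g, h1, h2⟩ := mem_pcomp_graph.1 ((pcomp T† T).mem_graph ⟨x, x.2.1⟩)
    obtain ⟨h, h3, h4⟩ := mem_pcomp_graph.1 ((pcomp S S†).mem_graph ⟨x, x.2.2⟩)
    exact ⟨g, h, _, _, h1, h2, h3, h4, LinearPMap.add_apply _ _ _⟩
  · rintro ⟨g, h, a, b, h1, h2, h3, h4, rfl⟩
    obtain ⟨x, hx, rfl⟩ := (LinearPMap.mem_graph_iff _).1 (mem_pcomp_graph.2 ⟨g, h1, h2⟩)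
    obtain ⟨y, hy, rfl⟩ := (LinearPMap.mem_graph_iff _).1 (mem_pcomp_graph.2 ⟨h, h3, h4⟩)
    replace hx : (x : H₁) = u := hx
    replace hy : (y : H₁) = u := hy
    have hu : u ∈ (pcomp T† T).domain := hx ▸ x.2
    have hu' : u ∈ (pcomp S S†).domain := hy ▸ y.2
    obtain rfl : x = ⟨u, hu⟩ := Subtype.ext hx
    obtain rfl : y = ⟨u, hu'⟩ := Subtype.ext hy
    exact (LinearPMap.mem_graph_iff _).2 ⟨⟨u, hu, hu'⟩, rfl, LinearPMap.add_apply _ _ _⟩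

/-- The triples `(u, Tu, S*u)`. -/
def formGraph : Submodule ℂ (WithLp 2 (H₁ × WithLp 2 (H₂ × H₀))) where
  carrier := {x | (x.fst, x.snd.fst) ∈ T.graph ∧ (x.fst, x.snd.snd) ∈ S†.graph}
  zero_mem' := ⟨T.graph.zero_mem, S†.graph.zero_mem⟩
  add_mem' := fun ha hb => ⟨T.graph.add_mem ha.1 hb.1, S†.graph.add_mem ha.2 hb.2⟩
  smul_mem' := fun c _ ha => ⟨T.graph.smul_mem c ha.1, S†.graph.smul_mem c ha.2⟩

variable {S T}

theorem isClosed_formGraph (hS : Dense (S.domain : Set H₀)) (hTc : T.IsClosed) :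
    IsClosed (formGraph S T : Set (WithLp 2 (H₁ × WithLp 2 (H₂ × H₀)))) := by
  refine IsClosed.inter (hTc.preimage ?_) ((LinearPMap.adjoint_isClosed hS).preimage ?_)
  · fun_prop
  · fun_prop

/-- `u` is the weak solution of `(T*T + SS* + 1) u = f`, with `g = T u` and `h = S* u`. -/
structure IsWeakSolution (S : H₀ →ₗ.[ℂ] H₁) (T : H₁ →ₗ.[ℂ] H₂) (f u : H₁) (g : H₂) (h : H₀) :
    Prop where
  left : (u, g) ∈ T.graph
  right : (u, h) ∈ S†.graph
  form : ∀ v g' h', (v, g') ∈ T.graph → (v, h') ∈ S†.graph →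
    inner ℂ u v + (inner ℂ g g' + inner ℂ h h') = inner ℂ f v

/-- The weak equation says that `(f, 0, 0) - (u, g, h)` is orthogonal to every `(v, Tv, S*v)`. Its
unique solution is therefore the orthogonal projection of `(f, 0, 0)` onto the closed space
`formGraph`. The resulting `R` is an inclusion, a projection and the adjoint of the inclusion, hence
self-adjoint. -/
theorem exists_weakSolution (hS : Dense (S.domain : Set H₀)) (hTc : T.IsClosed) :
    ∃ R : H₁ →L[ℂ] H₁, IsSelfAdjoint R ∧ (∀ f, ∃ g h, IsWeakSolution S T f (R f) g h) ∧
      ∀ f u g h, IsWeakSolution S T f u g h → R f = u := by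
  have : CompleteSpace (formGraph S T) := (isClosed_formGraph hS hTc).completeSpace_coe
  let P := (formGraph S T).starProjection
  let ι : H₁ →L[ℂ] WithLp 2 (H₁ × WithLp 2 (H₂ × H₀)) :=
    (WithLp.prodContinuousLinearEquiv 2 ℂ H₁ (WithLp 2 (H₂ × H₀))).symm.toContinuousLinearMap ∘L
      ContinuousLinearMap.inl ℂ H₁ (WithLp 2 (H₂ × H₀))
  have hι : ∀ f, ι f = WithLp.toLp 2 (f, 0) := fun f => rfl
  let π : WithLp 2 (H₁ × WithLp 2 (H₂ × H₀)) →L[ℂ] H₁ := WithLp.fstL 2 ℂ H₁ (WithLp 2 (H₂ × H₀))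
  have hπ : ∀ x, π x = x.fst := fun x => rfl
  have key : ∀ x f, inner ℂ (π x) f = inner ℂ x (ι f) := fun x f => by
    rw [WithLp.prod_inner_apply, hι, hπ]
    simp
  have key' : ∀ x f, inner ℂ f (π x) = inner ℂ (ι f) x := fun x f => by
    rw [WithLp.prod_inner_apply, hι, hπ]
    simp
  refine ⟨π ∘L P ∘L ι, ?_, ?_, ?_⟩
  · rw [ContinuousLinearMap.isSelfAdjoint_iff_isSymmetric]
    intro x y
    have : inner ℂ (P (ι x)) (ι y) = inner ℂ (ι x) (P (ι y)) :=
      (Submodule.starProjection_isSymmetric (K := formGraph S T)) (ι x) (ι y)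
    simpa [key, key'] using this
  · intro f
    have hm : P (ι f) ∈ formGraph S T := Submodule.starProjection_apply_mem _ _
    refine ⟨(P (ι f)).snd.fst, (P (ι f)).snd.snd, hm.1, hm.2, fun v g' h' hg hh => ?_⟩
    have := Submodule.starProjection_inner_eq_zero (K := formGraph S T) (ι f)
      (WithLp.toLp 2 (v, WithLp.toLp 2 (g', h'))) ⟨hg, hh⟩
    rw [inner_sub_left, sub_eq_zero] at this
    have h2 := this.symm
    simp only [WithLp.prod_inner_apply, hι] at h2
    change inner ℂ (P (ι f)).fst v + (inner ℂ (P (ι f)).snd.fst g' +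
      inner ℂ (P (ι f)).snd.snd h') = inner ℂ f v + (inner ℂ 0 g' + inner ℂ 0 h') at h2
    rw [inner_zero_left, inner_zero_left, add_zero, add_zero] at h2
    exact h2
  · intro f u g h hw
    have : P (ι f) = WithLp.toLp 2 (u, WithLp.toLp 2 (g, h)) := by
      refine Submodule.eq_starProjection_of_mem_of_inner_eq_zero ⟨hw.left, hw.right⟩ ?_
      intro w hm
      have := hw.form _ _ _ hm.1 hm.2
      rw [inner_sub_left, sub_eq_zero]
      simp only [WithLp.prod_inner_apply, hι]
      simpa using this.symm
    change (P (ι f)).fst = u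
    rw [this]
    rfl

/-- A complex `H₀ → H₁ → H₂` of closed densely defined operators. -/
structure IsHilbertComplex (S : H₀ →ₗ.[ℂ] H₁) (T : H₁ →ₗ.[ℂ] H₂) : Prop where
  dense_left : Dense (S.domain : Set H₀)
  closed_left : S.IsClosed
  dense_right : Dense (T.domain : Set H₁)
  closed_right : T.IsClosed
  comp_eq_zero : ∀ x y, (x, y) ∈ S.graph → (y, 0) ∈ T.graph

theorem IsHilbertComplex.isWeakSolution (hST : IsHilbertComplex S T) {u f : H₁} (hu : (u, f) ∈ (laplacian S T).graph) :
    ∃ g h, IsWeakSolution S T (f + u) u g h := by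
  obtain ⟨g, h, a, b, h1, h2, h3, h4, rfl⟩ := (KohnLaplacian.mem_laplacian_graph S T).1 hu
  refine ⟨g, h, h1, h3, fun v g' h' hg hh => ?_⟩
  have e1 := (mem_adjoint_graph hST.dense_right).1 h2 _ _ hg
  have e2 := (mem_adjoint_graph hST.dense_left).1 hh _ _ h4
  have e3 : inner ℂ h h' = inner ℂ b v := by
    rw [← inner_conj_symm h h', e2, inner_conj_symm]
  rw [inner_add_left, inner_add_left, e1, e3]
  ring

/-- Weak solutions are strong because the form domain splits along `ker T`. With `P` the projection
onto `ker T`, the part `P v` is killed by `T`, while `v - P v` is orthogonal to `ker T ⊇ ran S` and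
hence killed by `S†`. Testing with the two parts separately decouples the equation into `T† g = (1 -
P)(f - u)` and `S h = P (f - u)`. -/
theorem IsHilbertComplex.mem_laplacian_graph (hST : IsHilbertComplex S T) {f u : H₁} {g : H₂} {h : H₀}
    (hw : IsWeakSolution S T f u g h) : (u, f - u) ∈ (laplacian S T).graph := by
  let N : Submodule ℂ H₁ := T.graph.comap (LinearMap.inl ℂ H₁ H₂)
  have hN : IsClosed (N : Set H₁) := IsClosed.preimage (by fun_prop : Continuous fun x : H₁ => (x, (0 : H₂))) hST.closed_right
  have : CompleteSpace N := hN.completeSpace_coe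
  have hNm : ∀ x, x ∈ N ↔ (x, (0 : H₂)) ∈ T.graph := fun x => Iff.rfl
  let P := N.starProjection
  have hP1 : ∀ v, (P v, (0 : H₂)) ∈ T.graph := fun v =>
    Submodule.starProjection_apply_mem N v
  have hP2 : ∀ v, (v - P v, (0 : H₀)) ∈ S†.graph := fun v => by
    refine (mem_adjoint_graph hST.dense_left).2 fun x z hxz => ?_
    rw [inner_zero_left]
    exact (Submodule.starProjection_inner_eq_zero (K := N) v z (hST.comp_eq_zero _ _ hxz)).symm
  have hPs : ∀ x y, inner ℂ (P x) y = inner ℂ x (P y) := Submodule.starProjection_isSymmetric (K := N)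
  refine (KohnLaplacian.mem_laplacian_graph S T).2
    ⟨g, h, (f - u) - P (f - u), P (f - u), hw.left, ?_, hw.right, ?_, by abel⟩
  · refine (mem_adjoint_graph hST.dense_right).2 fun v g' hv => ?_
    -- An arbitrary `v` in the domain of `T` need not be admissible in the weak equation; `v - P v`
    -- is, and has the same image under `T`.
    have h1 : (v - P v, g') ∈ T.graph := by simpa using T.graph.sub_mem hv (hP1 v)
    have h2 := hw.form _ _ _ h1 (hP2 v)
    rw [inner_zero_right, add_zero] at h2
    rw [inner_sub_left, hPs, ← inner_sub_right, inner_sub_left, ← h2]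
    ring
  · refine mem_graph_of_adjoint hST.dense_left hST.closed_left fun v h' hv => ?_
    have h1 : (P v, h') ∈ S†.graph := by simpa using S†.graph.sub_mem hv (hP2 v)
    have h2 := hw.form _ _ _ (hP1 v) h1
    rw [inner_zero_right, zero_add] at h2
    have h3 : inner ℂ h h' = inner ℂ (P (f - u)) v := by
      rw [hPs, inner_sub_left, ← h2]
      ring
    rw [← inner_conj_symm h' h, h3, inner_conj_symm]

end Laplacian

/-! ### Operators with compact resolvent -/

section CompactResolvent

variable {H : Type*} [NormedAddCommGroup H] [InnerProductSpace ℂ H]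

/-- `R = (A + 1)⁻¹`. -/
structure IsResolvent (A : H →ₗ.[ℂ] H) (R : H →L[ℂ] H) : Prop where
  mem_graph : ∀ f, (R f, f - R f) ∈ A.graph
  apply_add : ∀ u f, (u, f) ∈ A.graph → R (f + u) = u

namespace IsResolvent

variable {A : H →ₗ.[ℂ] H} {R : H →L[ℂ] H}

/-- Since `(A - ζ) R = 1 - (ζ + 1) R`, an inverse `Z` of `A - ζ` gives the inverse `1 + (ζ + 1) Z`
on the right, and an inverse `U` of the right-hand side gives the inverse `R U` of `A - ζ`. -/
theorem mem_resolvent_iff (hR : IsResolvent A R) (ζ : ℂ) :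
    ζ ∈ resolvent A ↔ IsUnit (1 - (ζ + 1) • R) := by
  rw [isUnit_iff_exists]
  constructor
  · rintro ⟨Z, h1, h2⟩
    refine ⟨1 + (ζ + 1) • Z, ?_, ?_⟩
    · ext y
      obtain ⟨h, e⟩ := h1 y
      have h3 : (Z y, y + ζ • Z y) ∈ A.graph :=
        (LinearPMap.mem_graph_iff _).2 ⟨⟨Z y, h⟩, rfl, by rw [← sub_eq_iff_eq_add]; exact e⟩
      have h4 := hR.apply_add _ _ h3
      have h5 : R y + (ζ + 1) • R (Z y) = Z y := by
        simp only [map_add, map_smul] at h4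
        rw [← sub_eq_zero, ← sub_eq_zero.2 h4]
        module
      simp only [mul_apply_eq_comp, sub_apply,
        add_apply, one_apply_eq_self,
        smul_apply, map_add, map_smul]
      nth_rewrite 1 [← h5]
      module
    · ext y
      obtain ⟨x, hx, hx'⟩ := (LinearPMap.mem_graph_iff _).1 (hR.mem_graph y)
      have h3 := h2 x
      simp only at hx hx'
      rw [hx, hx'] at h3
      simp only [mul_apply_eq_comp, sub_apply,
        add_apply, one_apply_eq_self,
        smul_apply, map_sub, map_smul] at h3 ⊢
      have h5 : Z y = R y + (ζ + 1) • Z (R y) := by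
        nth_rewrite 1 [← h3]
        module
      rw [h5]
      module
  · rintro ⟨U, h1, h2⟩
    refine ⟨R ∘L U, fun y => ?_, fun x => ?_⟩
    · obtain ⟨x, hx, hx'⟩ := (LinearPMap.mem_graph_iff _).1 (hR.mem_graph (U y))
      replace hx : (x : H) = R (U y) := hx
      have h3 : R (U y) ∈ A.domain := hx ▸ x.2
      obtain rfl : x = ⟨R (U y), h3⟩ := Subtype.ext hx
      refine ⟨h3, ?_⟩
      have h4 := congrArg (fun Z : H →L[ℂ] H => Z y) h1
      simp only [mul_apply_eq_comp, sub_apply,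
        one_apply_eq_self, smul_apply] at h4
      refine Eq.trans ?_ h4
      change A ⟨R (U y), h3⟩ - ζ • R (U y) = _
      rw [hx']
      module
    · have h3 := hR.apply_add _ _ (A.mem_graph x)
      have h4 := congrArg (fun Z : H →L[ℂ] H => Z (A x + x)) h2
      simp only [mul_apply_eq_comp, sub_apply,
        one_apply_eq_self, smul_apply, h3] at h4
      have h5 : A x - ζ • (x : H) = A x + x - (ζ + 1) • (x : H) := by module
      rw [h5, ContinuousLinearMap.comp_apply, h4, h3]

theorem isUnit_one_sub_smul_iff {c : ℂ} (hc : c ≠ 0) :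
    IsUnit (1 - c • R) ↔ c⁻¹ ∉ spectrum ℂ R := by
  rw [spectrum.notMem_iff]
  have h : (1 - c • R) = (Units.mk0 c hc) • (algebraMap ℂ (H →L[ℂ] H) c⁻¹ - R) := by
    rw [Units.smul_def, Units.val_mk0, smul_sub, Algebra.algebraMap_eq_smul_one, smul_smul,
      mul_inv_cancel₀ hc, one_smul]
  rw [h, isUnit_smul_iff]

/-- Spectral mapping under `ζ ↦ (ζ + 1)⁻¹`. The point `-1` is excluded by hand, since Lean's `0⁻¹ =
0` may lie in the spectrum of `R`. -/
theorem mem_spec_iff (hR : IsResolvent A R) (ζ : ℂ) :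
    ζ ∈ spec A ↔ ζ + 1 ≠ 0 ∧ (ζ + 1)⁻¹ ∈ spectrum ℂ R := by
  rw [spec, Set.mem_compl_iff, hR.mem_resolvent_iff]
  by_cases hc : ζ + 1 = 0
  · simp [hc]
  · rw [isUnit_one_sub_smul_iff hc, not_not]
    simp [hc]

theorem isClosed_spec [CompleteSpace H] (hR : IsResolvent A R) : IsClosed (spec A) := by
  have h : resolvent A = (fun ζ : ℂ => 1 - (ζ + 1) • R) ⁻¹' {a | IsUnit a} :=
    Set.ext fun ζ => hR.mem_resolvent_iff ζ
  rw [spec, isClosed_compl_iff, h]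
  exact Units.isOpen.preimage (by fun_prop)

theorem mem_eigenspace_iff {ζ : ℂ} {x : A.domain} : x ∈ eigenspace A ζ ↔ A x = ζ • (x : H) := by
  rw [eigenspace, LinearMap.mem_ker, LinearMap.sub_apply, sub_eq_zero]
  rfl

/-- The eigenvectors of `A` are those of its resolvent. -/
theorem exists_eigenvector (hR : IsResolvent A R) {c : ℂ} (hc : c ≠ 0) {v : H}
    (hv : R v = c⁻¹ • v) : ∃ x : A.domain, (x : H) = v ∧ x ∈ eigenspace A (c - 1) := by
  have h := A.graph.smul_mem c (hR.mem_graph v)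
  rw [hv] at h
  obtain ⟨x, hx, hx'⟩ := (LinearPMap.mem_graph_iff _).1 h
  replace hx : (x : H) = v := by
    rw [hx]
    change c • c⁻¹ • v = v
    rw [smul_inv_smul₀ hc]
  refine ⟨x, hx, ?_⟩
  rw [mem_eigenspace_iff, hx, hx']
  change c • (v - c⁻¹ • v) = _
  rw [smul_sub, smul_inv_smul₀ hc]
  module

theorem apply_eigenvector (hR : IsResolvent A R) {c : ℂ} (hc : c ≠ 0) {x : A.domain}
    (hx : x ∈ eigenspace A (c - 1)) : R x = c⁻¹ • (x : H) := by
  have h := hR.apply_add _ _ (A.mem_graph x)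
  rw [mem_eigenspace_iff.1 hx] at h
  have h2 : (c - 1) • (x : H) + x = c • (x : H) := by module
  rw [h2, map_smul] at h
  nth_rewrite 2 [← h]
  rw [inv_smul_smul₀ hc]

theorem finiteDimensional_iff (hR : IsResolvent A R) {c : ℂ} (hc : c ≠ 0) :
    FiniteDimensional ℂ (eigenspace A (c - 1)) ↔
      FiniteDimensional ℂ (Module.End.eigenspace (R : Module.End ℂ H) c⁻¹) := by
  have h : (eigenspace A (c - 1)).map A.domain.subtype =
      Module.End.eigenspace (R : Module.End ℂ H) c⁻¹ := by
    ext v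
    rw [Module.End.mem_eigenspace_iff, Submodule.mem_map]
    constructor
    · rintro ⟨x, hx, rfl⟩
      exact hR.apply_eigenvector hc hx
    · intro hv
      obtain ⟨x, rfl, hx⟩ := hR.exists_eigenvector hc hv
      exact ⟨x, hx, rfl⟩
  rw [← h]
  exact Module.Finite.equiv_iff
    (Submodule.equivMapOfInjective A.domain.subtype A.domain.injective_subtype _)

end IsResolvent

variable [CompleteSpace H]

/-- Unit eigenvectors for distinct eigenvalues of modulus at least `δ` are orthogonal, so their
images under `R` are at mutual distance at least `√2 δ`. Infinitely many of them would contradict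
compactness. -/
theorem finite_spectrum_of_isCompactOperator {R : H →L[ℂ] H} (hR : IsSelfAdjoint R)
    (hc : IsCompactOperator R) {δ : ℝ} (hδ : 0 < δ) :
    {μ ∈ spectrum ℂ R | δ ≤ ‖μ‖}.Finite := by
  by_contra hinf
  let e := Set.Infinite.natEmbedding _ hinf
  have hs := (ContinuousLinearMap.isSelfAdjoint_iff_isSymmetric.1 hR)
  have h0 : ∀ n, (e n : ℂ) ≠ 0 := fun n h => by
    have := (e n).2.2
    rw [h, norm_zero] at this
    linarith
  have h1 : ∀ n, ∃ v : H, ‖v‖ = 1 ∧ R v = (e n : ℂ) • v := fun n => by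
    obtain ⟨v, hv⟩ := ((hc.hasEigenvalue_iff_mem_spectrum (h0 n)).2 (e n).2.1).exists_hasEigenvector
    have hn : (‖v‖ : ℂ) ≠ 0 := by simpa using hv.2
    refine ⟨(‖v‖ : ℂ)⁻¹ • v, by simp [norm_smul, inv_mul_cancel₀ (norm_ne_zero_iff.2 hv.2)], ?_⟩
    have : R v = (e n : ℂ) • v := hv.apply_eq_smul
    rw [map_smul, this, smul_comm]
  choose v hv1 hv2 using h1
  obtain ⟨K, hK, hK'⟩ := hc.image_closedBall_subset_compact (f := (R : H →ₗ[ℂ] H)) 1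
  obtain ⟨y, -, ψ, hψ, hψy⟩ := hK.tendsto_subseq
    (fun n => hK' ⟨v n, by simp [hv1], rfl⟩)
  obtain ⟨N, hN⟩ := Metric.cauchySeq_iff'.1 hψy.cauchySeq δ hδ
  have h2 := hN (N + 1) (by lia)
  simp only [Function.comp_apply, dist_eq_norm] at h2
  have horth : inner ℂ (v (ψ (N + 1))) (v (ψ N)) = 0 := by
    have hne : (e (ψ (N + 1)) : ℂ) ≠ e (ψ N) := fun h => by
      have := hψ.injective (e.injective (Subtype.ext h))
      lia
    exact hs.orthogonalFamily_eigenspaces hne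
      ⟨v (ψ (N + 1)), Module.End.mem_eigenspace_iff.2 (hv2 _)⟩
      ⟨v (ψ N), Module.End.mem_eigenspace_iff.2 (hv2 _)⟩
  have h3 : ‖R (v (ψ (N + 1))) - R (v (ψ N))‖ ^ 2 =
      ‖(e (ψ (N + 1)) : ℂ)‖ ^ 2 + ‖(e (ψ N) : ℂ)‖ ^ 2 := by
    rw [hv2, hv2, @norm_sub_sq ℂ, inner_smul_left, inner_smul_right, horth]
    simp [norm_smul, hv1]
  have h4 := (e (ψ (N + 1))).2.2
  have h5 : ‖R (v (ψ (N + 1))) - R (v (ψ N))‖ < δ := h2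
  nlinarith [norm_nonneg (R (v (ψ (N + 1))) - R (v (ψ N))), sq_nonneg ‖(e (ψ N) : ℂ)‖]

theorem IsResolvent.hasDiscreteSpectrum {A : H →ₗ.[ℂ] H} {R : H →L[ℂ] H} (hR : IsResolvent A R)
    (hsa : IsSelfAdjoint R) (hc : IsCompactOperator R) : HasDiscreteSpectrum A where
  real := fun ζ hζ => by
    obtain ⟨h0, h1⟩ := (hR.mem_spec_iff ζ).1 hζ
    have h2 := hsa.mem_spectrum_eq_re h1
    refine ⟨((ζ + 1)⁻¹.re)⁻¹ - 1, ?_⟩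
    push_cast
    rw [← h2, inv_inv, add_sub_cancel_right]
  discrete := by
    rw [isDiscrete_iff_forall_mem_exists_isOpen]
    intro ζ hζ
    -- Points of `spec A` at distance less than `r` from `-1` correspond to spectral values of `R`
    -- of modulus at least `1 / r`; the radius is chosen to contain `ζ` itself.
    have hfin : (spec A ∩ Metric.ball (-1) (‖ζ + 1‖ + 1)).Finite := by
      refine ((finite_spectrum_of_isCompactOperator hsa hc
        (δ := (‖ζ + 1‖ + 1)⁻¹) (by positivity)).image (fun μ => μ⁻¹ - 1)).subset ?_
      rintro ξ ⟨hξ, hb⟩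
      obtain ⟨h0, h1⟩ := (hR.mem_spec_iff ξ).1 hξ
      refine ⟨(ξ + 1)⁻¹, ⟨h1, ?_⟩, by simp⟩
      rw [norm_inv]
      refine inv_anti₀ (norm_pos_iff.2 h0) ?_
      rw [Metric.mem_ball, dist_eq_norm, sub_neg_eq_add] at hb
      exact hb.le
    refine ⟨Metric.ball (-1) (‖ζ + 1‖ + 1) ∩
      ((spec A ∩ Metric.ball (-1) (‖ζ + 1‖ + 1)) \ {ζ})ᶜ,
      Metric.isOpen_ball.inter (hfin.subset Set.sdiff_subset).isClosed.isOpen_compl, ?_⟩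
    ext ξ
    simp only [Set.mem_inter_iff, Set.mem_compl_iff, Set.mem_sdiff, Set.mem_singleton_iff]
    constructor
    · rintro ⟨⟨h1, h2⟩, h3⟩
      by_contra h4
      exact h2 ⟨⟨h3, h1⟩, h4⟩
    · rintro rfl
      refine ⟨⟨?_, fun h => h.2 rfl⟩, hζ⟩
      rw [Metric.mem_ball, dist_eq_norm, sub_neg_eq_add]
      linarith
  eigenvalue := fun ζ hζ => by
    obtain ⟨h0, h1⟩ := (hR.mem_spec_iff ζ).1 hζ
    obtain ⟨v, hv⟩ := ((hc.hasEigenvalue_iff_mem_spectrum (inv_ne_zero h0)).2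
      h1).exists_hasEigenvector
    obtain ⟨x, rfl, hx⟩ := hR.exists_eigenvector h0 hv.apply_eq_smul
    rw [add_sub_cancel_right] at hx
    intro hb
    rw [hb, Submodule.mem_bot] at hx
    exact hv.2 (by rw [hx]; rfl)
  finite_multiplicity := fun ζ hζ => by
    obtain ⟨h0, h1⟩ := (hR.mem_spec_iff ζ).1 hζ
    have h2 := (hR.finiteDimensional_iff h0).2
      (ContinuousLinearMap.finite_dimensional_eigenspace hc _ (inv_ne_zero h0))
    rwa [add_sub_cancel_right] at h2

/-- An operator which is small on subspaces of finite codimension is compact. -/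
theorem isCompactOperator_of_forall_small {R : H →L[ℂ] H}
    (h : ∀ ε > 0, ∃ V : Submodule ℂ H, FiniteDimensional ℂ V ∧ ∀ y ∈ Vᗮ, ‖R y‖ ≤ ε * ‖y‖) :
    IsCompactOperator R := by
  have hcl := isClosed_setOfPred_isCompactOperator (σ₁₂ := RingHom.id ℂ) (M₁ := H) (M₂ := H)
  refine hcl.closure_subset (Metric.mem_closure_iff.2 fun ε hε => ?_)
  obtain ⟨V, hV, hsmall⟩ := h (ε / 2) (by positivity)
  refine ⟨R ∘L V.starProjection, ?_, ?_⟩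
  · have : ProperSpace V := FiniteDimensional.proper ℂ V
    have h1 : IsCompactOperator (V.orthogonalProjectionOnto : H → V) :=
      isCompactOperator_of_locallyCompactSpace_dom V.orthogonalProjectionOnto
    exact h1.clm_comp (R ∘L V.subtypeL)
  · rw [dist_eq_norm]
    refine lt_of_le_of_lt (ContinuousLinearMap.opNorm_le_bound _ (half_pos hε).le fun y => ?_)
      (half_lt_self hε)
    have h1 : y - V.starProjection y ∈ Vᗮ := V.sub_starProjection_mem_orthogonal y
    have h2 : (R - R ∘L V.starProjection) y = R (y - V.starProjection y) := by simp
    rw [h2]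
    refine (hsmall _ h1).trans ?_
    gcongr
    rw [← Submodule.starProjection_orthogonal_val]
    exact Submodule.norm_starProjection_apply_le _ _

/-- The resolvent of an operator with discrete spectrum is a norm limit of operators of finite
rank. -/
theorem IsResolvent.exists_finiteRank {A : H →ₗ.[ℂ] H} {R : H →L[ℂ] H} (hR : IsResolvent A R)
    (hsa : IsSelfAdjoint R) (hA : HasDiscreteSpectrum A) {ε : ℝ} (hε : 0 < ε) :
    ∃ (V : Submodule ℂ H) (F : H →L[ℂ] H), FiniteDimensional ℂ V ∧ (∀ y, F y ∈ V) ∧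
      ∀ y, ‖R y - F y‖ ≤ ε * ‖y‖ := by
  have hmem : ∀ x ∈ spectrum ℝ R, x ≠ 0 → ((x : ℂ)⁻¹ - 1) ∈ spec A := fun x hx h0 => by
    refine (hR.mem_spec_iff _).2 ?_
    rw [sub_add_cancel, inv_inv]
    refine ⟨by simpa using h0, ?_⟩
    exact (spectrum.algebraMap_mem_iff (S := ℂ) (r := x)).2 hx
  -- Under `x ↦ x⁻¹ - 1` these points land in a bounded part of `spec A`, which is compact and
  -- discrete, hence finite.
  have hfin : ∀ δ > 0, {x ∈ spectrum ℝ R | δ ≤ |x|}.Finite := fun δ hδ => by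
    have h1 : (spec A ∩ Metric.closedBall 0 (δ⁻¹ + 1)).Finite :=
      ((isCompact_closedBall 0 (δ⁻¹ + 1)).inter_left hR.isClosed_spec).finite
        (hA.discrete.mono Set.inter_subset_left)
    refine Set.Finite.of_finite_image (f := fun x : ℝ => (x : ℂ)⁻¹ - 1) (h1.subset ?_) ?_
    · rintro _ ⟨x, ⟨hx, hx'⟩, rfl⟩
      have h0 : x ≠ 0 := fun h => by
        rw [h, abs_zero] at hx'
        linarith
      refine ⟨hmem x hx h0, ?_⟩
      rw [mem_closedBall_zero_iff]
      refine (norm_sub_le _ _).trans ?_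
      rw [norm_one, norm_inv, Complex.norm_real, Real.norm_eq_abs]
      gcongr
    · intro x _ y _ hxy
      simpa using hxy
  let s := (hfin ε hε).toFinset
  have hs : ∀ x, x ∈ s ↔ x ∈ spectrum ℝ R ∧ ε ≤ |x| := fun x => by simp [s]
  -- `f μ` is `μ` times the indicator of `{μ}`, so the functional calculus makes it `μ` times the
  -- spectral projection. It is continuous on the spectrum because a nonzero `μ` is isolated there.
  let f : ℝ → ℝ → ℝ := fun μ x => if x = μ then μ else 0
  have hf : ∀ μ ∈ s, ContinuousOn (f μ) (spectrum ℝ R) := fun μ hμ x hx => by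
    by_cases hxμ : x = μ
    · subst hxμ
      have h1 : {x} ∈ nhdsWithin x (spectrum ℝ R) := by
        refine mem_nhdsWithin.2 ⟨{y | ε / 2 < |y|} ∩ ({y ∈ spectrum ℝ R | ε / 2 ≤ |y|} \ {x})ᶜ,
          (isOpen_lt continuous_const continuous_abs).inter
            ((hfin (ε / 2) (by positivity)).subset Set.sdiff_subset).isClosed.isOpen_compl, ?_, ?_⟩
        · refine ⟨?_, fun h => h.2 rfl⟩
          have := ((hs x).1 hμ).2
          change ε / 2 < |x|
          linarith
        · rintro y ⟨⟨h2, h3⟩, h4⟩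
          by_contra h5
          exact h3 ⟨⟨h4, le_of_lt h2⟩, h5⟩
      refine ContinuousWithinAt.mono_of_mem_nhdsWithin ?_ h1
      exact continuousWithinAt_singleton
    · refine ContinuousAt.continuousWithinAt ?_
      refine (continuousAt_const (y := (0 : ℝ))).congr ?_
      filter_upwards [isOpen_ne.mem_nhds hxμ] with y hy
      simp [f, hy]
  refine ⟨s.sup fun μ => Module.End.eigenspace (R : Module.End ℂ H) (μ : ℂ),
    cfc (fun x => ∑ μ ∈ s, f μ x) R, ?_, ?_, ?_⟩
  · have : ∀ μ ∈ s, FiniteDimensional ℂ (Module.End.eigenspace (R : Module.End ℂ H) (μ : ℂ)) := by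
      intro μ hμ
      have h0 : μ ≠ 0 := fun h => by
        have := ((hs μ).1 hμ).2
        rw [h, abs_zero] at this
        linarith
      have h1 := hA.finite_multiplicity _ (hmem μ ((hs μ).1 hμ).1 h0)
      rw [hR.finiteDimensional_iff (inv_ne_zero (by simpa using h0)), inv_inv] at h1
      exact h1
    rw [Finset.sup_eq_iSup, iSup_subtype']
    have : ∀ μ : {μ // μ ∈ s}, FiniteDimensional ℂ
      (Module.End.eigenspace (R : Module.End ℂ H) ((μ : ℝ) : ℂ)) := fun μ => this μ μ.2
    infer_instance
  · intro y
    have hsum : cfc (fun x => ∑ μ ∈ s, f μ x) R = ∑ μ ∈ s, cfc (f μ) R := by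
      rw [← cfc_sum (fun μ => f μ) R s hf]
      congr 1
      ext x
      simp
    rw [hsum, sum_apply]
    refine Submodule.sum_mem _ fun μ hμ => ?_
    refine (Finset.le_sup (f := fun μ : ℝ => Module.End.eigenspace (R : Module.End ℂ H) (μ : ℂ))
      hμ) (Module.End.mem_eigenspace_iff.2 ?_)
    -- From `x · f μ x = μ · f μ x`: the range of `f μ (R)` consists of eigenvectors, and their span
    -- has finite dimension by hypothesis.
    have h1 : R * cfc (f μ) R = μ • cfc (f μ) R := by
      nth_rewrite 1 [← cfc_id ℝ R]
      rw [← cfc_mul id (f μ) R continuousOn_id (hf μ hμ), ← cfc_smul μ (f μ) R (hf μ hμ)]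
      congr 1
      ext x
      by_cases hx : x = μ <;> simp [f, hx]
    exact congrArg (fun Z : H →L[ℂ] H => Z y) h1
  · intro y
    have hcont : ContinuousOn (fun x => ∑ μ ∈ s, f μ x) (spectrum ℝ R) :=
      continuousOn_finsetSum s hf
    have h1 : R - cfc (fun x => ∑ μ ∈ s, f μ x) R = cfc (fun x => x - ∑ μ ∈ s, f μ x) R := by
      nth_rewrite 1 [← cfc_id ℝ R]
      rw [← cfc_sub id _ R continuousOn_id hcont]
      rfl
    -- After removing all spectral values of modulus at least `ε`, what is left of the identity
    -- function on the spectrum is bounded by `ε`.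
    have h2 : ‖R - cfc (fun x => ∑ μ ∈ s, f μ x) R‖ ≤ ε := by
      rw [h1]
      refine norm_cfc_le hε.le fun x hx => ?_
      simp only [f, Finset.sum_ite_eq]
      split_ifs with h3
      · simpa using hε.le
      · rw [sub_zero, Real.norm_eq_abs]
        by_contra h4
        exact h3 ((hs x).2 ⟨hx, (not_le.1 h4).le⟩)
    exact ContinuousLinearMap.le_of_opNorm_le _ h2 y

end CompactResolvent

/-! ### Discreteness of the spectrum and compactness estimates for the energy form -/

section Laplacian

variable {H₀ H₁ H₂ : Type*} [NormedAddCommGroup H₀] [InnerProductSpace ℂ H₀] [CompleteSpace H₀]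
  [NormedAddCommGroup H₁] [InnerProductSpace ℂ H₁] [CompleteSpace H₁]
  [NormedAddCommGroup H₂] [InnerProductSpace ℂ H₂] [CompleteSpace H₂]
  {S : H₀ →ₗ.[ℂ] H₁} {T : H₁ →ₗ.[ℂ] H₂}

/-- The weak equation tested with the solution `u` itself. -/
theorem IsWeakSolution.energy {f u : H₁} {g : H₂} {h : H₀} (hw : IsWeakSolution S T f u g h) :
    ‖u‖ ^ 2 + ‖g‖ ^ 2 + ‖h‖ ^ 2 ≤ ‖f‖ * ‖u‖ := by
  have h1 := congrArg Complex.re (hw.form u g h hw.left hw.right)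
  have e1 : (inner ℂ u u).re = ‖u‖ ^ 2 := inner_self_eq_norm_sq (𝕜 := ℂ) u
  have e2 : (inner ℂ g g).re = ‖g‖ ^ 2 := inner_self_eq_norm_sq (𝕜 := ℂ) g
  have e3 : (inner ℂ h h).re = ‖h‖ ^ 2 := inner_self_eq_norm_sq (𝕜 := ℂ) h
  rw [Complex.add_re, Complex.add_re, e1, e2, e3] at h1
  have h2 := (Complex.re_le_norm (inner ℂ f u)).trans (norm_inner_le_norm f u)
  linarith

theorem IsHilbertComplex.isResolvent (hST : IsHilbertComplex S T) :
    ∃ R : H₁ →L[ℂ] H₁, IsResolvent (laplacian S T) R ∧ IsSelfAdjoint R ∧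
      ∀ f, ∃ g h, IsWeakSolution S T f (R f) g h := by
  obtain ⟨R, h1, h2, h3⟩ := exists_weakSolution hST.dense_left hST.closed_right
  refine ⟨R, ⟨fun f => ?_, fun u f hu => ?_⟩, h1, h2⟩
  · obtain ⟨g, h, hw⟩ := h2 f
    exact hST.mem_laplacian_graph hw
  · obtain ⟨g, h, hw⟩ := hST.isWeakSolution hu
    exact h3 _ _ _ _ hw

/-- A compactness estimate for the form of the Laplacian implies discreteness of its spectrum. -/
theorem IsHilbertComplex.hasDiscreteSpectrum (hST : IsHilbertComplex S T)
    (hcpt : ∀ ε > 0, ∃ s : Finset H₁, ∀ u g h, (u, g) ∈ T.graph → (u, h) ∈ S†.graph →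
      (∀ y ∈ s, inner ℂ y u = 0) → ‖u‖ ^ 2 ≤ ε * (‖u‖ ^ 2 + ‖g‖ ^ 2 + ‖h‖ ^ 2)) :
    HasDiscreteSpectrum (laplacian S T) := by
  obtain ⟨R, hR, hsa, hw⟩ := hST.isResolvent
  refine hR.hasDiscreteSpectrum hsa (isCompactOperator_of_forall_small fun ε hε => ?_)
  obtain ⟨s, hs⟩ := hcpt ε hε
  -- By self-adjointness, `y ⊥ R(s)` is the same as `R y ⊥ s`, so the estimate applies to `R y`.
  -- With the energy bound it reads `‖R y‖² ≤ ε ‖y‖ ‖R y‖`.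
  refine ⟨Submodule.span ℂ (R '' s),
    FiniteDimensional.span_of_finite ℂ (s.finite_toSet.image R), fun y hy => ?_⟩
  obtain ⟨g, h, hgh⟩ := hw y
  have h1 := hs (R y) g h hgh.left hgh.right fun v hv => by
    have := (ContinuousLinearMap.isSelfAdjoint_iff_isSymmetric.1 hsa) v y
    refine this.symm.trans ?_
    exact (Submodule.mem_orthogonal _ _).1 hy _ (Submodule.subset_span ⟨v, hv, rfl⟩)
  have h2 := h1.trans (mul_le_mul_of_nonneg_left hgh.energy hε.le)
  rcases (norm_nonneg (R y)).eq_or_lt with h0 | h0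
  · rw [← h0]
    positivity
  · refine le_of_mul_le_mul_right ?_ h0
    linarith

/-- The compactness estimate for the form of a Laplacian with discrete spectrum. -/
theorem IsHilbertComplex.exists_finiteRank (hST : IsHilbertComplex S T)
    (hd : HasDiscreteSpectrum (laplacian S T)) {ε : ℝ} (hε : 0 < ε) :
    ∃ (V : Submodule ℂ H₁) (F : H₁ →L[ℂ] H₁), FiniteDimensional ℂ V ∧ (∀ y, F y ∈ V) ∧
      ∀ u g h, (u, g) ∈ T.graph → (u, h) ∈ S†.graph →
        ‖u‖ ^ 3 ≤ (‖u‖ ^ 2 + ‖g‖ ^ 2 + ‖h‖ ^ 2) * (ε * ‖u‖ + ‖F u‖) := by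
  obtain ⟨R, hR, hsa, hw⟩ := hST.isResolvent
  obtain ⟨V, F, hV, hF, hRF⟩ := hR.exists_finiteRank hsa hd hε
  refine ⟨V, F, hV, hF, fun u g h hg hh => ?_⟩
  obtain ⟨g₀, h₀, hgh⟩ := hw u
  -- The weak equation for `R u` tested with `u` expresses `‖u‖²` as the energy pairing of `R u`
  -- with `u`.
  have h1 := hgh.form u g h hg hh
  have h2 : ‖u‖ ^ 2 ≤ ‖R u‖ * ‖u‖ + (‖g₀‖ * ‖g‖ + ‖h₀‖ * ‖h‖) := by
    have h3 : ‖u‖ ^ 2 = ‖inner ℂ u u‖ := by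
      rw [inner_self_eq_norm_sq_to_K]
      simp
    rw [h3, ← h1]
    refine (norm_add_le _ _).trans (add_le_add (norm_inner_le_norm _ _) ?_)
    exact (norm_add_le _ _).trans (add_le_add (norm_inner_le_norm _ _) (norm_inner_le_norm _ _))
  have h3 : ‖R u‖ ≤ ε * ‖u‖ + ‖F u‖ := by
    have := norm_le_norm_add_norm_sub' (R u) (F u)
    linarith [hRF u]
  have h4 := hgh.energy.trans (mul_le_mul_of_nonneg_left h3 (norm_nonneg u))
  -- Cauchy–Schwarz for the energy pairing. Since the energy of `R u` is at most `‖u‖ ‖R u‖`, it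
  -- yields `‖u‖⁴ ≤ ‖u‖ ‖R u‖ E(u)`; one factor `‖u‖` is then cancelled, whence the cube in the
  -- conclusion.
  have h5 : (‖R u‖ * ‖u‖ + (‖g₀‖ * ‖g‖ + ‖h₀‖ * ‖h‖)) ^ 2 ≤
      (‖R u‖ ^ 2 + ‖g₀‖ ^ 2 + ‖h₀‖ ^ 2) * (‖u‖ ^ 2 + ‖g‖ ^ 2 + ‖h‖ ^ 2) := by
    nlinarith [sq_nonneg (‖R u‖ * ‖g‖ - ‖g₀‖ * ‖u‖), sq_nonneg (‖R u‖ * ‖h‖ - ‖h₀‖ * ‖u‖),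
      sq_nonneg (‖g₀‖ * ‖h‖ - ‖h₀‖ * ‖g‖)]
  rcases (norm_nonneg u).eq_or_lt with h0 | h0
  · rw [← h0]
    simp only [ne_eq, OfNat.ofNat_ne_zero, not_false_eq_true, zero_pow]
    positivity
  · refine le_of_mul_le_mul_right ?_ h0
    have h6 : (‖u‖ ^ 2) ^ 2 ≤ (‖R u‖ * ‖u‖ + (‖g₀‖ * ‖g‖ + ‖h₀‖ * ‖h‖)) ^ 2 :=
      pow_le_pow_left₀ (by positivity) h2 2
    have h7 := mul_le_mul_of_nonneg_right h4 (by positivity : 0 ≤ ‖u‖ ^ 2 + ‖g‖ ^ 2 + ‖h‖ ^ 2)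
    nlinarith

end Laplacian

/-! ### Wirtinger calculus -/

section Wirtinger

/-- `∂̄` in the complex direction `e`. -/
def dbar (e : ℂ × ℂ) (η : ℂ × ℂ → ℂ) (p : ℂ × ℂ) : ℂ :=
  (fderiv ℝ η p e + I * fderiv ℝ η p (I • e)) / 2

/-- `∂` in the complex direction `e`. -/
def del (e : ℂ × ℂ) (η : ℂ × ℂ → ℂ) (p : ℂ × ℂ) : ℂ :=
  (fderiv ℝ η p e - I * fderiv ℝ η p (I • e)) / 2

theorem dbarZ_eq (η : ℂ × ℂ → ℂ) : dbarZ η = dbar (1, 0) η := by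
  ext p
  simp [dbarZ, dbar]

theorem dbarW_eq (η : ℂ × ℂ → ℂ) : dbarW η = dbar (0, 1) η := by
  ext p
  simp [dbarW, dbar]

variable {f g : ℂ × ℂ → ℂ} {e e' : ℂ × ℂ}

theorem contDiff_fderiv_apply (hf : ContDiff ℝ ∞ f) (v : ℂ × ℂ) :
    ContDiff ℝ ∞ fun p => fderiv ℝ f p v :=
  (hf.fderiv_right (m := ∞) (by simp)).clm_apply contDiff_const

theorem contDiff_dbar (hf : ContDiff ℝ ∞ f) (e : ℂ × ℂ) : ContDiff ℝ ∞ (dbar e f) := by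
  have h1 := contDiff_fderiv_apply hf e
  have h2 := contDiff_fderiv_apply hf (I • e)
  unfold dbar
  fun_prop

theorem contDiff_del (hf : ContDiff ℝ ∞ f) (e : ℂ × ℂ) : ContDiff ℝ ∞ (del e f) := by
  have h1 := contDiff_fderiv_apply hf e
  have h2 := contDiff_fderiv_apply hf (I • e)
  unfold del
  fun_prop

theorem support_dbar_subset (e : ℂ × ℂ) (f : ℂ × ℂ → ℂ) : Function.support (dbar e f) ⊆ tsupport f := by
  refine Set.Subset.trans (fun p hp => ?_) (support_fderiv_subset ℝ (f := f))
  contrapose! hp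
  simp only [Function.mem_support, ne_eq, not_not] at hp
  simp [dbar, hp]

theorem support_del_subset (e : ℂ × ℂ) (f : ℂ × ℂ → ℂ) : Function.support (del e f) ⊆ tsupport f := by
  refine Set.Subset.trans (fun p hp => ?_) (support_fderiv_subset ℝ (f := f))
  contrapose! hp
  simp only [Function.mem_support, ne_eq, not_not] at hp
  simp [del, hp]

theorem IsTest.dbar (hf : IsTest f) (e : ℂ × ℂ) : IsTest (dbar e f) :=
  ⟨contDiff_dbar hf.smooth e, hf.compact.mono' (support_dbar_subset e f)⟩

theorem IsTest.del (hf : IsTest f) (e : ℂ × ℂ) : IsTest (del e f) :=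
  ⟨contDiff_del hf.smooth e, hf.compact.mono' (support_del_subset e f)⟩

theorem IsTest.mul_left (hf : IsTest f) (hg : ContDiff ℝ ∞ g) : IsTest fun p => g p * f p :=
  ⟨hg.mul hf.smooth, hf.compact.mul_left⟩

theorem IsTest.mul_right (hf : IsTest f) (hg : ContDiff ℝ ∞ g) : IsTest fun p => f p * g p :=
  ⟨hf.smooth.mul hg, hf.compact.mul_right⟩

theorem IsTest.add (hf : IsTest f) (hg : IsTest g) : IsTest fun p => f p + g p :=
  ⟨hf.smooth.add hg.smooth, hf.compact.add hg.compact⟩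

theorem IsTest.neg (hf : IsTest f) : IsTest fun p => -f p :=
  ⟨hf.smooth.neg, hf.compact.comp_left (g := fun z : ℂ => -z) neg_zero⟩

theorem IsTest.sub (hf : IsTest f) (hg : IsTest g) : IsTest fun p => f p - g p := by
  simpa only [sub_eq_add_neg] using hf.add hg.neg

theorem contDiff_conj_comp (hf : ContDiff ℝ ∞ f) : ContDiff ℝ ∞ fun p => conj (f p) :=
  Complex.conjCLE.contDiff.comp hf

theorem IsTest.conj (hf : IsTest f) : IsTest fun p => conj (f p) :=
  ⟨contDiff_conj_comp hf.smooth, hf.compact.comp_left (g := fun z : ℂ => starRingEnd ℂ z) (map_zero _)⟩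

theorem IsTest.integrable (hf : IsTest f) : Integrable f :=
  hf.smooth.continuous.integrable_of_hasCompactSupport hf.compact

theorem dbar_mul (hf : Differentiable ℝ f) (hg : Differentiable ℝ g) (e p : ℂ × ℂ) :
    dbar e (fun q => f q * g q) p = dbar e f p * g p + f p * dbar e g p := by
  unfold dbar
  rw [fderiv_fun_mul (hf p) (hg p)]
  simp only [add_apply, smul_apply, smul_eq_mul]
  ring

theorem del_mul (hf : Differentiable ℝ f) (hg : Differentiable ℝ g) (e p : ℂ × ℂ) :
    del e (fun q => f q * g q) p = del e f p * g p + f p * del e g p := by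
  unfold del
  rw [fderiv_fun_mul (hf p) (hg p)]
  simp only [add_apply, smul_apply, smul_eq_mul]
  ring

theorem dbar_add (hf : Differentiable ℝ f) (hg : Differentiable ℝ g) (e p : ℂ × ℂ) :
    dbar e (fun q => f q + g q) p = dbar e f p + dbar e g p := by
  unfold dbar
  rw [fderiv_fun_add (hf p) (hg p)]
  simp only [add_apply]
  ring

theorem dbar_neg (f : ℂ × ℂ → ℂ) (e p : ℂ × ℂ) :
    dbar e (fun q => -f q) p = -dbar e f p := by
  unfold dbar
  rw [fderiv_fun_neg]
  simp only [neg_apply]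
  ring

theorem dbar_const_mul (hf : Differentiable ℝ f) (c : ℂ) (e p : ℂ × ℂ) :
    dbar e (fun q => c * f q) p = c * dbar e f p := by
  unfold dbar
  rw [fderiv_const_mul (hf p)]
  simp only [smul_apply, smul_eq_mul]
  ring

theorem dbar_sum {ι : Type*} {s : Finset ι} {F : ι → ℂ × ℂ → ℂ}
    (hF : ∀ i ∈ s, Differentiable ℝ (F i)) (e p : ℂ × ℂ) :
    dbar e (fun q => ∑ i ∈ s, F i q) p = ∑ i ∈ s, dbar e (F i) p := by
  unfold dbar
  rw [fderiv_fun_sum fun i hi => hF i hi p]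
  simp only [sum_apply, Finset.mul_sum, ← Finset.sum_add_distrib, Finset.sum_div]

theorem del_sum {ι : Type*} {s : Finset ι} {F : ι → ℂ × ℂ → ℂ}
    (hF : ∀ i ∈ s, Differentiable ℝ (F i)) (e p : ℂ × ℂ) :
    del e (fun q => ∑ i ∈ s, F i q) p = ∑ i ∈ s, del e (F i) p := by
  unfold del
  rw [fderiv_fun_sum fun i hi => hF i hi p]
  simp only [sum_apply, Finset.mul_sum, ← Finset.sum_sub_distrib, Finset.sum_div]

theorem fderiv_conj_apply (hf : Differentiable ℝ f) (p v : ℂ × ℂ) :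
    fderiv ℝ (fun q => conj (f q)) p v = conj (fderiv ℝ f p v) := by
  have := (Complex.conjCLE.toContinuousLinearMap.hasFDerivAt.comp p (hf p).hasFDerivAt).fderiv
  exact congrArg (fun L : ℂ × ℂ →L[ℝ] ℂ => L v) this

theorem dbar_conj (hf : Differentiable ℝ f) (e p : ℂ × ℂ) :
    dbar e (fun q => conj (f q)) p = conj (del e f p) := by
  simp only [dbar, del, fderiv_conj_apply hf, map_div₀, map_sub, map_mul, conj_I, map_ofNat]
  ring

theorem del_conj (hf : Differentiable ℝ f) (e p : ℂ × ℂ) :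
    del e (fun q => conj (f q)) p = conj (dbar e f p) := by
  simp only [dbar, del, fderiv_conj_apply hf, map_div₀, map_add, map_mul, conj_I, map_ofNat]
  ring

theorem fderiv_fderiv_apply_comm (hf : ContDiff ℝ ∞ f) (p v w : ℂ × ℂ) :
    fderiv ℝ (fun q => fderiv ℝ f q v) p w = fderiv ℝ (fun q => fderiv ℝ f q w) p v := by
  have hd : Differentiable ℝ (fderiv ℝ f) := (hf.fderiv_right (m := ∞) (by simp)).differentiable
    (by simp)
  have h : IsSymmSndFDerivAt ℝ f p := hf.contDiffAt.isSymmSndFDerivAt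
    (by simpa using (WithTop.coe_le_coe.2 le_top : ((2 : ℕ∞) : WithTop ℕ∞) ≤ ∞))
  rw [fderiv_clm_apply (hd p) (differentiableAt_const v),
    fderiv_clm_apply (hd p) (differentiableAt_const w)]
  simpa using h w v

theorem fderiv_dbar_apply (hf : ContDiff ℝ ∞ f) (e p v : ℂ × ℂ) :
    fderiv ℝ (dbar e f) p v = dbar e (fun q => fderiv ℝ f q v) p := by
  have h1 : Differentiable ℝ fun p => fderiv ℝ f p e :=
    (contDiff_fderiv_apply hf e).differentiable (by simp)
  have h2 : Differentiable ℝ fun p => fderiv ℝ f p (I • e) :=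
    (contDiff_fderiv_apply hf (I • e)).differentiable (by simp)
  have h3 : dbar e f = fun q => (1 / 2 : ℂ) * fderiv ℝ f q e + (I / 2) * fderiv ℝ f q (I • e) := by
    ext q
    rw [dbar]
    ring
  rw [h3, fderiv_fun_add ((h1 p).const_mul _) ((h2 p).const_mul _), fderiv_const_mul (h1 p),
    fderiv_const_mul (h2 p), dbar]
  simp only [add_apply, smul_apply, smul_eq_mul, fderiv_fderiv_apply_comm hf p v]
  ring

/-- Both `∂` and `∂̄` are combinations of two real directional derivatives, so this single formula
shows that `∂̄` commutes with each of them. -/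
theorem dbar_fderiv_combination (hf : ContDiff ℝ ∞ f) (e p v w : ℂ × ℂ) (a b : ℂ) :
    dbar e (fun q => a * fderiv ℝ f q v + b * fderiv ℝ f q w) p =
      a * fderiv ℝ (dbar e f) p v + b * fderiv ℝ (dbar e f) p w := by
  have h1 : Differentiable ℝ fun p => fderiv ℝ f p v :=
    (contDiff_fderiv_apply hf v).differentiable (by simp)
  have h2 : Differentiable ℝ fun p => fderiv ℝ f p w :=
    (contDiff_fderiv_apply hf w).differentiable (by simp)
  rw [dbar_add (h1.const_mul a) (h2.const_mul b), dbar_const_mul h1, dbar_const_mul h2,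
    fderiv_dbar_apply hf, fderiv_dbar_apply hf]

theorem dbar_del_comm (hf : ContDiff ℝ ∞ f) (e e' p : ℂ × ℂ) :
    dbar e (del e' f) p = del e' (dbar e f) p := by
  have h : del e' f = fun q => (1 / 2 : ℂ) * fderiv ℝ f q e' + (-I / 2) * fderiv ℝ f q (I • e') := by
    ext q
    rw [del]
    ring
  rw [h, dbar_fderiv_combination hf, del]
  ring

theorem dbar_dbar_comm (hf : ContDiff ℝ ∞ f) (e e' p : ℂ × ℂ) :
    dbar e (dbar e' f) p = dbar e' (dbar e f) p := by
  have h : dbar e' f = fun q => (1 / 2 : ℂ) * fderiv ℝ f q e' + (I / 2) * fderiv ℝ f q (I • e') := by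
    ext q
    rw [dbar]
    ring
  rw [h, dbar_fderiv_combination hf]
  conv_rhs => rw [dbar]
  ring

theorem integral_fderiv_apply (hf : IsTest f) (v : ℂ × ℂ) : ∫ p, fderiv ℝ f p v = 0 := by
  have : (volume : Measure (ℂ × ℂ)).IsAddHaarMeasure :=
    inferInstanceAs ((volume : Measure ℂ).prod (volume : Measure ℂ)).IsAddHaarMeasure
  have hi : Integrable (fun p => fderiv ℝ f p v) :=
    (contDiff_fderiv_apply hf.smooth v).continuous.integrable_of_hasCompactSupport
      (hf.compact.fderiv_apply ℝ v)
  have := integral_mul_fderiv_eq_neg_fderiv_mul_of_integrable 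
    (μ := (volume : Measure (ℂ × ℂ))) (f := fun _ => (1 : ℂ)) (g := f) (v := v)
    (by simp) (by simpa using hi) (by simpa using hf.integrable)
    (fun x _ => differentiableAt_const _) (fun x _ => hf.smooth.differentiable (by simp) x)
  simpa using this

theorem integral_dbar (hf : IsTest f) (e : ℂ × ℂ) : ∫ p, dbar e f p = 0 := by
  have hi : ∀ v, Integrable (fun p => fderiv ℝ f p v) := fun v =>
    (contDiff_fderiv_apply hf.smooth v).continuous.integrable_of_hasCompactSupport
      (hf.compact.fderiv_apply ℝ v)
  simp only [dbar]
  rw [integral_div, integral_add (hi _) ((hi _).const_mul I), integral_const_mul,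
    integral_fderiv_apply hf, integral_fderiv_apply hf]
  simp

theorem dbar_of_holomorphic (hf : Differentiable ℂ f) (e p : ℂ × ℂ) : dbar e f p = 0 := by
  rw [dbar, (hf p).fderiv_restrictScalars ℝ]
  simp only [ContinuousLinearMap.coe_restrictScalars', map_smul, smul_eq_mul, ← mul_assoc, I_mul_I]
  ring

theorem del_of_holomorphic (hf : Differentiable ℂ f) (e p : ℂ × ℂ) :
    del e f p = fderiv ℂ f p e := by
  rw [del, (hf p).fderiv_restrictScalars ℝ]
  simp only [ContinuousLinearMap.coe_restrictScalars', map_smul, smul_eq_mul, ← mul_assoc, I_mul_I]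
  ring

/-- The chain rule for a smooth function of a real function. -/
theorem dbar_comp_real {χ : ℝ → ℝ} {q : ℂ × ℂ → ℝ} (hχ : Differentiable ℝ χ)
    (hq : Differentiable ℝ q) (e p : ℂ × ℂ) :
    dbar e (fun x => (χ (q x) : ℂ)) p = ((deriv χ (q p) : ℝ) : ℂ) * dbar e (fun x => (q x : ℂ)) p := by
  have h1 : ∀ {r : ℂ × ℂ → ℝ}, Differentiable ℝ r → ∀ v,
      fderiv ℝ (fun x => (r x : ℂ)) p v = (fderiv ℝ r p v : ℂ) := fun {r} hr v => by
    have := (Complex.ofRealCLM.hasFDerivAt.comp p (hr p).hasFDerivAt).fderiv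
    exact congrArg (fun L : ℂ × ℂ →L[ℝ] ℂ => L v) this
  have h2 : ∀ v, fderiv ℝ (fun x => χ (q x)) p v = deriv χ (q p) * fderiv ℝ q p v := fun v => by
    have := ((hχ (q p)).hasDerivAt.comp_hasFDerivAt p (hq p).hasFDerivAt).fderiv
    exact congrArg (fun L : ℂ × ℂ →L[ℝ] ℝ => L v) this
  have h3 : Differentiable ℝ fun x => χ (q x) := hχ.comp hq
  rw [dbar, dbar, h1 h3, h1 h3, h1 hq, h1 hq, h2, h2]
  push_cast
  ring

end Wirtinger

/-! ### The weighted integration by parts formulas -/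

section Weighted

/-- The density `e^{-2φ}`. -/
def wt (φ : ℂ × ℂ → ℝ) (p : ℂ × ℂ) : ℝ := Real.exp (-2 * φ p)

/-- The formal adjoint `-∂ + 2 ∂φ` of `∂̄` in the direction `e`. -/
def delta (φ : ℂ × ℂ → ℝ) (e : ℂ × ℂ) (f : ℂ × ℂ → ℂ) (p : ℂ × ℂ) : ℂ :=
  -del e f p + 2 * del e (fun q => (φ q : ℂ)) p * f p

variable {φ : ℂ × ℂ → ℝ} {f g : ℂ × ℂ → ℂ}

theorem wt_pos (φ : ℂ × ℂ → ℝ) (p : ℂ × ℂ) : 0 < wt φ p := Real.exp_pos _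

theorem contDiff_ofReal_comp (hφ : ContDiff ℝ ∞ φ) : ContDiff ℝ ∞ fun q => (φ q : ℂ) :=
  Complex.ofRealCLM.contDiff.comp hφ

theorem contDiff_wt (hφ : ContDiff ℝ ∞ φ) : ContDiff ℝ ∞ (wt φ) :=
  Real.contDiff_exp.comp (contDiff_const.mul hφ)

theorem contDiff_delta (hφ : ContDiff ℝ ∞ φ) (hf : ContDiff ℝ ∞ f) (e : ℂ × ℂ) :
    ContDiff ℝ ∞ (delta φ e f) :=
  (contDiff_del hf e).neg.add
    ((contDiff_const.mul (contDiff_del (contDiff_ofReal_comp hφ) e)).mul hf)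

theorem IsTest.delta (hf : IsTest f) (hφ : ContDiff ℝ ∞ φ) (e : ℂ × ℂ) : IsTest (delta φ e f) :=
  (hf.del e).neg.add
    (hf.mul_left (contDiff_const.mul (contDiff_del (contDiff_ofReal_comp hφ) e)))

theorem dbar_wt (hφ : ContDiff ℝ ∞ φ) (e p : ℂ × ℂ) :
    dbar e (fun q => (wt φ q : ℂ)) p = -2 * dbar e (fun q => (φ q : ℂ)) p * wt φ p := by
  have h1 : ∀ t : ℝ, HasDerivAt (fun t => Real.exp (-2 * t)) (Real.exp (-2 * t) * -2) t := fun t =>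
    by simpa using ((hasDerivAt_id t).const_mul (-2)).exp
  have h2 := dbar_comp_real (χ := fun t => Real.exp (-2 * t)) (fun t => (h1 t).differentiableAt)
    (hφ.differentiable (by simp)) e p
  rw [(h1 _).deriv] at h2
  refine h2.trans ?_
  rw [wt]
  push_cast
  ring

theorem conj_del_ofReal (hφ : ContDiff ℝ ∞ φ) (e p : ℂ × ℂ) :
    conj (del e (fun q => (φ q : ℂ)) p) = dbar e (fun q => (φ q : ℂ)) p := by
  rw [← dbar_conj ((contDiff_ofReal_comp hφ).differentiable (by simp))]
  simp

theorem IsTest.mul_conj_mul_wt (hf : IsTest f) (hg : ContDiff ℝ ∞ g) (hφ : ContDiff ℝ ∞ φ) :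
    IsTest fun p => f p * conj (g p) * wt φ p :=
  (hf.mul_right (contDiff_conj_comp hg)).mul_right (contDiff_ofReal_comp (contDiff_wt hφ))

theorem IsTest.mul_conj_mul_wt' (hg : IsTest g) (hf : ContDiff ℝ ∞ f) (hφ : ContDiff ℝ ∞ φ) :
    IsTest fun p => f p * conj (g p) * wt φ p :=
  (hg.conj.mul_left hf).mul_right (contDiff_ofReal_comp (contDiff_wt hφ))

/-- Integrate `∂̄_e (f · ḡ e^{-2φ})` to zero; the derivative of the weight produces the zero-order
term of `delta`. -/
theorem integral_dbar_mul_conj (hφ : ContDiff ℝ ∞ φ) (hf : ContDiff ℝ ∞ f) (hg : IsTest g)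
    (e : ℂ × ℂ) :
    ∫ p, dbar e f p * conj (g p) * wt φ p = ∫ p, f p * conj (delta φ e g p) * wt φ p := by
  have hW := contDiff_ofReal_comp (contDiff_wt hφ)
  have hgW := hg.conj.mul_right hW
  have h1 : ∀ p, dbar e (fun q => f q * (conj (g q) * wt φ q)) p =
      dbar e f p * conj (g p) * wt φ p - f p * conj (delta φ e g p) * wt φ p := fun p => by
    rw [dbar_mul (hf.differentiable (by simp)) (hgW.smooth.differentiable (by simp)),
      dbar_mul ((contDiff_conj_comp hg.smooth).differentiable (by simp))
        (hW.differentiable (by simp)), dbar_wt hφ,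
      dbar_conj (hg.smooth.differentiable (by simp)), delta]
    simp only [map_add, map_neg, map_mul, map_ofNat, conj_del_ofReal hφ]
    ring
  have h2 := integral_dbar (hgW.mul_left hf) e
  simp only [h1] at h2
  rw [integral_sub (hg.mul_conj_mul_wt' (contDiff_dbar hf e) hφ).integrable
    ((hg.delta hφ e).mul_conj_mul_wt' hf hφ).integrable] at h2
  exact sub_eq_zero.1 h2

theorem integral_delta_mul_conj (hφ : ContDiff ℝ ∞ φ) (hf : IsTest f) (hg : ContDiff ℝ ∞ g)
    (e : ℂ × ℂ) :
    ∫ p, delta φ e f p * conj (g p) * wt φ p = ∫ p, f p * conj (dbar e g p) * wt φ p := by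
  have h := congrArg (starRingEnd ℂ) (integral_dbar_mul_conj hφ hg hf e)
  rw [← integral_conj, ← integral_conj] at h
  simp only [map_mul, conj_conj, conj_ofReal] at h
  simp only [mul_comm (conj _)] at h
  exact h.symm

/-- `∂̄_k` commutes with `∂_j`, so only the coefficient `2 ∂_j φ` contributes to the commutator of
`∂̄_k` and `δ_j`: this is where the complex Hessian of the weight comes from. -/
theorem dbar_delta (hφ : ContDiff ℝ ∞ φ) (hf : ContDiff ℝ ∞ f) (j k p : ℂ × ℂ) :
    dbar k (delta φ j f) p = delta φ j (dbar k f) p +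
      2 * (dbar k (del j fun q => (φ q : ℂ)) p * f p) := by
  have h0 : ∀ {h : ℂ × ℂ → ℂ}, ContDiff ℝ ∞ h → Differentiable ℝ h :=
    fun hh => hh.differentiable (by simp)
  have h1 := contDiff_del (contDiff_ofReal_comp hφ) j
  have h2 : delta φ j f = fun p => -del j f p + (2 * del j (fun q => (φ q : ℂ)) p) * f p := rfl
  rw [h2, dbar_add (h0 (contDiff_del hf j).neg) (h0 ((contDiff_const.mul h1).mul hf)),
    dbar_neg, dbar_mul (h0 (contDiff_const.mul h1)) (h0 hf), dbar_const_mul (h0 h1),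
    dbar_del_comm hf, delta]
  ring

/-- The commutation formula `⟨δ_j f, δ_k g⟩ = ⟨∂̄_k f, ∂̄_j g⟩ + 2 ⟨φ_{jk̄} f, g⟩`. -/
theorem integral_delta_mul_conj_delta (hφ : ContDiff ℝ ∞ φ) (hf : IsTest f) (hg : IsTest g)
    (j k : ℂ × ℂ) :
    ∫ p, delta φ j f p * conj (delta φ k g p) * wt φ p =
      (∫ p, dbar k f p * conj (dbar j g p) * wt φ p) +
        2 * ∫ p, dbar k (del j fun q => (φ q : ℂ)) p * f p * conj (g p) * wt φ p := by
  rw [← integral_dbar_mul_conj hφ (contDiff_delta hφ hf.smooth j) hg,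
    ← integral_delta_mul_conj hφ (hf.dbar k) hg.smooth, ← integral_const_mul, ← integral_add
      (((hf.dbar k).delta hφ j).mul_conj_mul_wt hg.smooth hφ).integrable]
  · refine integral_congr_ae (Filter.Eventually.of_forall fun p => ?_)
    simp only [dbar_delta hφ hf.smooth]
    ring
  · exact ((hf.mul_left (contDiff_dbar (contDiff_del (contDiff_ofReal_comp hφ) j)
      k)).mul_conj_mul_wt hg.smooth hφ).integrable.const_mul 2

theorem ofReal_integral_norm_sq (f : ℂ × ℂ → ℂ) (φ : ℂ × ℂ → ℝ) :
    ((∫ p, ‖f p‖ ^ 2 * wt φ p : ℝ) : ℂ) = ∫ p, f p * conj (f p) * wt φ p := by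
  rw [← integral_complex_ofReal]
  refine integral_congr_ae (Filter.Eventually.of_forall fun p => ?_)
  simp only [mul_conj']
  push_cast
  ring

theorem IsTest.integrable_norm_sq (hf : IsTest f) (hφ : ContDiff ℝ ∞ φ) :
    Integrable fun p => ‖f p‖ ^ 2 * wt φ p := by
  have h := (hf.mul_conj_mul_wt hf.smooth hφ).integrable.re
  refine h.congr (Filter.Eventually.of_forall fun p => ?_)
  simp only [mul_conj']
  norm_cast

/-- The integrated commutation formula for a single function. -/
theorem integral_norm_sq_delta_zero (hf : IsTest f) (e : ℂ × ℂ) :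
    ∫ p, ‖del e f p‖ ^ 2 = ∫ p, ‖dbar e f p‖ ^ 2 := by
  -- For the zero weight `delta` is `-∂` and the Hessian term vanishes.
  have h := integral_delta_mul_conj_delta (φ := fun _ => 0) contDiff_const hf hf e e
  rw [← ofReal_integral_norm_sq, ← ofReal_integral_norm_sq] at h
  have h0 : ∀ p, del e (fun _ : ℂ × ℂ => (0 : ℂ)) p = 0 := fun p => by simp [del]
  have h1 : ∀ p, dbar e (del e fun _ : ℂ × ℂ => (0 : ℂ)) p = 0 := fun p => by
    rw [funext h0]
    simp [dbar]
  simp only [ofReal_zero, h1, zero_mul, integral_zero, mul_zero, add_zero] at h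
  have h2 := Complex.ofReal_injective h
  simpa [wt, delta, h0] using h2

theorem integral_add_four {a b c d : ℂ × ℂ → ℂ} (ha : Integrable a) (hb : Integrable b)
    (hc : Integrable c) (hd : Integrable d) :
    ∫ p, (a p + b p + c p + d p) = (∫ p, a p) + (∫ p, b p) + (∫ p, c p) + ∫ p, d p := by
  rw [integral_add (f := fun p => a p + b p + c p) ((ha.add hb).add hc) hd,
    integral_add (f := fun p => a p + b p) (ha.add hb) hc, integral_add ha hb]

/-- The Kohn–Morrey formula. -/
theorem integral_kohnMorrey (hφ : ContDiff ℝ ∞ φ) (hf : IsTest f) (hg : IsTest g) (Z W : ℂ × ℂ) :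
    (((∫ p, ‖dbar Z g p - dbar W f p‖ ^ 2 * wt φ p) +
      ∫ p, ‖delta φ Z f p + delta φ W g p‖ ^ 2 * wt φ p : ℝ) : ℂ) =
    (((∫ p, ‖dbar Z f p‖ ^ 2 * wt φ p) + (∫ p, ‖dbar W f p‖ ^ 2 * wt φ p) +
      (∫ p, ‖dbar Z g p‖ ^ 2 * wt φ p) + ∫ p, ‖dbar W g p‖ ^ 2 * wt φ p : ℝ) : ℂ) +
    2 * ∫ p, (dbar Z (del Z fun q => (φ q : ℂ)) p * f p * conj (f p) +
      dbar W (del Z fun q => (φ q : ℂ)) p * f p * conj (g p) +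
      dbar Z (del W fun q => (φ q : ℂ)) p * g p * conj (f p) +
      dbar W (del W fun q => (φ q : ℂ)) p * g p * conj (g p)) * wt φ p := by
  have hI : ∀ {a b : ℂ × ℂ → ℂ}, IsTest a → IsTest b →
      Integrable fun p => a p * conj (b p) * wt φ p :=
    fun ha hb => (ha.mul_conj_mul_wt hb.smooth hφ).integrable
  have e1 : ∀ {a b : ℂ × ℂ → ℂ}, IsTest a → IsTest b → ∫ p, (a p + b p) * conj (a p + b p) * wt φ p =
      (∫ p, a p * conj (a p) * wt φ p) + (∫ p, a p * conj (b p) * wt φ p) +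
      (∫ p, b p * conj (a p) * wt φ p) + ∫ p, b p * conj (b p) * wt φ p := fun {a b} ha hb => by
    rw [← integral_add_four (hI ha ha) (hI ha hb) (hI hb ha) (hI hb hb)]
    refine integral_congr_ae (Filter.Eventually.of_forall fun p => ?_)
    simp only [map_add]
    ring
  have e2 : ∀ {a b : ℂ × ℂ → ℂ}, IsTest a → IsTest b → ∫ p, (a p - b p) * conj (a p - b p) * wt φ p =
      (∫ p, a p * conj (a p) * wt φ p) - (∫ p, a p * conj (b p) * wt φ p) -
      (∫ p, b p * conj (a p) * wt φ p) + ∫ p, b p * conj (b p) * wt φ p := fun {a b} ha hb => by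
    have := e1 ha hb.neg
    simp only [map_neg, mul_neg, neg_mul, neg_neg, integral_neg, ← sub_eq_add_neg] at this
    exact this
  have hL : ∀ {a b : ℂ × ℂ → ℂ}, IsTest a → IsTest b → ∀ j k : ℂ × ℂ,
      Integrable fun p => dbar k (del j fun q => (φ q : ℂ)) p * a p * conj (b p) * wt φ p :=
    fun ha hb j k => ((ha.mul_left (contDiff_dbar (contDiff_del (contDiff_ofReal_comp hφ) j)
      k)).mul_conj_mul_wt hb.smooth hφ).integrable
  have e3 : ∫ p, (dbar Z (del Z fun q => (φ q : ℂ)) p * f p * conj (f p) +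
      dbar W (del Z fun q => (φ q : ℂ)) p * f p * conj (g p) +
      dbar Z (del W fun q => (φ q : ℂ)) p * g p * conj (f p) +
      dbar W (del W fun q => (φ q : ℂ)) p * g p * conj (g p)) * wt φ p =
      (∫ p, dbar Z (del Z fun q => (φ q : ℂ)) p * f p * conj (f p) * wt φ p) +
      (∫ p, dbar W (del Z fun q => (φ q : ℂ)) p * f p * conj (g p) * wt φ p) +
      (∫ p, dbar Z (del W fun q => (φ q : ℂ)) p * g p * conj (f p) * wt φ p) +
      ∫ p, dbar W (del W fun q => (φ q : ℂ)) p * g p * conj (g p) * wt φ p := by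
    rw [← integral_add_four (hL hf hf Z Z) (hL hf hg Z W) (hL hg hf W Z) (hL hg hg W W)]
    refine integral_congr_ae (Filter.Eventually.of_forall fun p => ?_)
    simp only []
    ring
  push_cast
  rw [e3]
  simp only [ofReal_integral_norm_sq]
  -- The cross terms `⟨δ_Z f, δ_W g⟩` commute into `⟨∂̄_W f, ∂̄_Z g⟩` plus a Hessian term. The
  -- former cancel the cross terms of `‖∂̄_Z g - ∂̄_W f‖²`.
  rw [e2 (hg.dbar Z) (hf.dbar W), e1 (hf.delta hφ Z) (hg.delta hφ W)]
  simp only [integral_delta_mul_conj_delta hφ hf hf, integral_delta_mul_conj_delta hφ hf hg,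
    integral_delta_mul_conj_delta hφ hg hf, integral_delta_mul_conj_delta hφ hg hg]
  ring

end Weighted

/-! ### Model weights -/

section Model

/-- The monomial `z^α w^β`. -/
def mono (γ : ℕ × ℕ) (p : ℂ × ℂ) : ℂ := p.1 ^ γ.1 * p.2 ^ γ.2

/-- The Levi form of `φ_Γ` applied to `(f, g)`. -/
def levi (Γ : Finset (ℕ × ℕ)) (f g : ℂ × ℂ → ℂ) (p : ℂ × ℂ) : ℝ :=
  ∑ γ ∈ Γ, ‖del (1, 0) (mono γ) p * f p + del (0, 1) (mono γ) p * g p‖ ^ 2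

theorem differentiable_mono (γ : ℕ × ℕ) : Differentiable ℂ (mono γ) := by
  unfold mono
  fun_prop

theorem contDiff_mono (γ : ℕ × ℕ) : ContDiff ℝ ∞ (mono γ) := by
  unfold mono
  fun_prop

theorem del_mono_fst (γ : ℕ × ℕ) (p : ℂ × ℂ) :
    del (1, 0) (mono γ) p = γ.1 * p.1 ^ (γ.1 - 1) * p.2 ^ γ.2 := by
  rw [del_of_holomorphic (differentiable_mono γ)]
  have h1 : HasFDerivAt (fun q : ℂ × ℂ => q.1) (ContinuousLinearMap.fst ℂ ℂ ℂ) p := hasFDerivAt_fst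
  have h2 : HasFDerivAt (fun q : ℂ × ℂ => q.2) (ContinuousLinearMap.snd ℂ ℂ ℂ) p := hasFDerivAt_snd
  have h3 : fderiv ℂ (mono γ) p = _ := ((h1.pow γ.1).mul (h2.pow γ.2)).fderiv
  rw [h3]
  simp
  ring

theorem del_mono_snd (γ : ℕ × ℕ) (p : ℂ × ℂ) :
    del (0, 1) (mono γ) p = γ.2 * p.1 ^ γ.1 * p.2 ^ (γ.2 - 1) := by
  rw [del_of_holomorphic (differentiable_mono γ)]
  have h1 : HasFDerivAt (fun q : ℂ × ℂ => q.1) (ContinuousLinearMap.fst ℂ ℂ ℂ) p := hasFDerivAt_fst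
  have h2 : HasFDerivAt (fun q : ℂ × ℂ => q.2) (ContinuousLinearMap.snd ℂ ℂ ℂ) p := hasFDerivAt_snd
  have h3 : fderiv ℂ (mono γ) p = _ := ((h1.pow γ.1).mul (h2.pow γ.2)).fderiv
  rw [h3]
  simp
  ring

theorem modelWeight_apply (Γ : Finset (ℕ × ℕ)) (p : ℂ × ℂ) :
    modelWeight Γ p = ∑ γ ∈ Γ, ‖mono γ p‖ ^ 2 := rfl

theorem ofReal_modelWeight (Γ : Finset (ℕ × ℕ)) :
    (fun p => (modelWeight Γ p : ℂ)) = fun p => ∑ γ ∈ Γ, mono γ p * conj (mono γ p) := by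
  ext p
  rw [modelWeight_apply]
  push_cast
  simp only [mul_conj']

theorem contDiff_modelWeight (Γ : Finset (ℕ × ℕ)) : ContDiff ℝ ∞ (modelWeight Γ) := by
  have h : ∀ γ ∈ Γ, ContDiff ℝ ∞ fun p => ‖mono γ p‖ ^ 2 := fun γ _ => (contDiff_mono γ).norm_sq ℝ
  exact ContDiff.sum h

theorem del_modelWeight (Γ : Finset (ℕ × ℕ)) (e : ℂ × ℂ) :
    del e (fun p => (modelWeight Γ p : ℂ)) =
      fun p => ∑ γ ∈ Γ, del e (mono γ) p * conj (mono γ p) := by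
  have h0 : ∀ {h : ℂ × ℂ → ℂ}, ContDiff ℝ ∞ h → Differentiable ℝ h :=
    fun hh => hh.differentiable (by simp)
  ext p
  rw [ofReal_modelWeight, del_sum fun γ _ =>
    h0 ((contDiff_mono γ).mul (contDiff_conj_comp (contDiff_mono γ)))]
  refine Finset.sum_congr rfl fun γ _ => ?_
  rw [del_mul (h0 (contDiff_mono γ)) (h0 (contDiff_conj_comp (contDiff_mono γ))),
    del_conj (h0 (contDiff_mono γ)), dbar_of_holomorphic (differentiable_mono γ)]
  simp

/-- The monomials are holomorphic, so the complex Hessian of `∑ |m_γ|²` is a sum of rank-one terms;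
this is what makes the Levi form a sum of squares. -/
theorem dbar_del_modelWeight (Γ : Finset (ℕ × ℕ)) (j k p : ℂ × ℂ) :
    dbar k (del j fun p => (modelWeight Γ p : ℂ)) p =
      ∑ γ ∈ Γ, del j (mono γ) p * conj (del k (mono γ) p) := by
  have h0 : ∀ {h : ℂ × ℂ → ℂ}, ContDiff ℝ ∞ h → Differentiable ℝ h :=
    fun hh => hh.differentiable (by simp)
  rw [del_modelWeight, dbar_sum fun γ _ =>
    h0 ((contDiff_del (contDiff_mono γ) j).mul (contDiff_conj_comp (contDiff_mono γ)))]
  refine Finset.sum_congr rfl fun γ _ => ?_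
  have h1 : dbar k (mono γ) = fun _ => 0 := funext (dbar_of_holomorphic (differentiable_mono γ) k)
  have h2 : dbar k (del j (mono γ)) p = 0 := by
    rw [dbar_del_comm (contDiff_mono γ), h1]
    simp [del]
  rw [dbar_mul (h0 (contDiff_del (contDiff_mono γ) j)) (h0 (contDiff_conj_comp (contDiff_mono γ))),
    dbar_conj (h0 (contDiff_mono γ)), h2]
  simp

/-- The Kohn–Morrey formula for model weights. -/
theorem kohnMorrey_modelWeight (Γ : Finset (ℕ × ℕ)) {f g : ℂ × ℂ → ℂ} (hf : IsTest f)
    (hg : IsTest g) :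
    (∫ p, ‖dbar (1, 0) g p - dbar (0, 1) f p‖ ^ 2 * wt (modelWeight Γ) p) +
      ∫ p, ‖delta (modelWeight Γ) (1, 0) f p + delta (modelWeight Γ) (0, 1) g p‖ ^ 2 *
        wt (modelWeight Γ) p =
    (∫ p, ‖dbar (1, 0) f p‖ ^ 2 * wt (modelWeight Γ) p) +
      (∫ p, ‖dbar (0, 1) f p‖ ^ 2 * wt (modelWeight Γ) p) +
      (∫ p, ‖dbar (1, 0) g p‖ ^ 2 * wt (modelWeight Γ) p) +
      (∫ p, ‖dbar (0, 1) g p‖ ^ 2 * wt (modelWeight Γ) p) +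
    2 * ∫ p, levi Γ f g p * wt (modelWeight Γ) p := by
  apply Complex.ofReal_injective
  rw [integral_kohnMorrey (contDiff_modelWeight Γ) hf hg]
  rw [ofReal_add _ (2 * _), ofReal_mul, ← integral_complex_ofReal]
  congr 2
  refine integral_congr_ae (Filter.Eventually.of_forall fun p => ?_)
  simp only [dbar_del_modelWeight, levi, ofReal_mul]
  congr 1
  push_cast
  simp only [← mul_conj', Finset.sum_mul, ← Finset.sum_add_distrib]
  refine Finset.sum_congr rfl fun γ _ => ?_
  simp only [map_add, map_mul]
  ring

end Model

/-! ### The estimate near infinity for weights which are not decoupled -/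

section Tail

theorem exists_cutoff : ∃ (χ : ℝ → ℝ) (C : ℝ), ContDiff ℝ ∞ χ ∧ (∀ t, 0 ≤ χ t) ∧ (∀ t, χ t ≤ 1) ∧
    (∀ t ≤ 1 / 2, χ t = 1) ∧ (∀ t, 1 ≤ t → χ t = 0) ∧ (∀ t, |deriv χ t| ≤ C) ∧
    ∀ t, 1 ≤ t → deriv χ t = 0 := by
  let χ : ℝ → ℝ := fun t => Real.smoothTransition (2 - 2 * t)
  have hχ : ContDiff ℝ ∞ χ := Real.smoothTransition.contDiff.comp (by fun_prop)
  have h0 : ∀ t, 0 ≤ χ t := fun t => Real.smoothTransition.nonneg _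
  have h1 : ∀ t, χ t ≤ 1 := fun t => Real.smoothTransition.le_one _
  have h2 : ∀ t ≤ 1 / 2, χ t = 1 := fun t ht => Real.smoothTransition.one_of_one_le (by linarith)
  have h3 : ∀ t, 1 ≤ t → χ t = 0 := fun t ht => Real.smoothTransition.zero_of_nonpos (by linarith)
  -- Here `χ` attains its minimum `0`, and for `t ≤ 1 / 2` its maximum `1`. This covers the
  -- endpoints too and leaves only a compact interval on which to bound the derivative.
  have h4 : ∀ t, 1 ≤ t → deriv χ t = 0 := fun t ht =>
    IsLocalMin.deriv_eq_zero (Filter.Eventually.of_forall fun y => by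
      rw [h3 t ht]
      exact h0 y)
  have h5 : ∀ t ≤ 1 / 2, deriv χ t = 0 := fun t ht =>
    IsLocalMax.deriv_eq_zero (Filter.Eventually.of_forall fun y => by
      rw [h2 t ht]
      exact h1 y)
  obtain ⟨C, hC⟩ := (isCompact_Icc (a := (1 / 2 : ℝ)) (b := 1)).exists_bound_of_continuousOn
    (hχ.continuous_deriv (by simp)).continuousOn
  have hC0 : 0 ≤ C := (norm_nonneg _).trans (hC 1 (by norm_num))
  refine ⟨χ, C, hχ, h0, h1, h2, h3, fun t => ?_, h4⟩
  rcases le_total t (1 / 2) with h | h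
  · rw [h5 t h, abs_zero]
    exact hC0
  · rcases le_total t 1 with h' | h'
    · exact hC t ⟨h, h'⟩
    · rw [h4 t h', abs_zero]
      exact hC0

/-- A Poincaré inequality for functions supported where `w` is small. -/
theorem poincare_snd {g : ℂ × ℂ → ℂ} (hg : IsTest g) {s : ℝ}
    (hs : ∀ p, g p ≠ 0 → ‖p.2‖ ≤ s) :
    ∫ p, ‖g p‖ ^ 2 ≤ 4 * s ^ 2 * ∫ p, ‖dbar (0, 1) g p‖ ^ 2 := by
  have h0 : ∀ {h : ℂ × ℂ → ℂ}, ContDiff ℝ ∞ h → Differentiable ℝ h :=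
    fun hh => hh.differentiable (by simp)
  have hi : ∀ {h : ℂ × ℂ → ℂ}, IsTest h → Integrable fun p => ‖h p‖ ^ 2 := fun {h} hh => by
    simpa [wt] using hh.integrable_norm_sq (φ := fun _ => 0) contDiff_const
  have hw : Differentiable ℂ fun p : ℂ × ℂ => p.2 := differentiable_snd
  have hwc : ContDiff ℝ ∞ fun p : ℂ × ℂ => p.2 := contDiff_snd
  have hg2 : IsTest fun p => g p * conj (g p) := hg.mul_right (contDiff_conj_comp hg.smooth)
  -- The integral of `∂̄_w (w̄ |g|²)` vanishes, which expresses `∫ |g|²` by terms carrying the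
  -- factor `w̄`, bounded by `s` on the support of `g`.
  have h1 : ∀ p, dbar (0, 1) (fun q => conj q.2 * (g q * conj (g q))) p = g p * conj (g p) +
      conj p.2 * (dbar (0, 1) g p * conj (g p) + g p * conj (del (0, 1) g p)) := fun p => by
    rw [dbar_mul (h0 (contDiff_conj_comp hwc)) (h0 hg2.smooth), dbar_mul (h0 hg.smooth)
      (h0 (contDiff_conj_comp hg.smooth)), dbar_conj (h0 hwc), dbar_conj (h0 hg.smooth),
      del_of_holomorphic hw]
    have : fderiv ℂ (fun q : ℂ × ℂ => q.2) p (0, 1) = 1 := by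
      rw [fderiv_snd]
      rfl
    rw [this]
    simp
  have t1 : IsTest fun p => conj p.2 * (dbar (0, 1) g p * conj (g p) + g p * conj (del (0, 1) g p)) :=
    (((hg.dbar _).mul_right (contDiff_conj_comp hg.smooth)).add
      (hg.mul_right (contDiff_conj_comp (contDiff_del hg.smooth _)))).mul_left (contDiff_conj_comp hwc)
  have h2 := integral_dbar (hg2.mul_left (contDiff_conj_comp hwc)) (0, 1)
  simp only [h1] at h2
  rw [integral_add hg2.integrable t1.integrable] at h2
  have h3 : ((∫ p, ‖g p‖ ^ 2 : ℝ) : ℂ) = ∫ p, g p * conj (g p) := by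
    simpa [wt] using ofReal_integral_norm_sq g fun _ => 0
  rw [← h3] at h2
  have h4 : ∫ p, ‖g p‖ ^ 2 ≤ ∫ p, ‖conj p.2 * (dbar (0, 1) g p * conj (g p) +
      g p * conj (del (0, 1) g p))‖ := by
    have h5 : ‖((∫ p, ‖g p‖ ^ 2 : ℝ) : ℂ)‖ = ∫ p, ‖g p‖ ^ 2 := by
      rw [Complex.norm_real, Real.norm_of_nonneg (integral_nonneg fun p => by positivity)]
    rw [← h5, eq_neg_of_add_eq_zero_left h2, norm_neg]
    exact norm_integral_le_integral_norm _
  -- Young's inequality leaves half of `∫ |g|²` to be absorbed. As `∂_w g` and `∂̄_w g` have equal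
  -- unweighted norms, the rest is `2 s² ∫ |∂̄_w g|²`, whence the constant 4.
  have h5 : ∫ p, ‖conj p.2 * (dbar (0, 1) g p * conj (g p) + g p * conj (del (0, 1) g p))‖ ≤
      ∫ p, (1 / 2 * ‖g p‖ ^ 2 + s ^ 2 * (‖dbar (0, 1) g p‖ ^ 2 + ‖del (0, 1) g p‖ ^ 2)) := by
    refine integral_mono t1.integrable.norm (((hi hg).const_mul _).add
      (((hi (hg.dbar _)).add (hi (hg.del _))).const_mul _)) fun p => ?_
    by_cases hp : g p = 0
    · simp only [hp, map_zero, mul_zero, zero_mul, add_zero, norm_zero]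
      positivity
    · have hps := hs p hp
      have hs0 : 0 ≤ s := (norm_nonneg _).trans hps
      have h6 : ‖conj p.2 * (dbar (0, 1) g p * conj (g p) + g p * conj (del (0, 1) g p))‖ ≤
          s * (‖dbar (0, 1) g p‖ * ‖g p‖ + ‖g p‖ * ‖del (0, 1) g p‖) := by
        rw [norm_mul, RCLike.norm_conj]
        gcongr
        refine (norm_add_le _ _).trans ?_
        rw [norm_mul, norm_mul, RCLike.norm_conj, RCLike.norm_conj]
      refine h6.trans ?_
      nlinarith [sq_nonneg (‖g p‖ / 2 - s * ‖dbar (0, 1) g p‖),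
        sq_nonneg (‖g p‖ / 2 - s * ‖del (0, 1) g p‖)]
  rw [integral_add (f := fun p => 1 / 2 * ‖g p‖ ^ 2)
    (g := fun p => s ^ 2 * (‖dbar (0, 1) g p‖ ^ 2 + ‖del (0, 1) g p‖ ^ 2)) ((hi hg).const_mul _)
    (((hi (hg.dbar _)).add (hi (hg.del _))).const_mul _),
    integral_const_mul, integral_const_mul, integral_add (hi (hg.dbar _)) (hi (hg.del _)),
    integral_norm_sq_delta_zero hg] at h5
  linarith

theorem levi_nonneg (Γ : Finset (ℕ × ℕ)) (f g : ℂ × ℂ → ℂ) (p : ℂ × ℂ) : 0 ≤ levi Γ f g p :=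
  Finset.sum_nonneg fun _ _ => by positivity

theorem norm_le_sqrt_levi {Γ : Finset (ℕ × ℕ)} {γ : ℕ × ℕ} (hγ : γ ∈ Γ) (f g : ℂ × ℂ → ℂ)
    (p : ℂ × ℂ) :
    ‖del (1, 0) (mono γ) p * f p + del (0, 1) (mono γ) p * g p‖ ≤ √(levi Γ f g p) :=
  Real.le_sqrt_of_sq_le (Finset.single_le_sum
    (f := fun γ => ‖del (1, 0) (mono γ) p * f p + del (0, 1) (mono γ) p * g p‖ ^ 2)
    (fun _ _ => by positivity) hγ)

/-- The monomial `z^m` does not involve `w`, so its term in the Levi form is `(m |z|^{m-1} |f|)²`.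
The assumption `m ≥ 2` makes the factor at least `|z|`, so that it grows. -/
theorem fst_le_sqrt_levi {Γ : Finset (ℕ × ℕ)} {m : ℕ} (hm : 2 ≤ m) (hΓ : (m, 0) ∈ Γ)
    (f g : ℂ × ℂ → ℂ) {p : ℂ × ℂ} (hp : 1 ≤ ‖p.1‖) : ‖p.1‖ * ‖f p‖ ≤ √(levi Γ f g p) := by
  refine le_trans ?_ (norm_le_sqrt_levi hΓ f g p)
  rw [del_mono_fst, del_mono_snd]
  simp only [Nat.cast_zero, zero_mul, add_zero, pow_zero, mul_one, norm_mul, norm_pow,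
    Complex.norm_natCast]
  gcongr
  calc ‖p.1‖ = 1 * ‖p.1‖ ^ 1 := by ring
    _ ≤ m * ‖p.1‖ ^ (m - 1) := by
      gcongr
      · exact_mod_cast (by lia : 1 ≤ m)
      · lia

theorem snd_le_sqrt_levi {Γ : Finset (ℕ × ℕ)} {n : ℕ} (hn : 2 ≤ n) (hΓ : (0, n) ∈ Γ)
    (f g : ℂ × ℂ → ℂ) {p : ℂ × ℂ} (hp : 1 ≤ ‖p.2‖) : ‖p.2‖ * ‖g p‖ ≤ √(levi Γ f g p) := by
  refine le_trans ?_ (norm_le_sqrt_levi hΓ f g p)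
  rw [del_mono_fst, del_mono_snd]
  simp only [Nat.cast_zero, zero_mul, zero_add, pow_zero, mul_one, norm_mul, norm_pow,
    Complex.norm_natCast]
  gcongr
  calc ‖p.2‖ = 1 * ‖p.2‖ ^ 1 := by ring
    _ ≤ n * ‖p.2‖ ^ (n - 1) := by
      gcongr
      · exact_mod_cast (by lia : 1 ≤ n)
      · lia

/-- The square of the mixed monomial in the Levi form couples `f` and `g`; the triangle inequality
isolates `g` at the cost of an `f`-term, which `fst_le_sqrt_levi` will control. -/
theorem mixed_le_sqrt_levi {Γ : Finset (ℕ × ℕ)} {a b : ℕ} (hΓ : (a, b) ∈ Γ)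
    (f g : ℂ × ℂ → ℂ) (p : ℂ × ℂ) :
    b * ‖p.1‖ ^ a * ‖p.2‖ ^ (b - 1) * ‖g p‖ ≤
      √(levi Γ f g p) + a * ‖p.1‖ ^ (a - 1) * ‖p.2‖ ^ b * ‖f p‖ := by
  have h := norm_le_sqrt_levi hΓ f g p
  rw [del_mono_fst, del_mono_snd] at h
  have h2 : ‖(b : ℂ) * p.1 ^ a * p.2 ^ (b - 1) * g p‖ ≤
      ‖a * p.1 ^ (a - 1) * p.2 ^ b * f p + b * p.1 ^ a * p.2 ^ (b - 1) * g p‖ +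
      ‖a * p.1 ^ (a - 1) * p.2 ^ b * f p‖ := by
    refine le_trans (le_of_eq ?_) (norm_sub_le _ _)
    congr 1
    ring
  simp only [norm_mul, norm_pow, Complex.norm_natCast] at h2
  linarith

/-- Away from the region where `z^a w^b` is small, the Levi form is large. -/
theorem sq_norm_le_levi {Γ : Finset (ℕ × ℕ)} {m n a b : ℕ} (hm : 2 ≤ m) (hn : 2 ≤ n)
    (hmΓ : (m, 0) ∈ Γ) (hnΓ : (0, n) ∈ Γ) (ha : 1 ≤ a) (hb : 1 ≤ b) (hΓ : (a, b) ∈ Γ)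
    (f g : ℂ × ℂ → ℂ) {p : ℂ × ℂ} {s : ℝ} (hs : 0 < s) (hs1 : s ≤ 1) (hp : (s ^ b)⁻¹ ≤ ‖p.1‖)
    (hab : 1 / 2 ≤ ‖p.1‖ ^ a * ‖p.2‖ ^ b) :
    ‖g p‖ ^ 2 ≤ (2 + a) ^ 2 * s ^ 2 * levi Γ f g p := by
  set x := ‖p.1‖
  set y := ‖p.2‖
  set r := √(levi Γ f g p)
  have hr0 : 0 ≤ r := Real.sqrt_nonneg _
  have hr : r ^ 2 = levi Γ f g p := Real.sq_sqrt (levi_nonneg _ _ _ _)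
  have hy0 : 0 ≤ y := norm_nonneg _
  have hsb : s ^ b ≤ s := by
    calc s ^ b ≤ s ^ 1 := pow_le_pow_of_le_one hs.le hs1 hb
      _ = s := pow_one s
  have hx1 : s⁻¹ ≤ x := le_trans (inv_anti₀ (by positivity) hsb) hp
  have hs2 : 1 ≤ s⁻¹ := (one_le_inv₀ hs).2 hs1
  have hx : 1 ≤ x := hs2.trans hx1
  have hsx : 1 ≤ s * x := by
    have := mul_le_mul_of_nonneg_left hx1 hs.le
    rwa [mul_inv_cancel₀ hs.ne'] at this
  have hG0 : 0 ≤ ‖g p‖ := norm_nonneg _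
  have hF0 : 0 ≤ ‖f p‖ := norm_nonneg _
  suffices h : ‖g p‖ ≤ (2 + a) * s * r by
    calc ‖g p‖ ^ 2 ≤ ((2 + a) * s * r) ^ 2 := pow_le_pow_left₀ hG0 h 2
      _ = _ := by rw [mul_pow, mul_pow, hr]
  have ha0 : (1 : ℝ) ≤ a := by exact_mod_cast ha
  -- If `|w| ≥ |z|` then `|w| ≥ 1 / s` and the power `w^n` alone suffices. Otherwise the mixed
  -- monomial is used, with `f` bounded through `z^m`.
  rcases le_total x y with hxy | hxy
  · have h1 : y * ‖g p‖ ≤ r := snd_le_sqrt_levi hn hnΓ f g (hx.trans hxy)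
    have h2 : 1 ≤ s * y := hsx.trans (by gcongr)
    calc ‖g p‖ ≤ (s * y) * ‖g p‖ := le_mul_of_one_le_left hG0 h2
      _ = s * (y * ‖g p‖) := by ring
      _ ≤ s * r := by gcongr
      _ ≤ (2 + a) * s * r := by
        have : 0 ≤ s * r := by positivity
        nlinarith
  · have h1 := mixed_le_sqrt_levi hΓ f g p
    have h2 : x * ‖f p‖ ≤ r := fst_le_sqrt_levi hm hmΓ f g hx
    have hb0 : (1 : ℝ) ≤ b := by exact_mod_cast hb
    have hyb : y ^ b = y * y ^ (b - 1) := by rw [← pow_succ', Nat.sub_add_cancel hb]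
    have hxa : x ^ a = x * x ^ (a - 1) := by rw [← pow_succ', Nat.sub_add_cancel ha]
    set D := x ^ a * y ^ (b - 1)
    -- For `|w| ≤ s`, `1 / 2 ≤ |z|^a |w|^b = |w| D ≤ s D`. For `|w| ≥ s`, `D ≥ |z|^a s^{b-1} ≥
    -- s^{-b} s^{b-1} = 1 / s`.
    have hD : 1 ≤ 2 * s * D := by
      rcases le_total y s with hys | hys
      · have : x ^ a * y ^ b ≤ s * D := by
          calc x ^ a * y ^ b = y * D := by rw [hyb]; ring
            _ ≤ s * D := by gcongr
        linarith
      · have h3 : s ^ (b - 1) ≤ y ^ (b - 1) := pow_le_pow_left₀ hs.le hys _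
        have h4 : (s ^ b)⁻¹ ≤ x ^ a := hp.trans (le_self_pow₀ hx (by lia))
        have h5 : s⁻¹ ≤ D := by
          calc s⁻¹ = (s ^ b)⁻¹ * s ^ (b - 1) := by
                obtain ⟨c, rfl⟩ : ∃ c, b = c + 1 := ⟨b - 1, by lia⟩
                rw [Nat.add_sub_cancel]
                field_simp
                ring
            _ ≤ D := mul_le_mul h4 h3 (by positivity) (by positivity)
        have h6 := mul_le_mul_of_nonneg_left h5 hs.le
        rw [mul_inv_cancel₀ hs.ne'] at h6
        linarith
    have hD0 : 0 ≤ D := by positivity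
    -- Since `y ≤ x`, one factor `y` may be traded for `x`, which turns the coefficient of `f` into
    -- `a D`; moreover `|f| ≤ r / x ≤ s r`.
    have h3 : a * x ^ (a - 1) * y ^ b * ‖f p‖ ≤ a * s * r * D := by
      have h5 : ‖f p‖ ≤ s * r := by
        calc ‖f p‖ ≤ (s * x) * ‖f p‖ := le_mul_of_one_le_left hF0 hsx
          _ = s * (x * ‖f p‖) := by ring
          _ ≤ s * r := by gcongr
      calc a * x ^ (a - 1) * y ^ b * ‖f p‖ = a * (x ^ (a - 1) * y * y ^ (b - 1)) * ‖f p‖ := by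
            rw [hyb]
            ring
        _ ≤ a * (x ^ (a - 1) * x * y ^ (b - 1)) * (s * r) := by gcongr
        _ = a * s * r * D := by
          simp only [D, hxa]
          ring
    have h4 : D * ‖g p‖ ≤ b * x ^ a * y ^ (b - 1) * ‖g p‖ := by
      calc D * ‖g p‖ ≤ b * (D * ‖g p‖) := le_mul_of_one_le_left (by positivity) hb0
        _ = _ := by simp only [D]; ring
    have h5 : D * ‖g p‖ ≤ D * ((2 + a) * s * r) := by
      have : r ≤ 2 * s * D * r := le_mul_of_one_le_left hr0 hD
      calc D * ‖g p‖ ≤ r + a * s * r * D := by linarith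
        _ ≤ 2 * s * D * r + a * s * r * D := by linarith
        _ = _ := by ring
    refine le_of_mul_le_mul_left h5 ?_
    by_contra hD'
    have : D = 0 := le_antisymm (not_lt.1 hD') hD0
    rw [this, mul_zero] at hD
    linarith

/-- Maximise `α / β` over the exponents with `β ≥ 1`. An exponent with both entries nonzero exists,
so the maximal slope is positive and `a ≥ 1`. -/
theorem exists_steepest {Γ : Finset (ℕ × ℕ)} (h : ¬ IsDecoupled Γ) :
    ∃ a b, (a, b) ∈ Γ ∧ 1 ≤ a ∧ 1 ≤ b ∧ ∀ γ ∈ Γ, 1 ≤ γ.2 → γ.1 * b ≤ a * γ.2 := by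
  simp only [IsDecoupled, not_forall, not_or] at h
  obtain ⟨δ, hδ, h2, h1⟩ := h
  obtain ⟨⟨a, b⟩, hγ, hmax⟩ := (Γ.filter fun γ => 1 ≤ γ.2).exists_max_image
    (fun γ => (γ.1 : ℚ) / γ.2) ⟨δ, Finset.mem_filter.2 ⟨hδ, by lia⟩⟩
  obtain ⟨hΓ, hb⟩ := Finset.mem_filter.1 hγ
  simp only at hb hmax
  have key : ∀ γ ∈ Γ, 1 ≤ γ.2 → γ.1 * b ≤ a * γ.2 := fun γ hγ' hγ2 => by
    have := hmax γ (Finset.mem_filter.2 ⟨hγ', hγ2⟩)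
    rw [div_le_div_iff₀ (by exact_mod_cast hγ2) (by exact_mod_cast hb)] at this
    exact_mod_cast this
  refine ⟨a, b, hΓ, ?_, hb, key⟩
  have := key δ hδ (by lia)
  by_contra ha
  obtain rfl : a = 0 := by lia
  rw [zero_mul] at this
  have h3 : 0 < δ.1 * b := Nat.mul_pos (by lia) hb
  lia

theorem modelWeight_fst_le (Γ : Finset (ℕ × ℕ)) (p : ℂ × ℂ) :
    modelWeight Γ (p.1, 0) ≤ modelWeight Γ p := by
  rw [modelWeight_apply, modelWeight_apply]
  refine Finset.sum_le_sum fun γ _ => ?_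
  rcases Nat.eq_zero_or_pos γ.2 with h | h
  · simp [mono, h]
  · simp only [mono, zero_pow (Nat.pos_iff_ne_zero.1 h), mul_zero, norm_zero]
    rw [zero_pow two_ne_zero]
    positivity

/-- By steepness every monomial containing `w` satisfies `|z^α w^β|^b ≤ |z^a w^b|^β ≤ 1` in this
region, so each contributes at most 1. With `modelWeight_fst_le` the weight is comparable to one
that depends on `z` only. -/
theorem modelWeight_le_fst {Γ : Finset (ℕ × ℕ)} {a b : ℕ} (hb : 1 ≤ b)
    (hab : ∀ γ ∈ Γ, 1 ≤ γ.2 → γ.1 * b ≤ a * γ.2) {p : ℂ × ℂ} (hp : 1 ≤ ‖p.1‖)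
    (h : ‖p.1‖ ^ a * ‖p.2‖ ^ b ≤ 1) :
    modelWeight Γ p ≤ modelWeight Γ (p.1, 0) + Γ.card := by
  rw [modelWeight_apply, modelWeight_apply, Finset.card_eq_sum_ones, Nat.cast_sum,
    ← Finset.sum_add_distrib]
  refine Finset.sum_le_sum fun γ hγ => ?_
  rcases Nat.eq_zero_or_pos γ.2 with h0 | h0
  · simp [mono, h0]
  · have h1 : ‖p.1‖ ^ γ.1 * ‖p.2‖ ^ γ.2 ≤ 1 := by
      rw [← pow_le_one_iff_of_nonneg (by positivity) (by lia : b ≠ 0)]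
      calc (‖p.1‖ ^ γ.1 * ‖p.2‖ ^ γ.2) ^ b = ‖p.1‖ ^ (γ.1 * b) * ‖p.2‖ ^ (b * γ.2) := by ring
        _ ≤ ‖p.1‖ ^ (a * γ.2) * ‖p.2‖ ^ (b * γ.2) := by
          refine mul_le_mul_of_nonneg_right ?_ (by positivity)
          exact pow_le_pow_right₀ hp (hab γ hγ h0)
        _ = (‖p.1‖ ^ a * ‖p.2‖ ^ b) ^ γ.2 := by ring
        _ ≤ 1 := pow_le_one₀ (by positivity) h
    have h2 : ‖mono γ p‖ ^ 2 ≤ 1 := by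
      rw [mono, norm_mul, norm_pow, norm_pow]
      exact pow_le_one₀ (by positivity) h1
    push_cast
    nlinarith [sq_nonneg ‖mono γ (p.1, 0)‖]

theorem dbar_comp_fst_mul {k : ℂ → ℂ} {u : ℂ × ℂ → ℂ} (hk : ContDiff ℝ ∞ k) (hu : ContDiff ℝ ∞ u)
    (p : ℂ × ℂ) : dbar (0, 1) (fun q => k q.1 * u q) p = k p.1 * dbar (0, 1) u p := by
  have h1 : Differentiable ℝ k := hk.differentiable (by simp)
  have h2 : dbar (0, 1) (fun q : ℂ × ℂ => k q.1) p = 0 := by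
    have h3 : fderiv ℝ (fun q : ℂ × ℂ => k q.1) p = _ :=
      ((h1 p.1).hasFDerivAt.comp p (hasFDerivAt_fst (p := p))).fderiv
    rw [dbar, h3]
    simp
  rw [dbar_mul (f := fun q => k q.1) (h1.comp differentiable_fst) (hu.differentiable (by simp)), h2]
  ring

theorem IsTest.integrable_levi {Γ : Finset (ℕ × ℕ)} {φ : ℂ × ℂ → ℝ} (hφ : ContDiff ℝ ∞ φ)
    {f g : ℂ × ℂ → ℂ} (hf : IsTest f) (hg : IsTest g) :
    Integrable fun p => levi Γ f g p * wt φ p := by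
  simp only [levi, Finset.sum_mul]
  refine integrable_finsetSum _ fun γ _ => ?_
  exact ((hf.mul_left (contDiff_del (contDiff_mono γ) (1, 0))).add
    (hg.mul_left (contDiff_del (contDiff_mono γ) (0, 1)))).integrable_norm_sq hφ

theorem norm_dbar_norm_sq_mono (a b : ℕ) (p : ℂ × ℂ) :
    ‖dbar (0, 1) (fun q => ((‖mono (a, b) q‖ ^ 2 : ℝ) : ℂ)) p‖ =
      ‖p.1‖ ^ a * ‖p.2‖ ^ b * (b * ‖p.1‖ ^ a * ‖p.2‖ ^ (b - 1)) := by
  have h0 : ∀ {h : ℂ × ℂ → ℂ}, ContDiff ℝ ∞ h → Differentiable ℝ h :=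
    fun hh => hh.differentiable (by simp)
  have h1 : (fun q => ((‖mono (a, b) q‖ ^ 2 : ℝ) : ℂ)) =
      fun q => mono (a, b) q * conj (mono (a, b) q) := by
    ext q
    rw [mul_conj']
    push_cast
    rfl
  rw [h1, dbar_mul (h0 (contDiff_mono _)) (h0 (contDiff_conj_comp (contDiff_mono _))),
    dbar_of_holomorphic (differentiable_mono _), dbar_conj (h0 (contDiff_mono _)), del_mono_snd]
  simp [mono]

/-- The mass of the second component of a form near infinity in the `z`-direction is controlled by
the form of the Kohn Laplacian, if the weight is not decoupled. -/
theorem exists_tail_snd {Γ : Finset (ℕ × ℕ)} {m n : ℕ} (hm : 2 ≤ m) (hn : 2 ≤ n)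
    (hmΓ : (m, 0) ∈ Γ) (hnΓ : (0, n) ∈ Γ) (hΓ : ¬ IsDecoupled Γ) {ε : ℝ} (hε : 0 < ε) :
    ∃ R > 0, ∀ f g, IsTest f → IsTest g →
      ∫ p in {p : ℂ × ℂ | R ≤ ‖p.1‖}, ‖g p‖ ^ 2 * wt (modelWeight Γ) p ≤
        ε * ((∫ p, ‖dbar (0, 1) g p‖ ^ 2 * wt (modelWeight Γ) p) +
          ∫ p, levi Γ f g p * wt (modelWeight Γ) p) := by
  obtain ⟨a, b, habΓ, ha, hb, hab⟩ := exists_steepest hΓ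
  obtain ⟨χ, C, hχ, hχ0, hχ1, hχone, hχzero, hχd, hχd0⟩ := exists_cutoff
  have hC0 : 0 ≤ C := (abs_nonneg _).trans (hχd 0)
  set N : ℝ := (Γ.card : ℝ)
  set C₁ : ℝ := C ^ 2 * (1 + a) ^ 2
  have hC₁ : 0 ≤ C₁ := by positivity
  -- `M` collects the constants of the final estimate: 16 is 2 from splitting `g`, 4 from the
  -- Poincaré inequality and 2 from expanding `|∂̄H|²`; `exp (2 * N)` compares the weights.
  set M : ℝ := 16 * Real.exp (2 * N) * (1 + C₁) + 2 * (2 + a) ^ 2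
  have hM : 0 < M := by positivity
  obtain ⟨s, hs, hs1, hsM⟩ : ∃ s : ℝ, 0 < s ∧ s ≤ 1 ∧ M * s ^ 2 ≤ ε := by
    refine ⟨min 1 (ε / M), lt_min one_pos (by positivity), min_le_left _ _, ?_⟩
    have h1 : (min 1 (ε / M)) ^ 2 ≤ ε / M := by
      calc (min 1 (ε / M)) ^ 2 = min 1 (ε / M) * min 1 (ε / M) := sq _
        _ ≤ 1 * (ε / M) := mul_le_mul (min_le_left _ _) (min_le_right _ _)
          (le_min zero_le_one (by positivity)) zero_le_one
        _ = ε / M := one_mul _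
    calc M * (min 1 (ε / M)) ^ 2 ≤ M * (ε / M) := by gcongr
      _ = ε := by field_simp
  -- With this threshold, `|z| ≥ R` and `|z^a w^b| ≤ 1` force `|w|^b ≤ 1 / |z|^a ≤ 1 / R = s^b`,
  -- that is `|w| ≤ s`.
  set R : ℝ := (s ^ b)⁻¹
  have hR1 : 1 ≤ R := (one_le_inv₀ (by positivity)).2 (pow_le_one₀ hs.le hs1)
  have hR0 : 0 < R := by positivity
  refine ⟨2 * R, by positivity, fun f g hf hg => ?_⟩
  set φ := modelWeight Γ
  have hφ : ContDiff ℝ ∞ φ := contDiff_modelWeight Γ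
  set ψ : ℂ → ℝ := fun z => φ (z, 0)
  have hψ : ContDiff ℝ ∞ ψ := hφ.comp (contDiff_id.prodMk contDiff_const)
  -- A cutoff in `z` vanishing for `|z| ≤ R` and equal to 1 for `|z| ≥ 2 R`. It depends on `z`
  -- alone, so `∂̄_w` never falls on it.
  let κ : ℂ → ℝ := fun z => 1 - χ (‖z‖ ^ 2 / (2 * R ^ 2))
  have hκ : ContDiff ℝ ∞ κ := contDiff_const.sub (hχ.comp ((contDiff_norm_sq ℝ).div_const _))
  have hκ01 : ∀ z, 0 ≤ κ z ∧ κ z ≤ 1 := fun z => ⟨sub_nonneg.2 (hχ1 _), sub_le_self _ (hχ0 _)⟩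
  have hκsupp : ∀ z, κ z ≠ 0 → R ≤ ‖z‖ := fun z hz => by
    by_contra h
    refine hz (sub_eq_zero.2 (hχone _ ?_).symm)
    rw [div_le_iff₀ (by positivity)]
    nlinarith [norm_nonneg z]
  have hκone : ∀ z, 2 * R ≤ ‖z‖ → κ z = 1 := fun z hz => by
    have : χ (‖z‖ ^ 2 / (2 * R ^ 2)) = 0 := by
      refine hχzero _ ?_
      rw [le_div_iff₀ (by positivity)]
      nlinarith
    simp [κ, this]
  let T : ℂ × ℂ → ℝ := fun p => ‖mono (a, b) p‖ ^ 2
  have hT : ContDiff ℝ ∞ T := (contDiff_mono (a, b)).norm_sq ℝ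
  have hTeq : ∀ p, T p = (‖p.1‖ ^ a * ‖p.2‖ ^ b) ^ 2 := fun p => by
    simp [T, mono]
  have hX : ContDiff ℝ ∞ fun p => ((χ (T p) : ℝ) : ℂ) := contDiff_ofReal_comp (hχ.comp hT)
  -- The weight `e^{-φ(z, 0)}` is absorbed into the function; being independent of `w` it commutes
  -- with `∂̄_w`, and the unweighted Poincaré inequality becomes applicable.
  let k : ℂ → ℂ := fun z => ((κ z * Real.exp (-ψ z) : ℝ) : ℂ)
  have hk : ContDiff ℝ ∞ k := Complex.ofRealCLM.contDiff.comp
    (hκ.mul (Real.contDiff_exp.comp hψ.neg))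
  have hknorm : ∀ z, ‖k z‖ ^ 2 = κ z ^ 2 * Real.exp (-2 * ψ z) := fun z => by
    rw [Complex.norm_real, Real.norm_eq_abs, sq_abs, mul_pow, ← Real.exp_nat_mul]
    congr 2
    push_cast
    ring
  let u : ℂ × ℂ → ℂ := fun p => (χ (T p) : ℂ) * g p
  have hu : IsTest u := hg.mul_left hX
  let H : ℂ × ℂ → ℂ := fun p => k p.1 * u p
  have hH : IsTest H := hu.mul_left (hk.comp contDiff_fst)
  have hsmall : ∀ p : ℂ × ℂ, R ≤ ‖p.1‖ → T p ≤ 1 → ‖p.1‖ ^ a * ‖p.2‖ ^ b ≤ 1 ∧ ‖p.2‖ ≤ s := by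
    intro p hp hTp
    have h1 : ‖p.1‖ ^ a * ‖p.2‖ ^ b ≤ 1 := by
      rw [hTeq] at hTp
      exact (sq_le_one_iff₀ (by positivity)).1 hTp
    refine ⟨h1, ?_⟩
    have h2 : R ≤ ‖p.1‖ ^ a := hp.trans (le_self_pow₀ (hR1.trans hp) (by lia))
    have h3 : R * ‖p.2‖ ^ b ≤ 1 := le_trans (by gcongr) h1
    have h4 : ‖p.2‖ ^ b ≤ s ^ b := by
      have h5 : s ^ b * R = 1 := mul_inv_cancel₀ (by positivity)
      calc ‖p.2‖ ^ b = s ^ b * (R * ‖p.2‖ ^ b) := by rw [← mul_assoc, h5, one_mul]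
        _ ≤ s ^ b * 1 := by gcongr
        _ = s ^ b := mul_one _
    exact le_of_pow_le_pow_left₀ (by lia) hs.le h4
  have hHsupp : ∀ p, H p ≠ 0 → ‖p.2‖ ≤ s := fun p hp => by
    have h1 : κ p.1 ≠ 0 := fun h => hp (by simp [H, k, h])
    have h2 : T p ≤ 1 := by
      by_contra h
      exact hp (by simp [H, u, hχzero _ (not_le.1 h).le])
    exact (hsmall p (hκsupp _ h1) h2).2
  have hP := poincare_snd hH hHsupp
  -- the bound for `∂̄H`
  have hdH : ∀ p, ‖dbar (0, 1) H p‖ ^ 2 ≤ 2 * Real.exp (2 * N) *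
      (‖dbar (0, 1) g p‖ ^ 2 * wt φ p + C₁ * (levi Γ f g p * wt φ p)) := fun p => by
    have hL0 := levi_nonneg Γ f g p
    have hw0 := (wt_pos φ p).le
    have e1 : dbar (0, 1) H p = k p.1 * (((deriv χ (T p) : ℝ) : ℂ) *
        dbar (0, 1) (fun q => (T q : ℂ)) p * g p + χ (T p) * dbar (0, 1) g p) := by
      rw [dbar_comp_fst_mul hk hu.smooth, dbar_mul (hX.differentiable (by simp))
        (hg.smooth.differentiable (by simp)), dbar_comp_real (hχ.differentiable (by simp))
        (hT.differentiable (by simp))]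
    by_cases hp : R ≤ ‖p.1‖ ∧ T p ≤ 1
    · obtain ⟨h1, h2⟩ := hsmall p hp.1 hp.2
      have hx : 1 ≤ ‖p.1‖ := hR1.trans hp.1
      have e2 : ‖k p.1‖ ^ 2 ≤ Real.exp (2 * N) * wt φ p := by
        rw [hknorm, wt, ← Real.exp_add]
        have h3 : κ p.1 ^ 2 ≤ 1 := pow_le_one₀ (hκ01 _).1 (hκ01 _).2
        have h4 : -2 * ψ p.1 ≤ 2 * N + -2 * φ p := by
          have := modelWeight_le_fst hb hab hx h1
          simp only [ψ, φ]
          linarith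
        calc κ p.1 ^ 2 * Real.exp (-2 * ψ p.1) ≤ 1 * Real.exp (2 * N + -2 * φ p) := by gcongr
          _ = _ := one_mul _
      -- The derivative of the cutoff `χ(|z^a w^b|²)` has the size of the coefficient of `g` in the
      -- Levi form. Its product with `g` is bounded by `(1 + a) √levi`, since here `|z|^{a-1} |w|^b
      -- ≤ 1` and `|f| ≤ √levi`. Hence no error term in `g` remains.
      have e3 : ‖((deriv χ (T p) : ℝ) : ℂ) * dbar (0, 1) (fun q => (T q : ℂ)) p * g p‖ ≤
          C * (1 + a) * √(levi Γ f g p) := by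
        rw [norm_mul, norm_mul, Complex.norm_real, Real.norm_eq_abs, norm_dbar_norm_sq_mono]
        have h3 := mixed_le_sqrt_levi habΓ f g p
        have h4 := fst_le_sqrt_levi hm hmΓ f g hx
        have h5 : a * ‖p.1‖ ^ (a - 1) * ‖p.2‖ ^ b * ‖f p‖ ≤ a * √(levi Γ f g p) := by
          have h6 : ‖p.1‖ ^ (a - 1) * ‖p.2‖ ^ b ≤ 1 := by
            refine le_trans ?_ h1
            exact mul_le_mul_of_nonneg_right (pow_le_pow_right₀ hx (by lia)) (by positivity)
          have h7 : ‖f p‖ ≤ √(levi Γ f g p) :=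
            (le_mul_of_one_le_left (norm_nonneg _) hx).trans h4
          calc a * ‖p.1‖ ^ (a - 1) * ‖p.2‖ ^ b * ‖f p‖ =
              a * ((‖p.1‖ ^ (a - 1) * ‖p.2‖ ^ b) * ‖f p‖) := by ring
            _ ≤ a * (1 * √(levi Γ f g p)) := by gcongr
            _ = _ := by rw [one_mul]
        calc |deriv χ (T p)| * (‖p.1‖ ^ a * ‖p.2‖ ^ b *
              (b * ‖p.1‖ ^ a * ‖p.2‖ ^ (b - 1))) * ‖g p‖
            = |deriv χ (T p)| * ((‖p.1‖ ^ a * ‖p.2‖ ^ b) *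
              (b * ‖p.1‖ ^ a * ‖p.2‖ ^ (b - 1) * ‖g p‖)) := by ring
          _ ≤ C * (1 * (√(levi Γ f g p) + a * √(levi Γ f g p))) := by
            gcongr
            · exact hχd _
            · linarith
          _ = _ := by ring
      have e4 : ‖(χ (T p) : ℂ) * dbar (0, 1) g p‖ ≤ ‖dbar (0, 1) g p‖ := by
        rw [norm_mul, Complex.norm_real, Real.norm_of_nonneg (hχ0 _)]
        exact mul_le_of_le_one_left (norm_nonneg _) (hχ1 _)
      have e5 : ‖((deriv χ (T p) : ℝ) : ℂ) * dbar (0, 1) (fun q => (T q : ℂ)) p * g p +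
          χ (T p) * dbar (0, 1) g p‖ ^ 2 ≤
          2 * (‖dbar (0, 1) g p‖ ^ 2 + C₁ * levi Γ f g p) := by
        have h3 := (norm_add_le _ _).trans (add_le_add e3 e4)
        have h4 := pow_le_pow_left₀ (norm_nonneg _) h3 2
        have h5 : (C * (1 + a) * √(levi Γ f g p)) ^ 2 = C₁ * levi Γ f g p := by
          rw [mul_pow, Real.sq_sqrt hL0, mul_pow]
        nlinarith [sq_nonneg (C * (1 + a) * √(levi Γ f g p) - ‖dbar (0, 1) g p‖)]
      rw [e1, norm_mul, mul_pow]
      calc _ ≤ (Real.exp (2 * N) * wt φ p) * (2 * (‖dbar (0, 1) g p‖ ^ 2 + C₁ * levi Γ f g p)) := by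
            gcongr
        _ = _ := by ring
    · have : dbar (0, 1) H p = 0 := by
        rw [e1]
        rcases not_and_or.1 hp with h | h
        · have : κ p.1 = 0 := by
            by_contra h'
            exact h (hκsupp _ h')
          simp [k, this]
        · rw [hχd0 _ (not_le.1 h).le, hχzero _ (not_le.1 h).le]
          simp
      rw [this, norm_zero, zero_pow two_ne_zero]
      positivity
  -- the bound for `g`
  have hgb : ∀ p : ℂ × ℂ, 2 * R ≤ ‖p.1‖ → ‖g p‖ ^ 2 * wt φ p ≤
      2 * ‖H p‖ ^ 2 + 2 * ((2 + a) ^ 2 * s ^ 2) * (levi Γ f g p * wt φ p) := fun p hp => by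
    have hL0 := levi_nonneg Γ f g p
    have hw0 := (wt_pos φ p).le
    have e1 : wt φ p ≤ ‖k p.1‖ ^ 2 := by
      rw [hknorm, hκone _ hp, one_pow, one_mul, wt]
      have := modelWeight_fst_le Γ p
      refine Real.exp_le_exp.2 ?_
      simp only [ψ, φ]
      linarith
    have e2 : ‖χ (T p) * g p‖ ^ 2 * wt φ p ≤ ‖H p‖ ^ 2 := by
      simp only [H, u]
      rw [norm_mul (k p.1), mul_pow, mul_comm (‖k p.1‖ ^ 2)]
      gcongr
    -- On the support of `1 - χ(T)` one has `T ≥ 1 / 2`, so `|z^a w^b| ≥ 1 / 2` and the pointwise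
    -- bound by the Levi form applies.
    have e3 : ‖(1 - χ (T p)) * g p‖ ^ 2 ≤ (2 + a) ^ 2 * s ^ 2 * levi Γ f g p := by
      rcases le_total (T p) (1 / 2) with h | h
      · rw [hχone _ h]
        rw [ofReal_one, sub_self, zero_mul, norm_zero, zero_pow two_ne_zero]
        positivity
      · have h1 : 1 / 2 ≤ ‖p.1‖ ^ a * ‖p.2‖ ^ b := by
          rw [hTeq] at h
          by_contra h'
          have h0 : 0 ≤ ‖p.1‖ ^ a * ‖p.2‖ ^ b := by positivity
          nlinarith
        refine le_trans ?_ (sq_norm_le_levi hm hn hmΓ hnΓ ha hb habΓ f g hs hs1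
          (le_trans (by linarith) hp) h1)
        gcongr
        rw [norm_mul]
        refine mul_le_of_le_one_left (norm_nonneg _) ?_
        rw [← ofReal_one, ← ofReal_sub, Complex.norm_real, Real.norm_of_nonneg
          (sub_nonneg.2 (hχ1 _))]
        linarith [hχ0 (T p)]
    have e4 : ‖g p‖ ^ 2 ≤ 2 * ‖χ (T p) * g p‖ ^ 2 + 2 * ‖(1 - χ (T p)) * g p‖ ^ 2 := by
      have h1 : g p = χ (T p) * g p + (1 - χ (T p)) * g p := by ring
      have h2 := norm_add_le (χ (T p) * g p) ((1 - χ (T p)) * g p)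
      rw [← h1] at h2
      have h3 := pow_le_pow_left₀ (norm_nonneg _) h2 2
      nlinarith [sq_nonneg (‖χ (T p) * g p‖ - ‖(1 - χ (T p)) * g p‖)]
    calc ‖g p‖ ^ 2 * wt φ p ≤ (2 * ‖χ (T p) * g p‖ ^ 2 + 2 * ((2 + a) ^ 2 * s ^ 2 * levi Γ f g p)) *
          wt φ p := by
          gcongr
          linarith
      _ ≤ _ := by nlinarith
  have iH : Integrable fun p => ‖H p‖ ^ 2 := by
    simpa [wt] using hH.integrable_norm_sq (φ := fun _ => 0) contDiff_const
  have idH : Integrable fun p => ‖dbar (0, 1) H p‖ ^ 2 := by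
    simpa [wt] using (hH.dbar (0, 1)).integrable_norm_sq (φ := fun _ => 0) contDiff_const
  have iL : Integrable fun p => levi Γ f g p * wt φ p := hf.integrable_levi hφ hg
  have ig : Integrable fun p => ‖g p‖ ^ 2 * wt φ p := hg.integrable_norm_sq hφ
  have idg : Integrable fun p => ‖dbar (0, 1) g p‖ ^ 2 * wt φ p := (hg.dbar _).integrable_norm_sq hφ
  have hmeas : MeasurableSet {p : ℂ × ℂ | 2 * R ≤ ‖p.1‖} :=
    (isClosed_le continuous_const (by fun_prop)).measurableSet
  have s1 : ∫ p in {p : ℂ × ℂ | 2 * R ≤ ‖p.1‖}, ‖g p‖ ^ 2 * wt φ p ≤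
      ∫ p, (2 * ‖H p‖ ^ 2 + 2 * ((2 + a) ^ 2 * s ^ 2) * (levi Γ f g p * wt φ p)) := by
    refine (setIntegral_mono_on ig.integrableOn
      ((iH.const_mul 2).add (iL.const_mul _)).integrableOn hmeas hgb).trans ?_
    refine setIntegral_le_integral ((iH.const_mul 2).add (iL.const_mul _))
      (Filter.Eventually.of_forall fun p => ?_)
    have hL0 := levi_nonneg Γ f g p
    have hw0 := (wt_pos φ p).le
    simp only [Pi.zero_apply, Pi.add_apply]
    positivity
  have s2 : ∫ p, ‖dbar (0, 1) H p‖ ^ 2 ≤ ∫ p, 2 * Real.exp (2 * N) *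
      (‖dbar (0, 1) g p‖ ^ 2 * wt φ p + C₁ * (levi Γ f g p * wt φ p)) :=
    integral_mono idH ((idg.add (iL.const_mul _)).const_mul _) hdH
  rw [integral_add (f := fun p => 2 * ‖H p‖ ^ 2) (iH.const_mul 2) (iL.const_mul _),
    integral_const_mul, integral_const_mul] at s1
  rw [integral_const_mul, integral_add idg (iL.const_mul _), integral_const_mul] at s2
  set D := ∫ p, ‖dbar (0, 1) g p‖ ^ 2 * wt φ p
  set L := ∫ p, levi Γ f g p * wt φ p
  have hD0 : 0 ≤ D := integral_nonneg fun p => mul_nonneg (by positivity) (wt_pos φ p).le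
  have hL0 : 0 ≤ L := integral_nonneg fun p => mul_nonneg (levi_nonneg _ _ _ _) (wt_pos φ p).le
  have s3 : ∫ p, ‖H p‖ ^ 2 ≤ 4 * s ^ 2 * (2 * Real.exp (2 * N) * (D + C₁ * L)) :=
    hP.trans (by gcongr)
  have s4 : D + C₁ * L ≤ (1 + C₁) * (D + L) := by nlinarith [mul_nonneg hC₁ hD0]
  calc _ ≤ 2 * (4 * s ^ 2 * (2 * Real.exp (2 * N) * ((1 + C₁) * (D + L)))) +
        2 * ((2 + a) ^ 2 * s ^ 2) * (D + L) := by
        refine s1.trans (add_le_add ?_ ?_)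
        · refine mul_le_mul_of_nonneg_left (s3.trans ?_) zero_le_two
          gcongr
        · gcongr
          linarith
    _ = M * s ^ 2 * (D + L) := by
        simp only [M]
        ring
    _ ≤ ε * (D + L) := by gcongr

/-! ### Exchanging the two variables -/

theorem integral_comp_swap (F : ℂ × ℂ → ℝ) : ∫ p : ℂ × ℂ, F p.swap = ∫ p, F p :=
  (Measure.measurePreserving_swap (μ := (volume : Measure ℂ)) (ν := (volume : Measure ℂ))).integral_comp
    MeasurableEquiv.prodComm.measurableEmbedding F

theorem setIntegral_comp_swap (F : ℂ × ℂ → ℝ) (s : Set (ℂ × ℂ)) :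
    ∫ p : ℂ × ℂ in Prod.swap ⁻¹' s, F p.swap = ∫ p in s, F p :=
  (Measure.measurePreserving_swap (μ := (volume : Measure ℂ))
    (ν := (volume : Measure ℂ))).setIntegral_preimage_emb
    MeasurableEquiv.prodComm.measurableEmbedding F s

theorem contDiff_swap : ContDiff ℝ ∞ (Prod.swap : ℂ × ℂ → ℂ × ℂ) :=
  contDiff_snd.prodMk contDiff_fst

theorem IsTest.comp_swap {f : ℂ × ℂ → ℂ} (hf : IsTest f) : IsTest fun p => f p.swap :=
  ⟨hf.smooth.comp contDiff_swap, hf.compact.comp_homeomorph (Homeomorph.prodComm ℂ ℂ)⟩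

theorem dbar_comp_swap {f : ℂ × ℂ → ℂ} (hf : IsTest f) (e p : ℂ × ℂ) :
    dbar e (fun q => f q.swap) p = dbar e.swap f p.swap := by
  have h1 : HasFDerivAt (Prod.swap : ℂ × ℂ → ℂ × ℂ)
      ((ContinuousLinearMap.snd ℝ ℂ ℂ).prod (ContinuousLinearMap.fst ℝ ℂ ℂ)) p :=
    hasFDerivAt_snd.prodMk hasFDerivAt_fst
  have h2 : fderiv ℝ (fun q : ℂ × ℂ => f q.swap) p = _ :=
    (((hf.smooth.differentiable (by simp)) p.swap).hasFDerivAt.comp p h1).fderiv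
  rw [dbar, dbar, h2]
  rfl

theorem modelWeight_image_swap (Γ : Finset (ℕ × ℕ)) (p : ℂ × ℂ) :
    modelWeight (Γ.image Prod.swap) p = modelWeight Γ p.swap := by
  rw [modelWeight_apply, modelWeight_apply, Finset.sum_image Prod.swap_injective.injOn]
  refine Finset.sum_congr rfl fun γ _ => ?_
  simp only [mono, Prod.fst_swap, Prod.snd_swap, mul_comm]

theorem levi_image_swap (Γ : Finset (ℕ × ℕ)) (f g : ℂ × ℂ → ℂ) (p : ℂ × ℂ) :
    levi (Γ.image Prod.swap) (fun q => g q.swap) (fun q => f q.swap) p = levi Γ f g p.swap := by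
  rw [levi, levi, Finset.sum_image Prod.swap_injective.injOn]
  refine Finset.sum_congr rfl fun γ _ => ?_
  simp only [del_mono_fst, del_mono_snd, Prod.fst_swap, Prod.snd_swap]
  congr 2
  ring

/-- The mirror image of `exists_tail_snd`: exchanging `z` with `w` and `f` with `g` preserves the
hypotheses on the exponents. -/
theorem exists_tail_fst {Γ : Finset (ℕ × ℕ)} {m n : ℕ} (hm : 2 ≤ m) (hn : 2 ≤ n)
    (hmΓ : (m, 0) ∈ Γ) (hnΓ : (0, n) ∈ Γ) (hΓ : ¬ IsDecoupled Γ) {ε : ℝ} (hε : 0 < ε) :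
    ∃ R > 0, ∀ f g, IsTest f → IsTest g →
      ∫ p in {p : ℂ × ℂ | R ≤ ‖p.2‖}, ‖f p‖ ^ 2 * wt (modelWeight Γ) p ≤
        ε * ((∫ p, ‖dbar (1, 0) f p‖ ^ 2 * wt (modelWeight Γ) p) +
          ∫ p, levi Γ f g p * wt (modelWeight Γ) p) := by
  have hdec : ¬ IsDecoupled (Γ.image Prod.swap) := fun h => hΓ fun γ hγ =>
    (h γ.swap (Finset.mem_image_of_mem _ hγ)).symm
  obtain ⟨R, hR, h⟩ := exists_tail_snd hn hm (Finset.mem_image_of_mem Prod.swap hnΓ)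
    (Finset.mem_image_of_mem Prod.swap hmΓ) hdec hε
  refine ⟨R, hR, fun f g hf hg => ?_⟩
  have hw : ∀ p, wt (modelWeight (Γ.image Prod.swap)) p = wt (modelWeight Γ) p.swap := fun p => by
    rw [wt, wt, modelWeight_image_swap]
  have h1 := h _ _ hg.comp_swap hf.comp_swap
  simp only [hw, levi_image_swap, dbar_comp_swap hf, Prod.swap_prod_mk] at h1
  rw [integral_comp_swap fun p => ‖dbar (1, 0) f p‖ ^ 2 * wt (modelWeight Γ) p,
    integral_comp_swap fun p => levi Γ f g p * wt (modelWeight Γ) p] at h1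
  rwa [← setIntegral_comp_swap]

theorem setIntegral_le_of_mul_le_sqrt {Γ : Finset (ℕ × ℕ)} {φ : ℂ × ℂ → ℝ} (hφ : ContDiff ℝ ∞ φ)
    {f g h : ℂ × ℂ → ℂ} (hf : IsTest f) (hg : IsTest g) (hh : IsTest h) {s : Set (ℂ × ℂ)}
    (hs : MeasurableSet s) {R : ℝ} (hR : 0 < R)
    (hle : ∀ p ∈ s, R * ‖h p‖ ≤ √(levi Γ f g p)) :
    ∫ p in s, ‖h p‖ ^ 2 * wt φ p ≤ (R ^ 2)⁻¹ * ∫ p, levi Γ f g p * wt φ p := by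
  rw [← integral_const_mul]
  have hL := (hf.integrable_levi (Γ := Γ) hφ hg).const_mul (R ^ 2)⁻¹
  refine (setIntegral_mono_on (hh.integrable_norm_sq hφ).integrableOn hL.integrableOn hs
    fun p hp => ?_).trans (setIntegral_le_integral hL (Filter.Eventually.of_forall fun p => ?_))
  · rw [← mul_assoc]
    refine mul_le_mul_of_nonneg_right ?_ (wt_pos φ p).le
    rw [inv_mul_eq_div, le_div_iff₀ (by positivity)]
    have h1 := pow_le_pow_left₀ (by positivity) (hle p hp) 2
    rw [Real.sq_sqrt (levi_nonneg _ _ _ _), mul_pow] at h1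
    linarith
  · have := levi_nonneg Γ f g p
    have := (wt_pos φ p).le
    simp only [Pi.zero_apply]
    positivity

/-- Forms of bounded energy are uniformly small near infinity if the weight is not decoupled. -/
theorem exists_tail {Γ : Finset (ℕ × ℕ)} {m n : ℕ} (hm : 2 ≤ m) (hn : 2 ≤ n)
    (hmΓ : (m, 0) ∈ Γ) (hnΓ : (0, n) ∈ Γ) (hΓ : ¬ IsDecoupled Γ) {ε : ℝ} (hε : 0 < ε) :
    ∃ R > 0, ∀ f g, IsTest f → IsTest g →
      ∫ p in (Metric.ball 0 R)ᶜ, (‖f p‖ ^ 2 + ‖g p‖ ^ 2) * wt (modelWeight Γ) p ≤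
        ε * ((∫ p, ‖dbar (1, 0) f p‖ ^ 2 * wt (modelWeight Γ) p) +
          (∫ p, ‖dbar (0, 1) g p‖ ^ 2 * wt (modelWeight Γ) p) +
          ∫ p, levi Γ f g p * wt (modelWeight Γ) p) := by
  obtain ⟨R₁, hR₁, h₁⟩ := exists_tail_fst hm hn hmΓ hnΓ hΓ (ε := ε / 4) (by positivity)
  obtain ⟨R₂, hR₂, h₂⟩ := exists_tail_snd hm hn hmΓ hnΓ hΓ (ε := ε / 4) (by positivity)
  -- Beyond the two tail radii, `R ≥ 1` and `R ≥ 4 / ε` give `R⁻² ≤ ε / 4`, so that each of the four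
  -- pieces below costs at most `ε / 4`.
  let R := max (max R₁ R₂) (max 1 (4 / ε))
  have hRR1 : R₁ ≤ R := (le_max_left _ _).trans (le_max_left _ _)
  have hRR2 : R₂ ≤ R := (le_max_right _ _).trans (le_max_left _ _)
  have hR1 : 1 ≤ R := (le_max_left _ _).trans (le_max_right _ _)
  have hR4 : 4 / ε ≤ R := (le_max_right _ _).trans (le_max_right _ _)
  have hR0 : 0 < R := by linarith
  refine ⟨R, hR0, fun f g hf hg => ?_⟩
  set φ := modelWeight Γ
  have hφ : ContDiff ℝ ∞ φ := contDiff_modelWeight Γ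
  have hRε : (R ^ 2)⁻¹ ≤ ε / 4 := by
    rw [inv_le_comm₀ (by positivity) (by positivity), inv_div]
    nlinarith
  have m1 : MeasurableSet {p : ℂ × ℂ | R ≤ ‖p.1‖} :=
    (isClosed_le continuous_const (by fun_prop)).measurableSet
  have m2 : MeasurableSet {p : ℂ × ℂ | R ≤ ‖p.2‖} :=
    (isClosed_le continuous_const (by fun_prop)).measurableSet
  have i1 := hf.integrable_norm_sq hφ
  have i2 := hg.integrable_norm_sq hφ
  have n1 : ∀ p, 0 ≤ ‖f p‖ ^ 2 * wt φ p := fun p => mul_nonneg (by positivity) (wt_pos φ p).le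
  have n2 : ∀ p, 0 ≤ ‖g p‖ ^ 2 * wt φ p := fun p => mul_nonneg (by positivity) (wt_pos φ p).le
  have hset : (Metric.ball (0 : ℂ × ℂ) R)ᶜ = {p | R ≤ ‖p.1‖} ∪ {p | R ≤ ‖p.2‖} := by
    ext p
    simp only [Set.mem_compl_iff, mem_ball_zero_iff, Prod.norm_def, max_lt_iff, not_and_or, not_lt,
      Set.mem_union, Set.mem_ofPred_eq]
  have hadd : ∫ p in (Metric.ball 0 R)ᶜ, (‖f p‖ ^ 2 + ‖g p‖ ^ 2) * wt φ p =
      (∫ p in (Metric.ball 0 R)ᶜ, ‖f p‖ ^ 2 * wt φ p) +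
        ∫ p in (Metric.ball 0 R)ᶜ, ‖g p‖ ^ 2 * wt φ p := by
    rw [← integral_add i1.integrableOn i2.integrableOn]
    simp only [add_mul]
  have hunion : ∀ {F : ℂ × ℂ → ℝ}, Integrable F → (∀ p, 0 ≤ F p) →
      ∫ p in (Metric.ball 0 R)ᶜ, F p ≤ (∫ p in {p | R ≤ ‖p.1‖}, F p) + ∫ p in {p | R ≤ ‖p.2‖}, F p := by
    intro F hF hF0
    have hi : ∀ s, Integrable F (volume.restrict s) := fun s => hF.mono_measure Measure.restrict_le_self
    rw [hset, ← integral_add_measure (hi _) (hi _)]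
    exact integral_mono_measure (Measure.restrict_union_le _ _)
      (Filter.Eventually.of_forall hF0) ((hi _).add_measure (hi _))
  -- The complement of the sup-norm ball is `{|z| ≥ R} ∪ {|w| ≥ R}`. The pure powers handle `f` on
  -- the first set and `g` on the second; the tail lemmas handle the two crossed cases.
  have a1 := setIntegral_le_of_mul_le_sqrt (Γ := Γ) hφ hf hg hf m1 hR0 fun p hp =>
    le_trans (mul_le_mul_of_nonneg_right hp (norm_nonneg _))
      (fst_le_sqrt_levi hm hmΓ f g (hR1.trans hp))
  have a2 := setIntegral_le_of_mul_le_sqrt (Γ := Γ) hφ hf hg hg m2 hR0 fun p hp =>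
    le_trans (mul_le_mul_of_nonneg_right hp (norm_nonneg _))
      (snd_le_sqrt_levi hn hnΓ f g (hR1.trans hp))
  have a3 : ∫ p in {p | R ≤ ‖p.2‖}, ‖f p‖ ^ 2 * wt φ p ≤ _ :=
    (setIntegral_mono_set i1.integrableOn (Filter.Eventually.of_forall n1)
      (Filter.Eventually.of_forall fun p (hp : R ≤ ‖p.2‖) => hRR1.trans hp)).trans (h₁ f g hf hg)
  have a4 : ∫ p in {p | R ≤ ‖p.1‖}, ‖g p‖ ^ 2 * wt φ p ≤ _ :=
    (setIntegral_mono_set i2.integrableOn (Filter.Eventually.of_forall n2)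
      (Filter.Eventually.of_forall fun p (hp : R ≤ ‖p.1‖) => hRR2.trans hp)).trans (h₂ f g hf hg)
  have a5 := hunion i1 n1
  have a6 := hunion i2 n2
  have L0 : 0 ≤ ∫ p, levi Γ f g p * wt φ p :=
    integral_nonneg fun p => mul_nonneg (levi_nonneg _ _ _ _) (wt_pos φ p).le
  have D1 : 0 ≤ ∫ p, ‖dbar (1, 0) f p‖ ^ 2 * wt φ p :=
    integral_nonneg fun p => mul_nonneg (by positivity) (wt_pos φ p).le
  have D2 : 0 ≤ ∫ p, ‖dbar (0, 1) g p‖ ^ 2 * wt φ p :=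
    integral_nonneg fun p => mul_nonneg (by positivity) (wt_pos φ p).le
  rw [hadd]
  have a7 := mul_le_mul_of_nonneg_right hRε L0
  have a8 := mul_nonneg hε.le D1
  have a9 := mul_nonneg hε.le D2
  linarith

end Tail

/-! ### Mollification -/

section Mollifier

open scoped Convolution

theorem isAddHaarMeasure_volume : (volume : Measure (ℂ × ℂ)).IsAddHaarMeasure :=
  inferInstanceAs ((volume : Measure ℂ).prod (volume : Measure ℂ)).IsAddHaarMeasure

/-- A smooth approximate identity at scale `h`. -/
structure IsMollifier (h : ℝ) (ρ : ℂ × ℂ → ℝ) : Prop where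
  smooth : ContDiff ℝ ∞ ρ
  compact : HasCompactSupport ρ
  nonneg : ∀ x, 0 ≤ ρ x
  integral_eq : ∫ x, ρ x = 1
  norm_lt : ∀ x, ρ x ≠ 0 → ‖x‖ < h

theorem exists_isMollifier {h : ℝ} (hh : 0 < h) : ∃ ρ, IsMollifier h ρ := by
  have := isAddHaarMeasure_volume
  let b : ContDiffBump (0 : ℂ × ℂ) := ⟨h / 2, h, by linarith, by linarith⟩
  refine ⟨b.normed volume, b.contDiff_normed, b.hasCompactSupport_normed, b.nonneg_normed,
    b.integral_normed, fun x hx => ?_⟩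
  have : x ∈ Function.support (b.normed (volume : Measure (ℂ × ℂ))) := hx
  rw [b.support_normed_eq] at this
  simpa using this

/-- Convolution of `U` with `ρ`. -/
def conv (ρ : ℂ × ℂ → ℝ) (U : ℂ × ℂ → ℂ) (x : ℂ × ℂ) : ℂ := ∫ t, U t * (ρ (x - t) : ℂ)

variable {h : ℝ} {ρ : ℂ × ℂ → ℝ} {U : ℂ × ℂ → ℂ}

theorem conv_eq_convolution (ρ : ℂ × ℂ → ℝ) (U : ℂ × ℂ → ℂ) :
    conv ρ U = U ⋆[ContinuousLinearMap.mul ℝ ℂ] (fun x => (ρ x : ℂ)) := rfl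

theorem IsMollifier.isTest (hρ : IsMollifier h ρ) : IsTest fun x => (ρ x : ℂ) :=
  ⟨contDiff_ofReal_comp hρ.smooth, hρ.compact.comp_left (g := ((↑) : ℝ → ℂ)) (by simp)⟩

theorem IsTest.comp_sub_left {f : ℂ × ℂ → ℂ} (hf : IsTest f) (x : ℂ × ℂ) :
    IsTest fun t => f (x - t) :=
  ⟨hf.smooth.comp (contDiff_const.sub contDiff_id),
    hf.compact.comp_homeomorph (Homeomorph.subLeft x)⟩

theorem fderiv_comp_sub_left {f : ℂ × ℂ → ℂ} (hf : Differentiable ℝ f) (x t v : ℂ × ℂ) :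
    fderiv ℝ (fun t => f (x - t)) t v = -fderiv ℝ f (x - t) v := by
  have h := ((hf (x - t)).hasFDerivAt.comp t ((hasFDerivAt_id t).const_sub x)).fderiv
  refine (congrArg (fun L : ℂ × ℂ →L[ℝ] ℂ => L v) h).trans ?_
  simp

theorem contDiff_conv (hρ : IsMollifier h ρ) (hU : LocallyIntegrable U) : ContDiff ℝ ∞ (conv ρ U) := by
  have := isAddHaarMeasure_volume
  exact hρ.isTest.compact.contDiff_convolution_right (ContinuousLinearMap.mul ℝ ℂ) hU hρ.isTest.smooth

theorem isTest_conv (hρ : IsMollifier h ρ) (hU : LocallyIntegrable U) (hc : HasCompactSupport U) :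
    IsTest (conv ρ U) := by
  refine ⟨contDiff_conv hρ hU, ?_⟩
  rw [conv_eq_convolution]
  exact HasCompactSupport.convolution _ hc hρ.isTest.compact

theorem integrable_mul_fderiv_comp_sub (hρ : IsMollifier h ρ) (hU : LocallyIntegrable U)
    (x v : ℂ × ℂ) : Integrable fun t => U t * fderiv ℝ (fun t => (ρ (x - t) : ℂ)) t v := by
  have h1 := hρ.isTest.comp_sub_left x
  have := hU.integrable_smul_left_of_hasCompactSupport
    (contDiff_fderiv_apply h1.smooth v).continuous (h1.compact.fderiv_apply ℝ v)
  exact this.congr (Filter.Eventually.of_forall fun t => by simp [mul_comm])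

theorem fderiv_conv_apply (hρ : IsMollifier h ρ) (hU : LocallyIntegrable U) (x v : ℂ × ℂ) :
    fderiv ℝ (conv ρ U) x v = -∫ t, U t * fderiv ℝ (fun t => (ρ (x - t) : ℂ)) t v := by
  have := isAddHaarMeasure_volume
  have h1 := (hρ.isTest.compact.hasFDerivAt_convolution_right (ContinuousLinearMap.mul ℝ ℂ) hU
    (hρ.isTest.smooth.of_le (by simp)) x).fderiv
  rw [conv_eq_convolution, h1, convolution_precompR_apply _ hU (hρ.isTest.compact.fderiv ℝ)
    (hρ.isTest.smooth.continuous_fderiv (by simp)), ← integral_neg]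
  refine integral_congr_ae (Filter.Eventually.of_forall fun t => ?_)
  simp only [fderiv_comp_sub_left (hρ.isTest.smooth.differentiable (by simp)), ContinuousLinearMap.mul_apply']
  ring

theorem dbar_conv (hρ : IsMollifier h ρ) (hU : LocallyIntegrable U) (e x : ℂ × ℂ) :
    dbar e (conv ρ U) x = -∫ t, U t * dbar e (fun t => (ρ (x - t) : ℂ)) t := by
  have h1 := integrable_mul_fderiv_comp_sub hρ hU x
  have h2 : ∀ t, U t * dbar e (fun t => (ρ (x - t) : ℂ)) t =
      (1 / 2) * (U t * fderiv ℝ (fun t => (ρ (x - t) : ℂ)) t e) +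
        (I / 2) * (U t * fderiv ℝ (fun t => (ρ (x - t) : ℂ)) t (I • e)) := fun t => by
    rw [dbar]; ring
  simp only [h2]
  rw [integral_add ((h1 _).const_mul _) ((h1 _).const_mul _), integral_const_mul,
    integral_const_mul, dbar, fderiv_conv_apply hρ hU, fderiv_conv_apply hρ hU]
  ring

theorem del_conv (hρ : IsMollifier h ρ) (hU : LocallyIntegrable U) (e x : ℂ × ℂ) :
    del e (conv ρ U) x = -∫ t, U t * del e (fun t => (ρ (x - t) : ℂ)) t := by
  have h1 := integrable_mul_fderiv_comp_sub hρ hU x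
  have h2 : ∀ t, U t * del e (fun t => (ρ (x - t) : ℂ)) t =
      (1 / 2) * (U t * fderiv ℝ (fun t => (ρ (x - t) : ℂ)) t e) +
        (-I / 2) * (U t * fderiv ℝ (fun t => (ρ (x - t) : ℂ)) t (I • e)) := fun t => by
    rw [del]; ring
  simp only [h2]
  rw [integral_add ((h1 _).const_mul _) ((h1 _).const_mul _), integral_const_mul,
    integral_const_mul, del, fderiv_conv_apply hρ hU, fderiv_conv_apply hρ hU]
  ring

theorem conv_eq_integral_smul (ρ : ℂ × ℂ → ℝ) (U : ℂ × ℂ → ℂ) (x : ℂ × ℂ) :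
    conv ρ U x = ∫ t, ρ t • U (x - t) := by
  have := isAddHaarMeasure_volume
  rw [conv, ← integral_sub_left_eq_self _ _ x]
  refine integral_congr_ae (Filter.Eventually.of_forall fun t => ?_)
  simp [mul_comm]

theorem IsMollifier.integrable (hρ : IsMollifier h ρ) : Integrable ρ :=
  hρ.smooth.continuous.integrable_of_hasCompactSupport hρ.compact

/-- The probability measure with density `ρ`. -/
theorem IsMollifier.isProbabilityMeasure (hρ : IsMollifier h ρ) :
    IsProbabilityMeasure ((volume : Measure (ℂ × ℂ)).withDensity fun t => ENNReal.ofReal (ρ t)) := by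
  constructor
  rw [withDensity_apply _ MeasurableSet.univ, setLIntegral_univ,
    ← ofReal_integral_eq_lintegral_ofReal hρ.integrable (Filter.Eventually.of_forall hρ.nonneg),
    hρ.integral_eq, ENNReal.ofReal_one]

theorem eLpNorm_two_sq {α : Type*} [MeasurableSpace α] (ν : Measure α) (F : α → ℂ) :
    eLpNorm F 2 ν ^ 2 = ∫⁻ t, ‖F t‖ₑ ^ 2 ∂ν := by
  simpa using eLpNorm_nnreal_pow_eq_lintegral (f := F) (μ := ν) (p := 2) (by norm_num)

/-- Jensen's inequality for the square, through the monotonicity of `L^p` norms on a probability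
space. -/
theorem enorm_integral_sq_le {α : Type*} [MeasurableSpace α] (ν : Measure α) [IsProbabilityMeasure ν]
    {F : α → ℂ} (hF : AEStronglyMeasurable F ν) : ‖∫ t, F t ∂ν‖ₑ ^ 2 ≤ ∫⁻ t, ‖F t‖ₑ ^ 2 ∂ν := by
  have h1 : ‖∫ t, F t ∂ν‖ₑ ≤ eLpNorm F 1 ν := by
    rw [eLpNorm_one_eq_lintegral_enorm]
    exact enorm_integral_le_lintegral_enorm F
  have h2 := h1.trans (eLpNorm_le_eLpNorm_of_exponent_le (p := 1) (q := 2) (by norm_num) hF)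
  rw [← eLpNorm_two_sq]
  gcongr

/-- If all small translates of `U` are `L²`-close to `U`, so is its mollification. -/
theorem lintegral_enorm_conv_sub_sq_le (hρ : IsMollifier h ρ) (hU : LocallyIntegrable U)
    (hm : Measurable U) {K : ENNReal}
    (hK : ∀ t, ‖t‖ < h → ∫⁻ x, ‖U (x - t) - U x‖ₑ ^ 2 ≤ K) :
    ∫⁻ x, ‖conv ρ U x - U x‖ₑ ^ 2 ≤ K := by
  have := isAddHaarMeasure_volume
  have hp := hρ.isProbabilityMeasure
  have hρm : Measurable fun t => ENNReal.ofReal (ρ t) :=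
    ENNReal.measurable_ofReal.comp hρ.smooth.continuous.measurable
  set ν := (volume : Measure (ℂ × ℂ)).withDensity fun t => ENNReal.ofReal (ρ t) with hν
  have hmeas : Measurable fun q : (ℂ × ℂ) × (ℂ × ℂ) => U (q.1 - q.2) - U q.1 :=
    (hm.comp (measurable_fst.sub measurable_snd)).sub (hm.comp measurable_fst)
  -- As `ρ` has integral 1, the error is an average of the differences `U(x - t) - U(x)`; Jensen and
  -- Tonelli then reduce it to the translation bound.
  have h1 : ∀ x, conv ρ U x - U x = ∫ t, (U (x - t) - U x) ∂ν := fun x => by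
    rw [hν, integral_withDensity_eq_integral_toReal_smul hρm (by simp)]
    simp only [ENNReal.toReal_ofReal (hρ.nonneg _), smul_sub]
    have hi : Integrable fun t => ρ t • U (x - t) := by
      have := hρ.compact.convolutionExists_left (ContinuousLinearMap.lsmul ℝ ℝ)
        hρ.smooth.continuous hU x
      exact this
    rw [integral_sub hi (hρ.integrable.smul_const _), integral_smul_const, hρ.integral_eq, one_smul,
      conv_eq_integral_smul]
  calc ∫⁻ x, ‖conv ρ U x - U x‖ₑ ^ 2 ≤ ∫⁻ x, ∫⁻ t, ‖U (x - t) - U x‖ₑ ^ 2 ∂ν := by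
        refine lintegral_mono fun x => ?_
        rw [h1]
        exact enorm_integral_sq_le ν (hmeas.comp measurable_prodMk_left).aestronglyMeasurable
    _ = ∫⁻ t, (∫⁻ x, ‖U (x - t) - U x‖ₑ ^ 2) ∂ν := by
        exact lintegral_lintegral_swap (f := fun x t => ‖U (x - t) - U x‖ₑ ^ 2) (hmeas.enorm.pow_const 2).aemeasurable
    _ ≤ ∫⁻ _, K ∂ν := by
        refine lintegral_mono_ae ?_
        rw [hν, ae_withDensity_iff hρm]
        refine Filter.Eventually.of_forall fun t ht => hK t (hρ.norm_lt t fun h0 => ht ?_)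
        simp [h0]
    _ = K := by simp

/-- Continuity of translations in `L²`. -/
theorem exists_translate_lt (hU : MemLp U 2) {ε : ENNReal} (hε : ε ≠ 0) :
    ∃ h > 0, ∀ t : ℂ × ℂ, ‖t‖ < h → ∫⁻ x, ‖U (x - t) - U x‖ₑ ^ 2 ≤ ε ^ 2 := by
  have := isAddHaarMeasure_volume
  have hmp : ∀ t : ℂ × ℂ, MeasurePreserving (fun x => x - t) := fun t =>
    measurePreserving_sub_right volume t
  let T : C(ℂ × ℂ, C(ℂ × ℂ, ℂ × ℂ)) :=
    (ContinuousMap.mk (fun q : (ℂ × ℂ) × (ℂ × ℂ) => q.2 - q.1) (by fun_prop)).curry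
  have hc : Continuous fun t => Lp.compMeasurePreserving (T t) (hmp t) (hU.toLp U) :=
    continuous_const.compMeasurePreservingLp T.continuous hmp (by simp)
  have h2 := (hc.tendsto 0).eventually (Metric.eball_mem_nhds _ (pos_iff_ne_zero.2 hε))
  obtain ⟨h, hh, h3⟩ := Metric.eventually_nhds_iff.1 h2
  refine ⟨h, hh, fun t ht => ?_⟩
  have h4 : edist ((hU.comp_measurePreserving (hmp t)).toLp _)
    ((hU.comp_measurePreserving (hmp 0)).toLp _) < ε := h3 (y := t) (by simpa using ht)
  rw [Lp.edist_toLp_toLp] at h4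
  rw [← eLpNorm_two_sq volume fun x => U (x - t) - U x]
  gcongr
  refine (eLpNorm_congr_ae (Filter.Eventually.of_forall fun x => ?_)).trans_le h4.le
  simp

theorem exists_conv_sub_le (hU : MemLp U 2) (hm : Measurable U) {ε : ENNReal} (hε : ε ≠ 0) :
    ∃ h₀ > 0, ∀ h ≤ h₀, ∀ ρ, IsMollifier h ρ →
      eLpNorm (fun x => conv ρ U x - U x) 2 volume ≤ ε := by
  obtain ⟨h₀, hh, h1⟩ := exists_translate_lt hU hε
  refine ⟨h₀, hh, fun h hle ρ hρ => ?_⟩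
  have h2 := lintegral_enorm_conv_sub_sq_le hρ (hU.locallyIntegrable (by norm_num)) hm
    fun t ht => h1 t (ht.trans_le hle)
  rw [← eLpNorm_two_sq] at h2
  exact (ENNReal.pow_right_strictMono two_ne_zero).le_iff_le.1 h2

theorem support_conv_subset {R : ℝ} (hρ : IsMollifier h ρ) (hU : ∀ x, R ≤ ‖x‖ → U x = 0) {x : ℂ × ℂ}
    (hx : R + h ≤ ‖x‖) : conv ρ U x = 0 := by
  refine integral_eq_zero_of_ae (Filter.Eventually.of_forall fun t => ?_)
  by_cases ht : R ≤ ‖t‖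
  · simp [hU t ht]
  · have : ρ (x - t) = 0 := by
      by_contra h0
      have := hρ.norm_lt _ h0
      have := norm_sub_norm_le x t
      linarith
    simp [this]

end Mollifier

/-! ### Local compactness -/

section LocalCompactness

variable {f g : ℂ × ℂ → ℂ}

theorem fderiv_apply_eq (f : ℂ × ℂ → ℂ) (p t : ℂ × ℂ) :
    fderiv ℝ f p t = t.1 * del (1, 0) f p + conj t.1 * dbar (1, 0) f p +
      (t.2 * del (0, 1) f p + conj t.2 * dbar (0, 1) f p) := by
  have ht : t = t.1.re • ((1 : ℂ), (0 : ℂ)) + t.1.im • (I • ((1 : ℂ), (0 : ℂ))) +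
      (t.2.re • ((0 : ℂ), (1 : ℂ)) + t.2.im • (I • ((0 : ℂ), (1 : ℂ)))) := by
    ext <;> simp
  have hz : ∀ (z a b : ℂ), (z.re : ℂ) * a + z.im * b =
      z * ((a - I * b) / 2) + conj z * ((a + I * b) / 2) := fun z a b => by
    have h1 : conj z = z.re - z.im * I := by
      apply Complex.ext <;> simp
    rw [h1]
    nth_rewrite 3 [← re_add_im z]
    linear_combination (z.im * b) * I_mul_I
  conv_lhs => rw [ht]
  simp only [map_add, map_smul, real_smul]
  rw [hz, hz]
  rfl

theorem norm_fderiv_apply_sq_le (f : ℂ × ℂ → ℂ) (p t : ℂ × ℂ) :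
    ‖fderiv ℝ f p t‖ ^ 2 ≤ 4 * ‖t‖ ^ 2 * (‖del (1, 0) f p‖ ^ 2 + ‖dbar (1, 0) f p‖ ^ 2 +
      (‖del (0, 1) f p‖ ^ 2 + ‖dbar (0, 1) f p‖ ^ 2)) := by
  have h1 : ‖t.1‖ ≤ ‖t‖ := norm_fst_le t
  have h2 : ‖t.2‖ ≤ ‖t‖ := norm_snd_le t
  have h3 : ‖fderiv ℝ f p t‖ ≤ ‖t‖ * (‖del (1, 0) f p‖ + ‖dbar (1, 0) f p‖ +
      (‖del (0, 1) f p‖ + ‖dbar (0, 1) f p‖)) := by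
    rw [fderiv_apply_eq, mul_add, mul_add, mul_add]
    refine (norm_add_le _ _).trans (add_le_add ((norm_add_le _ _).trans (add_le_add ?_ ?_))
      ((norm_add_le _ _).trans (add_le_add ?_ ?_))) <;>
    · rw [norm_mul]
      refine mul_le_mul_of_nonneg_right ?_ (norm_nonneg _)
      simp [h1, h2]
  have h4 : ∀ a b c d : ℝ, (a + b + (c + d)) ^ 2 ≤ 4 * (a ^ 2 + b ^ 2 + (c ^ 2 + d ^ 2)) := by
    intro a b c d
    linarith [sq_nonneg (a - b), sq_nonneg (a - c), sq_nonneg (a - d),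
      sq_nonneg (b - c), sq_nonneg (b - d), sq_nonneg (c - d)]
  calc _ ≤ _ := pow_le_pow_left₀ (norm_nonneg _) h3 2
    _ ≤ _ := by
      rw [mul_pow, mul_comm (4 : ℝ), mul_assoc]
      gcongr
      exact h4 _ _ _ _

theorem IsTest.integrable_norm_sq_volume (hf : IsTest f) : Integrable fun p => ‖f p‖ ^ 2 := by
  simpa [wt] using hf.integrable_norm_sq (φ := fun _ => 0) contDiff_const

/-- The full gradient is controlled by the `∂̄`-derivatives alone, because for test functions `∂`
and `∂̄` have the same unweighted norm. -/
theorem integral_norm_fderiv_apply_sq_le (hf : IsTest f) (t : ℂ × ℂ) :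
    ∫ p, ‖fderiv ℝ f p t‖ ^ 2 ≤
      8 * ‖t‖ ^ 2 * ((∫ p, ‖dbar (1, 0) f p‖ ^ 2) + ∫ p, ‖dbar (0, 1) f p‖ ^ 2) := by
  have i1 := fun e => (hf.del e).integrable_norm_sq_volume
  have i2 := fun e => (hf.dbar e).integrable_norm_sq_volume
  have h := integral_mono_of_nonneg (μ := (volume : Measure (ℂ × ℂ)))
    (Filter.Eventually.of_forall fun p => by positivity)
    ((((i1 (1, 0)).add (i2 (1, 0))).add ((i1 (0, 1)).add (i2 (0, 1)))).const_mul (4 * ‖t‖ ^ 2))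
    (Filter.Eventually.of_forall fun p => norm_fderiv_apply_sq_le f p t)
  refine h.trans_eq ?_
  rw [integral_const_mul, integral_add' ((i1 _).add (i2 _)) ((i1 _).add (i2 _)),
    integral_add' (i1 _) (i2 _), integral_add' (i1 _) (i2 _),
    integral_norm_sq_delta_zero hf, integral_norm_sq_delta_zero hf]
  ring

theorem IsTest.lintegral_enorm_sq (hf : IsTest f) :
    ∫⁻ p, ‖f p‖ₑ ^ 2 = ENNReal.ofReal (∫ p, ‖f p‖ ^ 2) := by
  rw [ofReal_integral_eq_lintegral_ofReal hf.integrable_norm_sq_volume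
    (Filter.Eventually.of_forall fun p => by positivity)]
  refine lintegral_congr fun p => ?_
  rw [ENNReal.ofReal_pow (norm_nonneg _), ofReal_norm]

theorem IsTest.fderiv_apply (hf : IsTest f) (v : ℂ × ℂ) : IsTest fun p => fderiv ℝ f p v :=
  ⟨contDiff_fderiv_apply hf.smooth v, hf.compact.fderiv_apply ℝ v⟩

/-- Write the difference as the integral of the derivative along the segment from `p` to `p - t`,
apply Jensen, and use translation invariance. -/
theorem lintegral_translate_sub_sq_le (hf : IsTest f) (t : ℂ × ℂ) :
    ∫⁻ p, ‖f (p - t) - f p‖ₑ ^ 2 ≤ ENNReal.ofReal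
      (8 * ‖t‖ ^ 2 * ((∫ p, ‖dbar (1, 0) f p‖ ^ 2) + ∫ p, ‖dbar (0, 1) f p‖ ^ 2)) := by
  have := isAddHaarMeasure_volume
  have hft := hf.fderiv_apply t
  let ν : Measure ℝ := volume.restrict (Set.Ioc 0 1)
  have hν : IsProbabilityMeasure ν := ⟨by simp [ν]⟩
  have hc : Continuous fun q : (ℂ × ℂ) × ℝ => fderiv ℝ f (q.1 - q.2 • t) t :=
    hft.smooth.continuous.comp (by fun_prop)
  have h1 : ∀ p, f (p - t) - f p = ∫ s, -fderiv ℝ f (p - s • t) t ∂ν := fun p => by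
    have hd : ∀ s : ℝ, HasDerivAt (fun s : ℝ => f (p - s • t)) (-fderiv ℝ f (p - s • t) t) s :=
      fun s => by
        have h2 : HasDerivAt (fun s : ℝ => p - s • t) (-t) s := by
          simpa using ((hasDerivAt_id s).smul_const t).const_sub p
        have h3 := (hf.smooth.differentiable (by simp) (p - s • t)).hasFDerivAt.comp_hasDerivAt s h2
        rw [map_neg] at h3
        exact h3
    have h3 := intervalIntegral.integral_eq_sub_of_hasDerivAt (a := 0) (b := 1) (fun s _ => hd s)
      ((hc.comp (continuous_const.prodMk continuous_id)).neg.intervalIntegrable _ _)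
    rw [intervalIntegral.integral_of_le zero_le_one] at h3
    rw [h3]
    simp
  calc ∫⁻ p, ‖f (p - t) - f p‖ₑ ^ 2 ≤ ∫⁻ p, ∫⁻ s, ‖fderiv ℝ f (p - s • t) t‖ₑ ^ 2 ∂ν := by
        refine lintegral_mono fun p => ?_
        rw [h1]
        refine (enorm_integral_sq_le ν
          (hc.comp (continuous_const.prodMk continuous_id)).neg.aestronglyMeasurable).trans_eq ?_
        simp
    _ = ∫⁻ s, (∫⁻ p, ‖fderiv ℝ f (p - s • t) t‖ₑ ^ 2) ∂ν :=
        lintegral_lintegral_swap (f := fun p s => ‖fderiv ℝ f (p - s • t) t‖ₑ ^ 2)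
          (hc.measurable.enorm.pow_const 2).aemeasurable
    _ = ∫⁻ p, ‖fderiv ℝ f p t‖ₑ ^ 2 := by
        simp only [lintegral_sub_right_eq_self fun p => ‖fderiv ℝ f p t‖ₑ ^ 2]
        simp
    _ ≤ _ := by
        rw [hft.lintegral_enorm_sq]
        exact ENNReal.ofReal_le_ofReal (integral_norm_fderiv_apply_sq_le hf t)

theorem integral_norm_conv_sub_sq_le {h : ℝ} {ρ : ℂ × ℂ → ℝ} (hρ : IsMollifier h ρ) (hf : IsTest f) :
    ∫ p, ‖conv ρ f p - f p‖ ^ 2 ≤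
      8 * h ^ 2 * ((∫ p, ‖dbar (1, 0) f p‖ ^ 2) + ∫ p, ‖dbar (0, 1) f p‖ ^ 2) := by
  have hl : LocallyIntegrable f := hf.integrable.locallyIntegrable
  have hD : 0 ≤ (∫ p, ‖dbar (1, 0) f p‖ ^ 2) + ∫ p, ‖dbar (0, 1) f p‖ ^ 2 :=
    add_nonneg (integral_nonneg fun _ => by positivity) (integral_nonneg fun _ => by positivity)
  have h1 := lintegral_enorm_conv_sub_sq_le hρ hl hf.smooth.continuous.measurable fun t ht =>
    (lintegral_translate_sub_sq_le hf t).trans (ENNReal.ofReal_le_ofReal (by gcongr) :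
      _ ≤ ENNReal.ofReal (8 * h ^ 2 * _))
  rw [((isTest_conv hρ hl hf.compact).sub hf).lintegral_enorm_sq] at h1
  exact (ENNReal.ofReal_le_ofReal_iff (by positivity)).1 h1

variable {φ : ℂ × ℂ → ℝ}

/-- Cauchy–Schwarz on `B`, read off from `∫_B (V |g| - m)² ≥ 0` with `m` the `L¹` norm of `g`. -/
theorem sq_integral_norm_le (hg : IsTest g) {B : Set (ℂ × ℂ)} (hBt : volume B ≠ ⊤)
    (hV : 0 < volume.real B) (hgB : ∀ x, x ∉ B → g x = 0) :
    (∫ x, ‖g x‖) ^ 2 ≤ volume.real B * ∫ x, ‖g x‖ ^ 2 := by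
  have e1 : ∫ x in B, ‖g x‖ = ∫ x, ‖g x‖ :=
    setIntegral_eq_integral_of_forall_compl_eq_zero fun x hx => by simp [hgB x hx]
  have e2 : ∫ x in B, ‖g x‖ ^ 2 = ∫ x, ‖g x‖ ^ 2 :=
    setIntegral_eq_integral_of_forall_compl_eq_zero fun x hx => by simp [hgB x hx]
  set V := volume.real B
  set m := ∫ x, ‖g x‖
  have i1 := hg.integrable.norm.integrableOn (s := B)
  have i2 := hg.integrable_norm_sq_volume.integrableOn (s := B)
  have h1 : 0 ≤ ∫ x in B, (V * ‖g x‖ - m) ^ 2 := integral_nonneg fun _ => sq_nonneg _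
  have h2 : ∫ x in B, (V * ‖g x‖ - m) ^ 2 =
      ∫ x in B, (V ^ 2 * ‖g x‖ ^ 2 - 2 * V * m * ‖g x‖ + m ^ 2) := by
    congr 1
    ext x
    ring
  have i3 : IntegrableOn (fun _ => m ^ 2) B := integrableOn_const hBt
  rw [h2, integral_add (f := fun x => V ^ 2 * ‖g x‖ ^ 2 - 2 * V * m * ‖g x‖)
    ((i2.const_mul _).sub (i1.const_mul _)) i3, integral_sub (i2.const_mul _) (i1.const_mul _),
    integral_const_mul, integral_const_mul, e1, e2, setIntegral_const, smul_eq_mul] at h1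
  have h3 : 0 ≤ V * (V * (∫ x, ‖g x‖ ^ 2) - m ^ 2) := by
    change 0 ≤ V ^ 2 * (∫ x, ‖g x‖ ^ 2) - 2 * V * m * m + V * m ^ 2 at h1
    linarith
  have := nonneg_of_mul_nonneg_right h3 hV
  linarith

theorem norm_conv_sub_le {h : ℝ} {ρ : ℂ × ℂ → ℝ} (hρ : IsMollifier h ρ) (hg : IsTest g) {κ : ℝ}
    {x x' : ℂ × ℂ} (hκ : ∀ y, |ρ (x - y) - ρ (x' - y)| ≤ κ) :
    ‖conv ρ g x - conv ρ g x'‖ ≤ κ * ∫ y, ‖g y‖ := by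
  have i1 : ∀ x, Integrable fun t => g t * (ρ (x - t) : ℂ) := fun x =>
    (hg.mul_right (hρ.isTest.comp_sub_left x).smooth).integrable
  rw [conv, conv, ← integral_sub (i1 x) (i1 x'), ← integral_const_mul]
  refine norm_integral_le_of_norm_le (hg.integrable.norm.const_mul κ)
    (Filter.Eventually.of_forall fun y => ?_)
  rw [← mul_sub, norm_mul, mul_comm]
  gcongr
  rw [← ofReal_sub, norm_real]
  exact hκ y

/-- Rellich's lemma for functions supported in a fixed ball. -/
theorem exists_rellich {r η : ℝ} (hr : 0 < r) (hη : 0 < η) :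
    ∃ (N : Finset (ℂ × ℂ)) (y : ℂ × ℂ → ℂ × ℂ → ℂ) (C : ℝ), 0 ≤ C ∧ (∀ x, IsTest (y x)) ∧
      ∀ g, IsTest g → (∀ x, r ≤ ‖x‖ → g x = 0) →
        ∫ p, ‖g p‖ ^ 2 ≤ η * ((∫ p, ‖g p‖ ^ 2) + (∫ p, ‖dbar (1, 0) g p‖ ^ 2) +
          ∫ p, ‖dbar (0, 1) g p‖ ^ 2) + C * ∑ x ∈ N, ‖∫ p, g p * y x p‖ ^ 2 := by
  have := isAddHaarMeasure_volume
  let B : Set (ℂ × ℂ) := Metric.closedBall 0 r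
  have hBc : IsCompact B := isCompact_closedBall _ _
  have hBt : volume B ≠ ⊤ := hBc.measure_ne_top
  have hV : 0 < volume.real B :=
    ENNReal.toReal_pos (Metric.measure_closedBall_pos volume _ hr).ne' hBt
  set V := volume.real B
  -- At this scale the mollification error `8 h² D`, doubled, is `η D`. The oscillation `√η / (2 V)`
  -- below is chosen so that its contribution is likewise `η G`.
  have hh : 0 < √η / 4 := by positivity
  obtain ⟨ρ, hρ⟩ := exists_isMollifier hh
  have hκ : 0 < √η / (2 * V) := by positivity
  obtain ⟨δ, hδ, hu⟩ := Metric.uniformContinuous_iff.1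
    (hρ.compact.uniformContinuous_of_continuous hρ.smooth.continuous) _ hκ
  -- The values of `conv ρ g` on a finite `δ`-net are pairings of `g` with fixed test functions and
  -- determine `conv ρ g` on `B` up to a small multiple of the `L¹` norm of `g`.
  obtain ⟨t, -, ht, hcov⟩ := hBc.finite_cover_balls hδ
  refine ⟨ht.toFinset, fun x y => (ρ (x - y) : ℂ), 4 * V, by positivity,
    fun x => hρ.isTest.comp_sub_left x, fun g hg hgr => ?_⟩
  have hgB : ∀ x, x ∉ B → g x = 0 := fun x hx => hgr x (by
    simp only [B, Metric.mem_closedBall, dist_zero_right, not_le] at hx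
    exact hx.le)
  set S := ∑ x ∈ ht.toFinset, ‖∫ p, g p * (ρ (x - p) : ℂ)‖ ^ 2
  set m := ∫ x, ‖g x‖
  set G := ∫ p, ‖g p‖ ^ 2
  set D := (∫ p, ‖dbar (1, 0) g p‖ ^ 2) + ∫ p, ‖dbar (0, 1) g p‖ ^ 2
  have hm : m ^ 2 ≤ V * G := sq_integral_norm_le hg hBt hV hgB
  have hG0 : 0 ≤ G := integral_nonneg fun _ => by positivity
  have hC := isTest_conv hρ hg.integrable.locallyIntegrable hg.compact
  have h1 : ∀ x ∈ B, ‖conv ρ g x‖ ^ 2 ≤ 2 * S + 2 * (√η / (2 * V) * m) ^ 2 := fun x hx => by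
    obtain ⟨x', hx', hxx⟩ := Set.mem_iUnion₂.1 (hcov hx)
    have h2 : ‖conv ρ g x - conv ρ g x'‖ ≤ √η / (2 * V) * m := norm_conv_sub_le hρ hg fun y =>
      (hu (by simpa using hxx) : dist (ρ (x - y)) (ρ (x' - y)) < _).le
    have h3 : ‖conv ρ g x'‖ ^ 2 ≤ S :=
      Finset.single_le_sum (f := fun x => ‖∫ p, g p * (ρ (x - p) : ℂ)‖ ^ 2)
        (fun _ _ => by positivity) (ht.mem_toFinset.2 hx')
    have h4 : ‖conv ρ g x‖ ≤ ‖conv ρ g x'‖ + √η / (2 * V) * m := by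
      have := norm_le_norm_add_norm_sub' (conv ρ g x) (conv ρ g x')
      linarith
    have h5 := pow_le_pow_left₀ (norm_nonneg _) h4 2
    nlinarith [sq_nonneg (‖conv ρ g x'‖ - √η / (2 * V) * m)]
  have h6 : G ≤ 2 * (∫ p, ‖conv ρ g p - g p‖ ^ 2) + 2 * ∫ p in B, ‖conv ρ g p‖ ^ 2 := by
    have i1 := (hC.sub hg).integrable_norm_sq_volume
    have i2 := hC.integrable_norm_sq_volume
    have e2 : ∫ x in B, ‖g x‖ ^ 2 = G :=
      setIntegral_eq_integral_of_forall_compl_eq_zero fun x hx => by simp [hgB x hx]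
    have h7 : ∫ x in B, ‖g x‖ ^ 2 ≤ ∫ x in B, (2 * ‖conv ρ g x - g x‖ ^ 2 + 2 * ‖conv ρ g x‖ ^ 2) := by
      refine setIntegral_mono hg.integrable_norm_sq_volume.integrableOn
        ((i1.const_mul 2).add (i2.const_mul 2)).integrableOn fun x => ?_
      have h8 : ‖g x‖ ≤ ‖conv ρ g x - g x‖ + ‖conv ρ g x‖ := by
        rw [norm_sub_rev]
        linarith [norm_sub_norm_le (g x) (conv ρ g x)]
      have h9 := pow_le_pow_left₀ (norm_nonneg _) h8 2
      simp only
      nlinarith [sq_nonneg (‖conv ρ g x - g x‖ - ‖conv ρ g x‖)]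
    rw [integral_add (i1.const_mul 2).integrableOn (i2.const_mul 2).integrableOn,
      integral_const_mul, integral_const_mul, e2] at h7
    have := setIntegral_le_integral (s := B) i1 (Filter.Eventually.of_forall fun _ => by positivity)
    linarith
  have h7 : ∫ p in B, ‖conv ρ g p‖ ^ 2 ≤ V * (2 * S + 2 * (√η / (2 * V) * m) ^ 2) := by
    rw [← smul_eq_mul, ← setIntegral_const]
    exact setIntegral_mono_on hC.integrable_norm_sq_volume.integrableOn (integrableOn_const hBt)
      hBc.measurableSet h1
  have h8 := integral_norm_conv_sub_sq_le hρ hg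
  have h9 : V * (√η / (2 * V) * m) ^ 2 ≤ η / 4 * G := by
    have e : V * (√η / (2 * V) * m) ^ 2 = η / (4 * V) * m ^ 2 := by
      rw [mul_pow, div_pow, Real.sq_sqrt hη.le]
      field_simp
      ring
    rw [e]
    calc η / (4 * V) * m ^ 2 ≤ η / (4 * V) * (V * G) := by gcongr
      _ = η / 4 * G := by field_simp
  rw [div_pow, Real.sq_sqrt hη.le] at h8
  change ∫ p, ‖conv ρ g p - g p‖ ^ 2 ≤ 8 * (η / 4 ^ 2) * D at h8
  have h10 : η * (G + (∫ p, ‖dbar (1, 0) g p‖ ^ 2) + ∫ p, ‖dbar (0, 1) g p‖ ^ 2) = η * G + η * D := by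
    ring
  rw [h10]
  nlinarith

/-- The weight is bounded below on the compact support. This passes from weighted to unweighted
norms after multiplication by a cutoff. -/
theorem IsTest.exists_norm_sq_le_mul_wt (hf : IsTest f) (hφ : ContDiff ℝ ∞ φ) :
    ∃ M, 0 ≤ M ∧ ∀ p, ‖f p‖ ^ 2 ≤ M * wt φ p := by
  have hc : Continuous fun p => (wt φ p)⁻¹ :=
    (contDiff_wt hφ).continuous.inv₀ fun p => (wt_pos φ p).ne'
  have h1 : HasCompactSupport fun p => ‖f p‖ ^ 2 * (wt φ p)⁻¹ :=
    (hf.compact.comp_left (g := fun z : ℂ => ‖z‖ ^ 2) (by simp)).mul_right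
  obtain ⟨M, hM⟩ := h1.exists_bound_of_continuous ((hf.smooth.continuous.norm.pow 2).mul hc)
  refine ⟨M, (norm_nonneg _).trans (hM 0), fun p => ?_⟩
  have h2 := (le_abs_self _).trans (hM p)
  rwa [← div_eq_mul_inv, div_le_iff₀ (wt_pos φ p)] at h2

theorem exists_bump {r R : ℝ} (hr : 0 < r) (hrR : r < R) : ∃ θ : ℂ × ℂ → ℂ, IsTest θ ∧
    (∀ p, ‖θ p‖ ≤ 1) ∧ (∀ p, ‖p‖ ≤ r → θ p = 1) ∧ ∀ p, R ≤ ‖p‖ → θ p = 0 := by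
  let b : ContDiffBump (0 : ℂ × ℂ) := ⟨r, R, hr, hrR⟩
  refine ⟨fun p => (b p : ℂ), ⟨contDiff_ofReal_comp b.contDiff,
    b.hasCompactSupport.comp_left (g := ((↑) : ℝ → ℂ)) (by simp)⟩, fun p => ?_, fun p hp => ?_,
    fun p hp => ?_⟩
  · rw [norm_real, Real.norm_of_nonneg b.nonneg]
    exact b.le_one
  · simp [b.one_of_mem_closedBall (x := p) (by simpa using hp)]
  · simp [b.zero_of_le_dist (x := p) (by simpa using hp)]

/-- Functions of bounded energy are precompact in `L²` on every ball. -/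
theorem exists_local_compactness (hφ : ContDiff ℝ ∞ φ) (hφ0 : ∀ p, 0 ≤ φ p) {R ε : ℝ} (hR : 0 < R)
    (hε : 0 < ε) :
    ∃ (N : Finset (ℂ × ℂ)) (y : ℂ × ℂ → ℂ × ℂ → ℂ) (C : ℝ), 0 ≤ C ∧ (∀ x, IsTest (y x)) ∧
      ∀ f, IsTest f → ∫ p in Metric.ball 0 R, ‖f p‖ ^ 2 * wt φ p ≤
        ε * ((∫ p, ‖f p‖ ^ 2 * wt φ p) + (∫ p, ‖dbar (1, 0) f p‖ ^ 2 * wt φ p) +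
          ∫ p, ‖dbar (0, 1) f p‖ ^ 2 * wt φ p) + C * ∑ x ∈ N, ‖∫ p, f p * y x p‖ ^ 2 := by
  obtain ⟨θ, hθ, hθ1, hθR, hθ0⟩ := exists_bump hR (lt_add_one R)
  obtain ⟨M, hM0, hM⟩ := hθ.exists_norm_sq_le_mul_wt hφ
  obtain ⟨M₁, hM₁0, hM₁⟩ := (hθ.dbar (1, 0)).exists_norm_sq_le_mul_wt hφ
  obtain ⟨M₂, hM₂0, hM₂⟩ := (hθ.dbar (0, 1)).exists_norm_sq_le_mul_wt hφ
  -- `K` bounds the unweighted energy of `θ f` by the weighted energy of `f`; the terms in `M₁`,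
  -- `M₂` come from derivatives falling on `θ`.
  let K := 1 + 2 * M + 2 * M₁ + 2 * M₂
  have hK : 0 < K := by positivity
  obtain ⟨N, y, C, hC, hy, h⟩ := exists_rellich (r := R + 1) (η := ε / K) (by linarith) (by positivity)
  refine ⟨N, fun x p => θ p * y x p, C, hC, fun x => (hy x).mul_left hθ.smooth, fun f hf => ?_⟩
  have hg : IsTest fun p => f p * θ p := hf.mul_right hθ.smooth
  have h1 := h _ hg fun x hx => by simp [hθ0 x hx]
  have i0 := hf.integrable_norm_sq hφ
  have id1 := (hf.dbar (1, 0)).integrable_norm_sq hφ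
  have id2 := (hf.dbar (0, 1)).integrable_norm_sq hφ
  have w0 := fun p => (wt_pos φ p).le
  have hdiff : ∀ {h : ℂ × ℂ → ℂ}, IsTest h → Differentiable ℝ h :=
    fun hh => hh.smooth.differentiable (by simp)
  have b0 : ∫ p, ‖f p * θ p‖ ^ 2 ≤ M * ∫ p, ‖f p‖ ^ 2 * wt φ p := by
    rw [← integral_const_mul]
    refine integral_mono hg.integrable_norm_sq_volume (i0.const_mul M) fun p => ?_
    simp only [norm_mul, mul_pow]
    have := mul_le_mul_of_nonneg_left (hM p) (sq_nonneg ‖f p‖)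
    linarith
  have bd : ∀ e M', (∀ p, ‖dbar e θ p‖ ^ 2 ≤ M' * wt φ p) →
      ∫ p, ‖dbar e (fun p => f p * θ p) p‖ ^ 2 ≤
        2 * M * (∫ p, ‖dbar e f p‖ ^ 2 * wt φ p) + 2 * M' * ∫ p, ‖f p‖ ^ 2 * wt φ p := by
    intro e M' hM'
    have id := (hf.dbar e).integrable_norm_sq hφ
    rw [← integral_const_mul, ← integral_const_mul, ← integral_add (id.const_mul _) (i0.const_mul _)]
    refine integral_mono (hg.dbar e).integrable_norm_sq_volume
      ((id.const_mul _).add (i0.const_mul _)) fun p => ?_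
    simp only
    rw [dbar_mul (hdiff hf) (hdiff hθ)]
    have h2 := pow_le_pow_left₀ (norm_nonneg _) (norm_add_le (dbar e f p * θ p) (f p * dbar e θ p)) 2
    rw [norm_mul, norm_mul] at h2
    have h3 := mul_le_mul_of_nonneg_left (hM p) (sq_nonneg ‖dbar e f p‖)
    have h4 := mul_le_mul_of_nonneg_left (hM' p) (sq_nonneg ‖f p‖)
    have h5 := sq_nonneg (‖dbar e f p‖ * ‖θ p‖ - ‖f p‖ * ‖dbar e θ p‖)
    nlinarith
  have b1 := bd (1, 0) M₁ hM₁
  have b2 := bd (0, 1) M₂ hM₂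
  have hball : ∫ p in Metric.ball 0 R, ‖f p‖ ^ 2 * wt φ p ≤ ∫ p, ‖f p * θ p‖ ^ 2 := by
    refine (setIntegral_mono_on i0.integrableOn hg.integrable_norm_sq_volume.integrableOn
      Metric.isOpen_ball.measurableSet fun p hp => ?_).trans
      (setIntegral_le_integral hg.integrable_norm_sq_volume
        (Filter.Eventually.of_forall fun _ => by positivity))
    rw [hθR p (by simpa using (mem_ball_zero_iff.1 hp).le), mul_one]
    refine mul_le_of_le_one_right (by positivity) (Real.exp_le_one_iff.2 ?_)
    linarith [hφ0 p]
  have A0 : 0 ≤ ∫ p, ‖f p‖ ^ 2 * wt φ p := integral_nonneg fun p => mul_nonneg (by positivity) (w0 p)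
  have A1 : 0 ≤ ∫ p, ‖dbar (1, 0) f p‖ ^ 2 * wt φ p :=
    integral_nonneg fun p => mul_nonneg (by positivity) (w0 p)
  have A2 : 0 ≤ ∫ p, ‖dbar (0, 1) f p‖ ^ 2 * wt φ p :=
    integral_nonneg fun p => mul_nonneg (by positivity) (w0 p)
  set a0 := ∫ p, ‖f p‖ ^ 2 * wt φ p
  set a1 := ∫ p, ‖dbar (1, 0) f p‖ ^ 2 * wt φ p
  set a2 := ∫ p, ‖dbar (0, 1) f p‖ ^ 2 * wt φ p
  have hsum : (∫ p, ‖f p * θ p‖ ^ 2) + (∫ p, ‖dbar (1, 0) (fun p => f p * θ p) p‖ ^ 2) +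
      (∫ p, ‖dbar (0, 1) (fun p => f p * θ p) p‖ ^ 2) ≤ K * (a0 + a1 + a2) := by
    have e : K * (a0 + a1 + a2) = (1 + 2 * M + 2 * M₁ + 2 * M₂) * (a0 + a1 + a2) := rfl
    rw [e]
    have := mul_nonneg hM0 A0
    have := mul_nonneg hM₁0 A1
    have := mul_nonneg hM₁0 A2
    have := mul_nonneg hM₂0 A1
    have := mul_nonneg hM₂0 A2
    linarith
  have h2 : ε / K * ((∫ p, ‖f p * θ p‖ ^ 2) + (∫ p, ‖dbar (1, 0) (fun p => f p * θ p) p‖ ^ 2) +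
      (∫ p, ‖dbar (0, 1) (fun p => f p * θ p) p‖ ^ 2)) ≤ ε * (a0 + a1 + a2) := by
    refine (mul_le_mul_of_nonneg_left hsum (by positivity)).trans_eq ?_
    field_simp
  simp only [mul_assoc] at h1 ⊢
  linarith

end LocalCompactness

/-! ### The operators of the weighted `∂̄`-complex -/

section Operators

variable {φ : C(ℂ × ℂ, ℝ)} {f g η : ℂ × ℂ → ℂ}

theorem integral_weightedMeasure (φ : C(ℂ × ℂ, ℝ)) (F : ℂ × ℂ → ℂ) :
    ∫ p, F p ∂(weightedMeasure φ) = ∫ p, F p * wt φ p := by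
  rw [integral_withDensity_eq_integral_toReal_smul (by fun_prop) (by simp)]
  refine integral_congr_ae (Filter.Eventually.of_forall fun p => ?_)
  simp only [ENNReal.toReal_ofReal (Real.exp_pos _).le, real_smul, wt]
  ring

theorem inner_eq_integral (f g : L2 φ) :
    inner ℂ f g = ∫ p, g p * conj (f p) * wt φ p := by
  rw [L2.inner_def, integral_weightedMeasure]
  simp only [RCLike.inner_apply]

theorem inner_toL2 (hη : IsTest η) (f : L2 φ) :
    inner ℂ (hη.toL2 φ) f = ∫ p, f p * conj (η p) * wt φ p := by
  rw [inner_eq_integral]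
  exact integral_congr_ae ((hη.coeFn_toL2 (φ := φ)).mono fun p hp => by simp only [hp])

theorem norm_sq_toL2 (hη : IsTest η) : ‖hη.toL2 φ‖ ^ 2 = ∫ p, ‖η p‖ ^ 2 * wt φ p := by
  have h1 : ((‖hη.toL2 φ‖ ^ 2 : ℝ) : ℂ) = inner ℂ (hη.toL2 φ) (hη.toL2 φ) := by
    rw [inner_self_eq_norm_sq_to_K]
    norm_cast
  rw [inner_toL2] at h1
  rw [← ofReal_inj, h1, ofReal_integral_norm_sq]
  exact integral_congr_ae ((hη.coeFn_toL2 (φ := φ)).mono fun p hp => by simp only [hp])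

theorem IsTest.div_wt (hη : IsTest η) (hφ : ContDiff ℝ ∞ φ) :
    IsTest fun p => conj (η p) * ((wt φ p)⁻¹ : ℝ) :=
  hη.conj.mul_right (contDiff_ofReal_comp ((contDiff_wt hφ).inv fun p => (wt_pos φ p).ne'))

theorem wt_ne_zero (φ : ℂ × ℂ → ℝ) (p : ℂ × ℂ) : (wt φ p : ℂ) ≠ 0 :=
  ofReal_ne_zero.2 (wt_pos φ p).ne'

/-- Distributional pairings are inner products with the fixed vector `η̄ e^{2φ}`. They are therefore
continuous in `f`, which makes the maximal `∂̄` operators closed and the local compactness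
conditions into orthogonality conditions. -/
theorem integral_mul_eq_inner (hφ : ContDiff ℝ ∞ φ) (hη : IsTest η) (f : L2 φ) :
    ∫ p, f p * η p = inner ℂ ((hη.div_wt hφ).toL2 φ) f := by
  rw [inner_toL2]
  refine integral_congr_ae (Filter.Eventually.of_forall fun p => ?_)
  have := wt_ne_zero φ p
  beta_reduce
  rw [map_mul, conj_conj, conj_ofReal, ofReal_inv]
  field_simp

theorem continuous_integral_mul (hφ : ContDiff ℝ ∞ φ) (hη : IsTest η) :
    Continuous fun f : L2 φ => ∫ p, f p * η p := by
  simp only [integral_mul_eq_inner hφ hη]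
  fun_prop

theorem continuous_fst_L2Form : Continuous fun u : L2Form φ => u.fst :=
  continuous_fst.comp (WithLp.prod_continuous_ofLp 2 _ _)

theorem continuous_snd_L2Form : Continuous fun u : L2Form φ => u.snd :=
  continuous_snd.comp (WithLp.prod_continuous_ofLp 2 _ _)

theorem isClosed_dbar0Graph (hφ : ContDiff ℝ ∞ φ) :
    IsClosed (dbar0Graph φ : Set (L2 φ × L2Form φ)) := by
  have h1 : (dbar0Graph φ : Set (L2 φ × L2Form φ)) =
      ⋂ (η : ℂ × ℂ → ℂ) (_ : IsTest η),
        {q | ∫ p, q.1 p * dbarZ η p = -∫ p, q.2.fst p * η p} ∩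
        {q | ∫ p, q.1 p * dbarW η p = -∫ p, q.2.snd p * η p} := by
    ext q
    simp only [Set.mem_iInter, Set.mem_inter_iff]
    exact ⟨fun h η hη => ⟨h.1 η hη, h.2 η hη⟩, fun h => ⟨fun η hη => (h η hη).1, fun η hη => (h η hη).2⟩⟩
  rw [h1]
  refine isClosed_iInter fun η => isClosed_iInter fun hη => ?_
  have c1 := continuous_integral_mul hφ hη
  exact (isClosed_eq ((continuous_integral_mul hφ hη.dbarZ).comp continuous_fst)
    (c1.comp (continuous_fst_L2Form.comp continuous_snd)).neg).inter
    (isClosed_eq ((continuous_integral_mul hφ hη.dbarW).comp continuous_fst)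
    (c1.comp (continuous_snd_L2Form.comp continuous_snd)).neg)

theorem isClosed_dbar1Graph (hφ : ContDiff ℝ ∞ φ) :
    IsClosed (dbar1Graph φ : Set (L2Form φ × L2 φ)) := by
  have h1 : (dbar1Graph φ : Set (L2Form φ × L2 φ)) =
      ⋂ (η : ℂ × ℂ → ℂ) (_ : IsTest η),
        {q | (∫ p, q.1.snd p * dbarZ η p) - (∫ p, q.1.fst p * dbarW η p) = -∫ p, q.2 p * η p} := by
    ext q
    simp only [Set.mem_iInter]
    exact hasWeakDbarForm_iff _ _ _
  rw [h1]
  refine isClosed_iInter fun η => isClosed_iInter fun hη => ?_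
  exact isClosed_eq
    (((continuous_integral_mul hφ hη.dbarZ).comp (continuous_snd_L2Form.comp continuous_fst)).sub
      ((continuous_integral_mul hφ hη.dbarW).comp (continuous_fst_L2Form.comp continuous_fst)))
    ((continuous_integral_mul hφ hη).comp continuous_snd).neg

/-- The weighted `∂̄`-complex is a Hilbert complex. -/
theorem isHilbertComplex_dbar (hφ : ContDiff ℝ ∞ φ) : IsHilbertComplex (dbar0 φ) (dbar1 φ) where
  dense_left := dense_dbar0 φ
  closed_left := by
    change IsClosed ((dbar0 φ).graph : Set (L2 φ × L2Form φ))
    rw [dbar0_graph]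
    exact isClosed_dbar0Graph hφ
  dense_right := dense_dbar1 φ
  closed_right := by
    change IsClosed ((dbar1 φ).graph : Set (L2Form φ × L2 φ))
    rw [dbar1_graph]
    exact isClosed_dbar1Graph hφ
  comp_eq_zero := by
    intro f u h
    rw [dbar0_graph] at h
    rw [dbar1_graph]
    refine (hasWeakDbarForm_iff _ _ _).2 fun η hη => ?_
    -- Each equation is tested with the derivative of `η` in the other variable; since these
    -- derivatives commute, the left-hand sides agree.
    have h1 := h.1 _ hη.dbarW
    have h2 := h.2 _ hη.dbarZ
    have h3 : dbarZ (dbarW η) = dbarW (dbarZ η) := by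
      simp only [dbarZ_eq, dbarW_eq]
      exact funext fun p => dbar_dbar_comm hη.smooth _ _ p
    rw [h3] at h1
    simp only [integral_zero_mul] at h1 h2 ⊢
    linear_combination h2 - h1

/-- The `(0,1)`-form with smooth compactly supported coefficients. -/
def testForm (φ : C(ℂ × ℂ, ℝ)) (hf : IsTest f) (hg : IsTest g) : L2Form φ :=
  WithLp.toLp 2 (hf.toL2 φ, hg.toL2 φ)

theorem norm_sq_testForm (hf : IsTest f) (hg : IsTest g) :
    ‖testForm φ hf hg‖ ^ 2 = (∫ p, ‖f p‖ ^ 2 * wt φ p) + ∫ p, ‖g p‖ ^ 2 * wt φ p := by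
  rw [WithLp.prod_norm_sq_eq_of_L2, ← norm_sq_toL2 hf, ← norm_sq_toL2 hg]
  rfl

theorem dbar_conj_mul_wt {φ : ℂ × ℂ → ℝ} (hφ : ContDiff ℝ ∞ φ) (hf : ContDiff ℝ ∞ f) (e p : ℂ × ℂ) :
    dbar e (fun q => conj (f q) * wt φ q) p = -(conj (delta φ e f p) * wt φ p) := by
  have hd : ∀ {h : ℂ × ℂ → ℂ}, ContDiff ℝ ∞ h → Differentiable ℝ h :=
    fun hh => hh.differentiable (by simp)
  rw [dbar_mul (hd (contDiff_conj_comp hf)) (hd (contDiff_ofReal_comp (contDiff_wt hφ))),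
    dbar_conj (hd hf), dbar_wt hφ, delta, ← conj_del_ofReal hφ]
  simp only [map_add, map_mul, map_neg, map_ofNat]
  ring

/-- Choosing `f̄ e^{-2φ}` and `ḡ e^{-2φ}` as test functions in the weak definition of `∂̄` moves the
derivatives onto the form as `delta`. -/
theorem testForm_mem_adjoint (hφ : ContDiff ℝ ∞ φ) (hf : IsTest f) (hg : IsTest g) :
    (testForm φ hf hg, ((hf.delta hφ (1, 0)).add (hg.delta hφ (0, 1))).toL2 φ) ∈
      ((dbar0 φ)†).graph := by
  refine (mem_adjoint_graph (dense_dbar0 φ)).2 fun ψ v hv => ?_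
  rw [dbar0_graph] at hv
  have hW := contDiff_ofReal_comp (contDiff_wt hφ)
  have h1 := hv.1 _ (hf.conj.mul_right hW)
  have h2 := hv.2 _ (hg.conj.mul_right hW)
  rw [dbarZ_eq, funext (dbar_conj_mul_wt hφ hf.smooth (1, 0))] at h1
  rw [dbarW_eq, funext (dbar_conj_mul_wt hφ hg.smooth (0, 1))] at h2
  simp only [mul_neg, integral_neg, neg_inj, ← mul_assoc] at h1 h2
  have i1 := integrable_mul ψ ((hf.delta hφ (1, 0)).conj.mul_right hW)
  have i2 := integrable_mul ψ ((hg.delta hφ (0, 1)).conj.mul_right hW)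
  simp only [← mul_assoc] at i1 i2
  rw [WithLp.prod_inner_apply]
  change _ = inner ℂ (hf.toL2 φ) v.fst + inner ℂ (hg.toL2 φ) v.snd
  rw [inner_toL2, inner_toL2, inner_toL2, ← h1, ← h2, ← integral_add i1 i2]
  refine integral_congr_ae (Filter.Eventually.of_forall fun p => ?_)
  simp only [map_add]
  ring

end Operators

/-! ### Density of test forms -/

section Density

open Filter Topology

variable {φ : C(ℂ × ℂ, ℝ)} {f g η : ℂ × ℂ → ℂ}

/-- The adjoint of `∂̄` acts on test functions without the weight as `-∂ - 2 ∂φ`. -/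
theorem integral_of_mem_adjoint (hφ : ContDiff ℝ ∞ φ) {u : L2Form φ} {h : L2 φ}
    (hu : (u, h) ∈ ((dbar0 φ)†).graph) (hη : IsTest η) :
    (∫ p, u.fst p * (del (1, 0) η p + 2 * del (1, 0) (fun q => (φ q : ℂ)) p * η p)) +
      (∫ p, u.snd p * (del (0, 1) η p + 2 * del (0, 1) (fun q => (φ q : ℂ)) p * η p)) =
      ∫ p, h p * η p := by
  have hψ := hη.div_wt hφ
  -- Dividing by the weight removes it: the adjoint relation against this `ψ` becomes an unweighted
  -- identity tested with `η`.
  set ψ := fun p => conj (η p) * ((wt φ p)⁻¹ : ℝ) with hψe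
  have hd : ∀ {h : ℂ × ℂ → ℂ}, ContDiff ℝ ∞ h → Differentiable ℝ h :=
    fun hh => hh.differentiable (by simp)
  have hηe : η = fun p => conj (ψ p) * wt φ p := by
    ext p
    have := wt_ne_zero φ p
    simp only [hψe]
    rw [map_mul, conj_conj, conj_ofReal, ofReal_inv]
    field_simp
  have h1 : ∀ e p, del e η p + 2 * del e (fun q => (φ q : ℂ)) p * η p = conj (dbar e ψ p) * wt φ p := by
    intro e p
    have hw : del e (fun q => (wt φ q : ℂ)) p = -2 * del e (fun q => (φ q : ℂ)) p * wt φ p := by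
      have := congrArg conj (dbar_wt hφ e p)
      rw [← del_conj (hd (contDiff_ofReal_comp (contDiff_wt hφ))), map_mul, map_mul,
        ← del_conj (hd (contDiff_ofReal_comp hφ))] at this
      simpa [map_ofNat] using this
    conv_lhs => rw [hηe]
    rw [del_mul (hd (contDiff_conj_comp hψ.smooth)) (hd (contDiff_ofReal_comp (contDiff_wt hφ))), hw,
      del_conj (hd hψ.smooth)]
    ring
  have h2 := (mem_adjoint_graph (dense_dbar0 φ)).1 hu (hψ.toL2 φ)
    (testForm φ hψ.dbarZ hψ.dbarW) (by
      rw [dbar0_graph]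
      exact ⟨hψ.hasWeakDbarZ, hψ.hasWeakDbarW⟩)
  have h3 := congrArg conj h2
  rw [inner_conj_symm, inner_conj_symm, WithLp.prod_inner_apply] at h3
  change _ = inner ℂ (hψ.dbarZ.toL2 φ) u.fst + inner ℂ (hψ.dbarW.toL2 φ) u.snd at h3
  rw [inner_toL2, inner_toL2, inner_toL2, dbarZ_eq, dbarW_eq] at h3
  simp only [h1]
  simp only [← mul_assoc]
  rw [← h3]
  refine integral_congr_ae (Eventually.of_forall fun p => ?_)
  simp only
  rw [mul_assoc, ← congrFun hηe p]

theorem exists_mollifier_seq : ∃ ρ : ℕ → ℂ × ℂ → ℝ, (∀ j, ∃ h ≤ 1, IsMollifier h (ρ j)) ∧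
    ∀ U : ℂ × ℂ → ℂ, MemLp U 2 volume → Measurable U →
      Tendsto (fun j => eLpNorm (fun x => conv (ρ j) U x - U x) 2 volume) atTop (𝓝 0) := by
  choose ρ hρ using fun j : ℕ => exists_isMollifier (h := 1 / ((j : ℝ) + 1)) (by positivity)
  refine ⟨ρ, fun j => ⟨_, ?_, hρ j⟩, fun U hU hm => ENNReal.tendsto_nhds_zero.2 fun ε hε => ?_⟩
  · rw [div_le_one (by positivity)]
    linarith [(Nat.cast_nonneg j : (0 : ℝ) ≤ j)]
  · obtain ⟨h₀, hh, H⟩ := exists_conv_sub_le hU hm hε.ne'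
    filter_upwards [(tendsto_one_div_add_atTop_nhds_zero_nat (𝕜 := ℝ)).eventually_lt_const hh] with j hj
    exact H _ hj.le _ (hρ j)

/-- Dominated convergence. It disposes of the truncation errors `u (θ_k - 1)` and `u ∂θ_k`, `u
∂̄θ_k`. -/
theorem tendsto_eLpNorm_mul (u : L2 φ) {m : ℕ → ℂ × ℂ → ℂ} (hm : ∀ k, Continuous (m k)) {C : ℝ}
    (hC : ∀ k p, ‖m k p‖ ≤ C) (h0 : ∀ p, Tendsto (fun k => m k p) atTop (𝓝 0)) :
    Tendsto (fun k => eLpNorm (fun p => u p * m k p) 2 (weightedMeasure φ)) atTop (𝓝 0) := by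
  have hu : Measurable fun p => u p := (Lp.stronglyMeasurable u).measurable
  have hC0 : 0 ≤ C := (norm_nonneg _).trans (hC 0 0)
  have hfin : ∫⁻ p, ENNReal.ofReal C ^ 2 * ‖u p‖ₑ ^ 2 ∂(weightedMeasure φ) ≠ ⊤ := by
    rw [lintegral_const_mul _ (hu.enorm.pow_const 2), ← eLpNorm_two_sq]
    exact ENNReal.mul_ne_top (by simp) (ENNReal.pow_ne_top (Lp.memLp u).2.ne)
  have h1 : Tendsto (fun k => ∫⁻ p, ‖u p * m k p‖ₑ ^ 2 ∂(weightedMeasure φ)) atTop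
      (𝓝 (∫⁻ _, 0 ∂(weightedMeasure φ))) := by
    refine tendsto_lintegral_of_dominated_convergence _
      (fun k => ((hu.mul (hm k).measurable).enorm.pow_const 2))
      (fun k => Eventually.of_forall fun p => ?_) hfin (Eventually.of_forall fun p => ?_)
    · beta_reduce
      rw [enorm_mul, mul_pow, mul_comm]
      gcongr
      rw [← ofReal_norm]
      exact ENNReal.ofReal_le_ofReal (hC k p)
    · have h2 : Tendsto (fun k => u p * m k p) atTop (𝓝 (u p * 0)) := (h0 p).const_mul _
      rw [mul_zero] at h2
      have h3 := ((ENNReal.continuous_pow 2).tendsto _).comp h2.enorm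
      rw [enorm_zero, zero_pow two_ne_zero] at h3
      exact h3
  rw [lintegral_zero] at h1
  refine ENNReal.tendsto_nhds_zero.2 fun ε hε => ?_
  filter_upwards [ENNReal.tendsto_nhds_zero.1 h1 (ε ^ 2) (by positivity)] with k hk
  rw [← eLpNorm_two_sq] at hk
  exact (ENNReal.pow_right_strictMono two_ne_zero).le_iff_le.1 hk

/-- Dilates `b(p / (k + 1))` of one bump. Their derivatives are uniformly bounded and tend to zero,
so truncation costs nothing in the graph norm, whatever the growth of the weight. In `max C 2` the 2
bounds `|θ_k - 1|`. -/
theorem exists_cutoff_seq : ∃ (θ : ℕ → ℂ × ℂ → ℂ) (C : ℝ), (∀ k, IsTest (θ k)) ∧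
    (∀ k p, ‖θ k p - 1‖ ≤ C) ∧ (∀ p, Tendsto (fun k => θ k p - 1) atTop (𝓝 0)) ∧
    (∀ e k p, ‖dbar e (θ k) p‖ ≤ C * ‖e‖) ∧ (∀ e p, Tendsto (fun k => dbar e (θ k) p) atTop (𝓝 0)) ∧
    (∀ e k p, ‖del e (θ k) p‖ ≤ C * ‖e‖) ∧ ∀ e p, Tendsto (fun k => del e (θ k) p) atTop (𝓝 0) := by
  obtain ⟨b, hb, hb1, hbr, -⟩ := exists_bump one_pos one_lt_two
  obtain ⟨C, hC⟩ := (hb.compact.fderiv (𝕜 := ℝ)).exists_bound_of_continuous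
    (hb.smooth.continuous_fderiv (by simp))
  have hC0 : 0 ≤ C := (norm_nonneg _).trans (hC 0)
  let c : ℕ → ℝ := fun k => 1 / ((k : ℝ) + 1)
  have hc0 : ∀ k, 0 < c k := fun k => by positivity
  have hc1 : ∀ k, c k ≤ 1 := fun k => by
    rw [div_le_one (by positivity)]
    linarith [(Nat.cast_nonneg k : (0 : ℝ) ≤ k)]
  have hct : Tendsto c atTop (𝓝 0) := tendsto_one_div_add_atTop_nhds_zero_nat
  have hd : ∀ k p v, ‖fderiv ℝ (fun q => b (c k • q)) p v‖ ≤ c k * (C * ‖v‖) := fun k p v => by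
    have : fderiv ℝ (fun q => b (c k • q)) p = c k • fderiv ℝ b (c k • p) := fderiv_comp_smul _
    rw [this, smul_apply, norm_smul, Real.norm_of_nonneg (hc0 k).le]
    exact mul_le_mul_of_nonneg_left (((fderiv ℝ b (c k • p)).le_opNorm v).trans
      (mul_le_mul_of_nonneg_right (hC _) (norm_nonneg _))) (hc0 k).le
  have hI : ∀ e : ℂ × ℂ, ‖I • e‖ = ‖e‖ := fun e => by rw [norm_smul, norm_I, one_mul]
  have hdb : ∀ k p e, ‖dbar e (fun q => b (c k • q)) p‖ ≤ c k * (C * ‖e‖) := fun k p e => by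
    rw [dbar, norm_div, norm_ofNat, div_le_iff₀ two_pos]
    refine (norm_add_le _ _).trans ?_
    have h1 := hd k p e
    have h2 := hd k p (I • e)
    rw [hI] at h2
    rw [norm_mul, norm_I, one_mul]
    linarith
  have hde : ∀ k p e, ‖del e (fun q => b (c k • q)) p‖ ≤ c k * (C * ‖e‖) := fun k p e => by
    rw [del, norm_div, norm_ofNat, div_le_iff₀ two_pos]
    refine (norm_sub_le _ _).trans ?_
    have h1 := hd k p e
    have h2 := hd k p (I • e)
    rw [hI] at h2
    rw [norm_mul, norm_I, one_mul]
    linarith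
  have hle : ∀ k (e : ℂ × ℂ), c k * (C * ‖e‖) ≤ max C 2 * ‖e‖ := fun k e => by
    refine (mul_le_of_le_one_left (by positivity) (hc1 k)).trans ?_
    gcongr
    exact le_max_left _ _
  have hlim : ∀ e : ℂ × ℂ, Tendsto (fun k => c k * (C * ‖e‖)) atTop (𝓝 0) := fun e => by
    simpa using hct.mul_const (C * ‖e‖)
  refine ⟨fun k q => b (c k • q), max C 2, fun k => ⟨hb.smooth.comp (contDiff_const_smul _), ?_⟩,
    fun k p => ?_, fun p => ?_, fun e k p => (hdb k p e).trans (hle k e),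
    fun e p => squeeze_zero_norm (fun k => hdb k p e) (hlim e),
    fun e k p => (hde k p e).trans (hle k e),
    fun e p => squeeze_zero_norm (fun k => hde k p e) (hlim e)⟩
  · exact hb.compact.comp_homeomorph (Homeomorph.smulOfNeZero (c k) (hc0 k).ne')
  · refine (norm_sub_le _ _).trans (le_trans ?_ (le_max_right _ _))
    have := hb1 (c k • p)
    rw [norm_one]
    linarith
  · have h1 : Tendsto (fun k => c k * ‖p‖) atTop (𝓝 0) := by simpa using hct.mul_const ‖p‖
    refine tendsto_const_nhds.congr' ?_
    filter_upwards [h1.eventually_le_const one_pos] with k hk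
    rw [hbr (c k • p) (by rwa [norm_smul, Real.norm_of_nonneg (hc0 k).le]), sub_self]

variable {F G : ℂ × ℂ → ℂ} {a b : ℝ}

theorem measurable_coe (u : L2 φ) : Measurable fun p => u p :=
  (Lp.stronglyMeasurable u).measurable

theorem measurable_mul_test (u : L2 φ) (hη : IsTest η) : Measurable fun p => u p * η p :=
  (measurable_coe u).mul hη.smooth.continuous.measurable

theorem memLp_mul_test (hφ : ContDiff ℝ ∞ φ) (u : L2 φ) (hη : IsTest η) :
    MemLp (fun p => u p * η p) 2 volume := by
  obtain ⟨M, hM0, hM⟩ := hη.exists_norm_sq_le_mul_wt hφ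
  refine ⟨(measurable_mul_test u hη).aestronglyMeasurable, ?_⟩
  have hm : Measurable fun p => ENNReal.ofReal (Real.exp (-2 * φ p)) := by fun_prop
  have h1 : ∫⁻ p, ‖u p * η p‖ₑ ^ 2 ≤ ENNReal.ofReal M * ∫⁻ p, ‖u p‖ₑ ^ 2 ∂(weightedMeasure φ) := by
    rw [lintegral_withDensity_eq_lintegral_mul _ hm ((measurable_coe u).enorm.pow_const 2),
      ← lintegral_const_mul _ (hm.mul ((measurable_coe u).enorm.pow_const 2))]
    refine lintegral_mono fun p => ?_
    simp only [Pi.mul_apply]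
    rw [enorm_mul, mul_pow, mul_comm, ← mul_assoc, ← ENNReal.ofReal_mul hM0]
    gcongr
    rw [← ofReal_norm, ← ENNReal.ofReal_pow (norm_nonneg _)]
    exact ENNReal.ofReal_le_ofReal (hM p)
  rw [← eLpNorm_two_sq, ← eLpNorm_two_sq] at h1
  have h2 : eLpNorm (fun p => u p * η p) 2 volume ^ 2 < ⊤ := h1.trans_lt
    (ENNReal.mul_lt_top (by simp) (ENNReal.pow_lt_top (Lp.memLp u).2))
  exact lt_top_iff_ne_top.2 fun h => by simp [h] at h2

/-- `F` has norm at most `a` in `L²(ℂ², φ)`. -/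
structure IsSmall (φ : C(ℂ × ℂ, ℝ)) (a : ℝ) (F : ℂ × ℂ → ℂ) : Prop where
  measurable : Measurable F
  nonneg : 0 ≤ a
  eLpNorm_le : eLpNorm F 2 (weightedMeasure φ) ≤ ENNReal.ofReal a

theorem IsSmall.add (hF : IsSmall φ a F) (hG : IsSmall φ b G) :
    IsSmall φ (a + b) fun p => F p + G p where
  measurable := hF.measurable.add hG.measurable
  nonneg := add_nonneg hF.nonneg hG.nonneg
  eLpNorm_le := by
    rw [ENNReal.ofReal_add hF.nonneg hG.nonneg]
    exact (eLpNorm_add_le hF.measurable.aestronglyMeasurable hG.measurable.aestronglyMeasurable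
      (by norm_num)).trans (add_le_add hF.eLpNorm_le hG.eLpNorm_le)

theorem IsSmall.sub (hF : IsSmall φ a F) (hG : IsSmall φ b G) :
    IsSmall φ (a + b) fun p => F p - G p where
  measurable := hF.measurable.sub hG.measurable
  nonneg := add_nonneg hF.nonneg hG.nonneg
  eLpNorm_le := by
    rw [ENNReal.ofReal_add hF.nonneg hG.nonneg]
    exact (eLpNorm_sub_le hF.measurable.aestronglyMeasurable hG.measurable.aestronglyMeasurable
      (by norm_num)).trans (add_le_add hF.eLpNorm_le hG.eLpNorm_le)

theorem IsSmall.norm_toL2_sub_le {u : L2 φ} (hη : IsTest η) (h : IsSmall φ a F)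
    (he : ∀ p, η p - u p = F p) : ‖hη.toL2 φ - u‖ ≤ a := by
  rw [Lp.norm_def]
  refine ENNReal.toReal_le_of_le_ofReal h.nonneg (le_trans (le_of_eq ?_) h.eLpNorm_le)
  refine eLpNorm_congr_ae ?_
  filter_upwards [Lp.coeFn_sub (hη.toL2 φ) u,
    weightedMeasure_ac.ae_le (hη.coeFn_toL2 (φ := φ))] with p h1 h2
  rw [h1, Pi.sub_apply, h2, he]

theorem weightedMeasure_le (hφ0 : ∀ p, 0 ≤ φ p) : weightedMeasure φ ≤ volume := by
  refine (withDensity_mono (Eventually.of_forall fun p => ?_)).trans_eq withDensity_one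
  refine ENNReal.ofReal_le_one.2 (Real.exp_le_one_iff.2 ?_)
  linarith [hφ0 p]

variable {ρ : ℕ → ℂ × ℂ → ℝ}

theorem measurable_conv_sub {U : ℂ × ℂ → ℂ} (hρ : ∀ j, ∃ h ≤ 1, IsMollifier h (ρ j))
    (hU : LocallyIntegrable U) (hm : Measurable U) (j : ℕ) :
    Measurable fun x => conv (ρ j) U x - U x := by
  obtain ⟨h, -, hh⟩ := hρ j
  exact (contDiff_conv hh hU).continuous.measurable.sub hm

theorem eventually_isSmall_conv_sub (hφ0 : ∀ p, 0 ≤ φ p)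
    (hρ : ∀ j, ∃ h ≤ 1, IsMollifier h (ρ j))
    (hρt : ∀ U : ℂ × ℂ → ℂ, MemLp U 2 volume → Measurable U →
      Tendsto (fun j => eLpNorm (fun x => conv (ρ j) U x - U x) 2 volume) atTop (𝓝 0))
    {U : ℂ × ℂ → ℂ} (hU : MemLp U 2 volume) (hm : Measurable U) (ha : 0 < a) :
    ∀ᶠ j in atTop, IsSmall φ a fun x => conv (ρ j) U x - U x := by
  filter_upwards [ENNReal.tendsto_nhds_zero.1 (hρt U hU hm) (ENNReal.ofReal a)
    (ENNReal.ofReal_pos.2 ha)] with j hj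
  exact ⟨measurable_conv_sub hρ (hU.locallyIntegrable (by norm_num)) hm j, ha.le,
    (eLpNorm_mono_measure _ (weightedMeasure_le hφ0)).trans hj⟩

/-- The coefficient `P` may be unbounded, but mollifiers of scale at most 1 keep everything in the
ball of radius `R + 1`, where it is bounded. -/
theorem eventually_isSmall_mul_conv_sub (hφ0 : ∀ p, 0 ≤ φ p)
    (hρ : ∀ j, ∃ h ≤ 1, IsMollifier h (ρ j))
    (hρt : ∀ U : ℂ × ℂ → ℂ, MemLp U 2 volume → Measurable U →
      Tendsto (fun j => eLpNorm (fun x => conv (ρ j) U x - U x) 2 volume) atTop (𝓝 0))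
    {U P : ℂ × ℂ → ℂ} (hU : MemLp U 2 volume) (hm : Measurable U) (hP : Continuous P) {R : ℝ}
    (hR : ∀ x, R ≤ ‖x‖ → U x = 0) (ha : 0 < a) :
    ∀ᶠ j in atTop, IsSmall φ a fun x => P x * (conv (ρ j) U x - U x) := by
  obtain ⟨M, hM⟩ := (isCompact_closedBall (0 : ℂ × ℂ) (R + 1)).exists_bound_of_continuousOn
    hP.continuousOn
  have h1 : Tendsto (fun j => ENNReal.ofReal M * eLpNorm (fun x => conv (ρ j) U x - U x) 2 volume)
      atTop (𝓝 0) := by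
    simpa using ENNReal.Tendsto.const_mul (hρt U hU hm) (Or.inr ENNReal.ofReal_ne_top)
  have hl := hU.locallyIntegrable (by norm_num)
  filter_upwards [ENNReal.tendsto_nhds_zero.1 h1 (ENNReal.ofReal a) (ENNReal.ofReal_pos.2 ha)] with j hj
  refine ⟨hP.measurable.mul (measurable_conv_sub hρ hl hm j), ha.le,
    (eLpNorm_mono_measure _ (weightedMeasure_le hφ0)).trans (le_trans ?_ hj)⟩
  refine eLpNorm_le_mul_eLpNorm_of_ae_le_mul (Eventually.of_forall fun x => ?_) 2
  rw [norm_mul]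
  obtain ⟨h, hh1, hh⟩ := hρ j
  rcases le_total ‖x‖ (R + 1) with hx | hx
  · gcongr
    exact hM x (by simpa using hx)
  · simp [hR x (by linarith), support_conv_subset hh hR (x := x) (by linarith)]

theorem eventually_isSmall_mul (u : L2 φ) {m : ℕ → ℂ × ℂ → ℂ} (hm : ∀ k, Continuous (m k)) {C : ℝ}
    (hC : ∀ k p, ‖m k p‖ ≤ C) (h0 : ∀ p, Tendsto (fun k => m k p) atTop (𝓝 0)) (ha : 0 < a) :
    ∀ᶠ k in atTop, IsSmall φ a fun p => u p * m k p := by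
  filter_upwards [ENNReal.tendsto_nhds_zero.1 (tendsto_eLpNorm_mul u hm hC h0) (ENNReal.ofReal a)
    (ENNReal.ofReal_pos.2 ha)] with k hk
  exact ⟨(measurable_coe u).mul (hm k).measurable, ha.le, hk⟩

/-- Test forms are dense in the domain of `∂̄ ⊕ ∂̄*` for the graph norm. -/
theorem exists_testForm_approx (hφ : ContDiff ℝ ∞ φ) (hφ0 : ∀ p, 0 ≤ φ p) {u : L2Form φ} {g h : L2 φ}
    (hug : (u, g) ∈ (dbar1 φ).graph) (huh : (u, h) ∈ ((dbar0 φ)†).graph) {ε : ℝ} (hε : 0 < ε) :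
    ∃ (f₁ f₂ : ℂ × ℂ → ℂ) (h₁ : IsTest f₁) (h₂ : IsTest f₂), ‖testForm φ h₁ h₂ - u‖ ≤ ε ∧
      ‖((h₂.dbar (1, 0)).sub (h₁.dbar (0, 1))).toL2 φ - g‖ ≤ ε ∧
      ‖((h₁.delta hφ (1, 0)).add (h₂.delta hφ (0, 1))).toL2 φ - h‖ ≤ ε := by
  rw [dbar1_graph] at hug
  -- The approximation of `h` involves the most error terms, namely six.
  have ha : 0 < ε / 6 := by positivity
  have hd : ∀ {h : ℂ × ℂ → ℂ}, IsTest h → Differentiable ℝ h :=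
    fun hh => hh.smooth.differentiable (by simp)
  let u₁ := u.fst
  let u₂ := u.snd
  obtain ⟨θs, C, hθs, c1, t1, c2, t2, c3, t3⟩ := exists_cutoff_seq
  have e1 := fun v : L2 φ => eventually_isSmall_mul v (m := fun k p => θs k p - 1)
    (fun k => (hθs k).smooth.continuous.sub continuous_const) c1 t1 ha
  have e2 := fun (v : L2 φ) e => eventually_isSmall_mul v (m := fun k => dbar e (θs k))
    (fun k => ((hθs k).dbar e).smooth.continuous) (c2 e) (t2 e) ha
  have e3 := fun (v : L2 φ) e => eventually_isSmall_mul v (m := fun k => del e (θs k))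
    (fun k => ((hθs k).del e).smooth.continuous) (c3 e) (t3 e) ha
  obtain ⟨k, s1, s2, s3, s4, s5, s6, s7, s8⟩ := ((e1 u₁).and <| (e1 u₂).and <| (e1 g).and <|
    (e1 h).and <| (e2 u₁ (0, 1)).and <| (e2 u₂ (1, 0)).and <| (e3 u₁ (1, 0)).and
    (e3 u₂ (0, 1))).exists
  set θ := θs k
  have hθ : IsTest θ := hθs k
  obtain ⟨R, hR⟩ : ∃ R : ℝ, ∀ x, R ≤ ‖x‖ → θ x = 0 := by
    obtain ⟨R, hR⟩ := hθ.compact.isCompact.isBounded.subset_ball (0 : ℂ × ℂ)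
    refine ⟨R, fun x hx => ?_⟩
    by_contra h0
    have := hR (subset_tsupport _ h0)
    rw [mem_ball_zero_iff] at this
    linarith
  let P : ℂ × ℂ → ℂ × ℂ → ℂ := fun e p => 2 * del e (fun q => (φ q : ℂ)) p
  have hP : ∀ e, ContDiff ℝ ∞ (P e) := fun e =>
    contDiff_const.mul (contDiff_del (contDiff_ofReal_comp hφ) e)
  have hPθ : ∀ e, IsTest fun p => P e p * θ p + del e θ p := fun e =>
    (hθ.mul_left (hP e)).add (hθ.del e)
  let U₁ : ℂ × ℂ → ℂ := fun p => u₁ p * θ p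
  let U₂ : ℂ × ℂ → ℂ := fun p => u₂ p * θ p
  -- For the truncated form `θ u`, `G` is its weak `∂̄` and `K` is `∂_z U₁ + ∂_w U₂`. The zero-order
  -- part `2 ∂φ` of the adjoint has been moved into `K`, so that both equations have constant
  -- coefficients.
  let G : ℂ × ℂ → ℂ := fun p => g p * θ p + u₂ p * dbar (1, 0) θ p - u₁ p * dbar (0, 1) θ p
  let K : ℂ × ℂ → ℂ := fun p => u₁ p * (P (1, 0) p * θ p + del (1, 0) θ p) +
    u₂ p * (P (0, 1) p * θ p + del (0, 1) θ p) - h p * θ p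
  have LU₁ : MemLp U₁ 2 volume := memLp_mul_test hφ u₁ hθ
  have LU₂ : MemLp U₂ 2 volume := memLp_mul_test hφ u₂ hθ
  have LG : MemLp G 2 volume := ((memLp_mul_test hφ g hθ).add
    (memLp_mul_test hφ u₂ (hθ.dbar (1, 0)))).sub (memLp_mul_test hφ u₁ (hθ.dbar (0, 1)))
  have LK : MemLp K 2 volume := ((memLp_mul_test hφ u₁ (hPθ (1, 0))).add
    (memLp_mul_test hφ u₂ (hPθ (0, 1)))).sub (memLp_mul_test hφ h hθ)
  have MU₁ : Measurable U₁ := measurable_mul_test u₁ hθ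
  have MU₂ : Measurable U₂ := measurable_mul_test u₂ hθ
  have MG : Measurable G := ((measurable_mul_test g hθ).add
    (measurable_mul_test u₂ (hθ.dbar (1, 0)))).sub (measurable_mul_test u₁ (hθ.dbar (0, 1)))
  have MK : Measurable K := ((measurable_mul_test u₁ (hPθ (1, 0))).add
    (measurable_mul_test u₂ (hPθ (0, 1)))).sub (measurable_mul_test h hθ)
  have lU₁ := LU₁.locallyIntegrable (by norm_num)
  have lU₂ := LU₂.locallyIntegrable (by norm_num)
  have eqG : ∀ η, IsTest η →
      (∫ p, U₂ p * dbar (1, 0) η p) - (∫ p, U₁ p * dbar (0, 1) η p) = -∫ p, G p * η p := by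
    intro η hη
    have h1 := (hasWeakDbarForm_iff _ _ _).1 hug _ (hη.mul_left hθ.smooth)
    rw [dbarZ_eq, dbarW_eq, funext (dbar_mul (hd hθ) (hd hη) (1, 0)),
      funext (dbar_mul (hd hθ) (hd hη) (0, 1))] at h1
    change (∫ p, u₂ p * _) - (∫ p, u₁ p * _) = _ at h1
    have i1 := integrable_mul u₂ (hη.mul_left (hθ.dbar (1, 0)).smooth)
    have i2 := integrable_mul u₂ ((hη.dbar (1, 0)).mul_left hθ.smooth)
    have i3 := integrable_mul u₁ (hη.mul_left (hθ.dbar (0, 1)).smooth)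
    have i4 := integrable_mul u₁ ((hη.dbar (0, 1)).mul_left hθ.smooth)
    have i5 := integrable_mul g (hη.mul_left hθ.smooth)
    simp only [mul_add] at h1
    rw [integral_add i1 i2, integral_add i3 i4] at h1
    simp only [U₁, U₂, G, add_mul, sub_mul, mul_assoc]
    rw [integral_sub (f := fun p => g p * (θ p * η p) + u₂ p * (dbar (1, 0) θ p * η p))
      (i5.add i1) i3, integral_add i5 i1]
    linear_combination h1
  have eqK : ∀ η, IsTest η →
      (∫ p, U₁ p * del (1, 0) η p) + (∫ p, U₂ p * del (0, 1) η p) = -∫ p, K p * η p := by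
    intro η hη
    have h1 := integral_of_mem_adjoint hφ huh (hη.mul_left hθ.smooth)
    simp only [del_mul (hd hθ) (hd hη)] at h1
    have ex : ∀ e p, del e θ p * η p + θ p * del e η p + 2 * del e (fun q => (φ q : ℂ)) p * (θ p * η p) =
        (P e p * θ p + del e θ p) * η p + θ p * del e η p := fun e p => by
      simp only [P]
      ring
    simp only [ex] at h1
    change (∫ p, u₁ p * _) + (∫ p, u₂ p * _) = _ at h1
    have i1 := integrable_mul u₁ (hη.mul_left (hPθ (1, 0)).smooth)
    have i2 := integrable_mul u₁ ((hη.del (1, 0)).mul_left hθ.smooth)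
    have i3 := integrable_mul u₂ (hη.mul_left (hPθ (0, 1)).smooth)
    have i4 := integrable_mul u₂ ((hη.del (0, 1)).mul_left hθ.smooth)
    have i5 := integrable_mul h (hη.mul_left hθ.smooth)
    simp only [mul_add (u₁ _), mul_add (u₂ _)] at h1
    have h2 := integral_add i1 i2
    have h3 := integral_add i3 i4
    rw [h2, h3] at h1
    have h4 : ∫ p, K p * η p = (∫ p, u₁ p * ((P (1, 0) p * θ p + del (1, 0) θ p) * η p)) +
        (∫ p, u₂ p * ((P (0, 1) p * θ p + del (0, 1) θ p) * η p)) - ∫ p, h p * (θ p * η p) := by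
      rw [← integral_add' i1 i3, ← integral_sub (i1.add i3) i5]
      refine integral_congr_ae (Eventually.of_forall fun p => ?_)
      simp only [K, Pi.add_apply]
      ring
    rw [h4]
    simp only [U₁, U₂, mul_assoc]
    linear_combination h1
  obtain ⟨ρ, hρ, hρt⟩ := exists_mollifier_seq
  have hR₁ : ∀ x, R ≤ ‖x‖ → U₁ x = 0 := fun x hx => by simp [U₁, hR x hx]
  have hR₂ : ∀ x, R ≤ ‖x‖ → U₂ x = 0 := fun x hx => by simp [U₂, hR x hx]
  obtain ⟨j, r1, r2, r3, r4, r5, r6⟩ := (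
    (eventually_isSmall_conv_sub hφ0 hρ hρt LU₁ MU₁ ha).and <|
    (eventually_isSmall_conv_sub hφ0 hρ hρt LU₂ MU₂ ha).and <|
    (eventually_isSmall_conv_sub hφ0 hρ hρt LG MG ha).and <|
    (eventually_isSmall_conv_sub hφ0 hρ hρt LK MK ha).and <|
    (eventually_isSmall_mul_conv_sub hφ0 hρ hρt LU₁ MU₁ (hP (1, 0)).continuous hR₁ ha).and
    (eventually_isSmall_mul_conv_sub hφ0 hρ hρt LU₂ MU₂ (hP (0, 1)).continuous hR₂ ha)).exists
  obtain ⟨r, -, hr⟩ := hρ j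
  have h₁ : IsTest (conv (ρ j) U₁) := isTest_conv hr lU₁ hθ.compact.mul_left
  have h₂ : IsTest (conv (ρ j) U₂) := isTest_conv hr lU₂ hθ.compact.mul_left
  -- Mollification commutes exactly with constant-coefficient operators, so no commutator estimate
  -- is needed; the variable coefficient reappears only through `r5` and `r6`.
  have cG : ∀ x, dbar (1, 0) (conv (ρ j) U₂) x - dbar (0, 1) (conv (ρ j) U₁) x = conv (ρ j) G x := by
    intro x
    have := eqG _ (hr.isTest.comp_sub_left x)
    rw [dbar_conv hr lU₂, dbar_conv hr lU₁, conv]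
    linear_combination -this
  have cK : ∀ x, del (1, 0) (conv (ρ j) U₁) x + del (0, 1) (conv (ρ j) U₂) x = conv (ρ j) K x := by
    intro x
    have := eqK _ (hr.isTest.comp_sub_left x)
    rw [del_conv hr lU₂, del_conv hr lU₁, conv]
    linear_combination -this
  refine ⟨_, _, h₁, h₂, ?_, ?_, ?_⟩
  · have b1 := (r1.add s1).norm_toL2_sub_le h₁ (u := u₁) fun p => by simp only [U₁]; ring
    have b2 := (r2.add s2).norm_toL2_sub_le h₂ (u := u₂) fun p => by simp only [U₂]; ring
    have b3 : ‖testForm φ h₁ h₂ - u‖ ^ 2 = ‖h₁.toL2 φ - u₁‖ ^ 2 + ‖h₂.toL2 φ - u₂‖ ^ 2 :=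
      WithLp.prod_norm_sq_eq_of_L2 _
    have b4 := pow_le_pow_left₀ (norm_nonneg _) b1 2
    have b5 := pow_le_pow_left₀ (norm_nonneg _) b2 2
    refine (sq_le_sq₀ (norm_nonneg _) hε.le).1 ?_
    nlinarith
  · refine (((r3.add s3).add (s6.sub s5)).norm_toL2_sub_le _ fun p => ?_).trans ?_
    · rw [cG]
      simp only [G]
      ring
    · linarith
  · refine ((((r5.add r6).sub r4).add (s4.sub (s7.add s8))).norm_toL2_sub_le _ fun p => ?_).trans ?_
    · have := cK p
      simp only [delta]
      simp only [P, U₁, U₂, K] at this ⊢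
      linear_combination -this
    · linarith

end Density

/-! ### Weights which are not decoupled -/

section DiscreteSpectrum

open Filter Topology

variable {φ : C(ℂ × ℂ, ℝ)} {f g : ℂ × ℂ → ℂ}

theorem integral_toL2_mul (hf : IsTest f) (y : ℂ × ℂ → ℂ) :
    ∫ p, hf.toL2 φ p * y p = ∫ p, f p * y p :=
  integral_congr_ae ((hf.coeFn_toL2 (φ := φ)).mono fun p hp => by simp only [hp])

/-- The compactness estimate for test forms. -/
theorem exists_compactness_testForm {Γ : Finset (ℕ × ℕ)} {m n : ℕ} (hm : 2 ≤ m) (hn : 2 ≤ n)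
    (hmΓ : (m, 0) ∈ Γ) (hnΓ : (0, n) ∈ Γ) (hΓ : ¬ IsDecoupled Γ) {ε : ℝ} (hε : 0 < ε) :
    ∃ (N : Finset (ℂ × ℂ)) (y : ℂ × ℂ → ℂ × ℂ → ℂ) (C : ℝ), (∀ x, IsTest (y x)) ∧
      ∀ f g (hf : IsTest f) (hg : IsTest g), ‖testForm (modelWeight Γ) hf hg‖ ^ 2 ≤
        ε * (‖testForm (modelWeight Γ) hf hg‖ ^ 2 +
          ‖((hg.dbar (1, 0)).sub (hf.dbar (0, 1))).toL2 (modelWeight Γ)‖ ^ 2 +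
          ‖((hf.delta (contDiff_modelWeight Γ) (1, 0)).add
            (hg.delta (contDiff_modelWeight Γ) (0, 1))).toL2 (modelWeight Γ)‖ ^ 2) +
        C * ∑ x ∈ N, (‖∫ p, (testForm (modelWeight Γ) hf hg).fst p * y x p‖ ^ 2 +
          ‖∫ p, (testForm (modelWeight Γ) hf hg).snd p * y x p‖ ^ 2) := by
  have hφ := contDiff_modelWeight Γ
  have hφ0 : ∀ p, 0 ≤ modelWeight Γ p := fun p => by
    rw [modelWeight_apply]
    positivity
  obtain ⟨R, hR, htail⟩ := exists_tail hm hn hmΓ hnΓ hΓ (ε := ε / 2) (by positivity)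
  obtain ⟨N, y, C, hC, hy, hloc⟩ := exists_local_compactness hφ hφ0 hR (ε := ε / 2) (by positivity)
  refine ⟨N, y, C, hy, fun f g hf hg => ?_⟩
  -- Kohn–Morrey replaces the energy by `∂̄`-derivatives and the Levi form, in which both the tail
  -- bound and the local bound are stated.
  have hKM := kohnMorrey_modelWeight Γ hf hg
  have i1 := hf.integrable_norm_sq hφ
  have i2 := hg.integrable_norm_sq hφ
  have t1 := htail f g hf hg
  have l1 := hloc f hf
  have l2 := hloc g hg
  have hw := fun p => (wt_pos (modelWeight Γ) p).le
  have L0 : 0 ≤ ∫ p, levi Γ f g p * wt (modelWeight Γ) p :=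
    integral_nonneg fun p => mul_nonneg (levi_nonneg _ _ _ _) (hw p)
  have D : ∀ e (h : ℂ × ℂ → ℂ), 0 ≤ ∫ p, ‖dbar e h p‖ ^ 2 * wt (modelWeight Γ) p := fun e h =>
    integral_nonneg fun p => mul_nonneg (by positivity) (hw p)
  have d1 := D (1, 0) f
  have d2 := D (0, 1) f
  have d3 := D (1, 0) g
  have d4 := D (0, 1) g
  have split : (∫ p, ‖f p‖ ^ 2 * wt (modelWeight Γ) p) + (∫ p, ‖g p‖ ^ 2 * wt (modelWeight Γ) p) =
      (∫ p in Metric.ball 0 R, ‖f p‖ ^ 2 * wt (modelWeight Γ) p) +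
      (∫ p in Metric.ball 0 R, ‖g p‖ ^ 2 * wt (modelWeight Γ) p) +
      ∫ p in (Metric.ball 0 R)ᶜ, (‖f p‖ ^ 2 + ‖g p‖ ^ 2) * wt (modelWeight Γ) p := by
    simp only [add_mul]
    rw [integral_add i1.integrableOn i2.integrableOn,
      ← integral_add_compl (Metric.isOpen_ball (x := (0 : ℂ × ℂ)) (ε := R)).measurableSet i1,
      ← integral_add_compl (Metric.isOpen_ball (x := (0 : ℂ × ℂ)) (ε := R)).measurableSet i2]
    ring
  rw [norm_sq_testForm, norm_sq_toL2, norm_sq_toL2, Finset.sum_add_distrib, add_assoc _ _ (integral _ _),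
    hKM, split]
  change _ ≤ _ + C * ((∑ x ∈ N, ‖∫ p, hf.toL2 (modelWeight Γ) p * y x p‖ ^ 2) +
    ∑ x ∈ N, ‖∫ p, hg.toL2 (modelWeight Γ) p * y x p‖ ^ 2)
  simp only [integral_toL2_mul]
  rw [← split]
  have A1 : 0 ≤ ∫ p, ‖f p‖ ^ 2 * wt (modelWeight Γ) p :=
    integral_nonneg fun p => mul_nonneg (by positivity) (hw p)
  have A2 : 0 ≤ ∫ p, ‖g p‖ ^ 2 * wt (modelWeight Γ) p :=
    integral_nonneg fun p => mul_nonneg (by positivity) (hw p)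
  have p0 := mul_nonneg hε.le L0
  have p1 := mul_nonneg hε.le d1
  have p2 := mul_nonneg hε.le d2
  have p3 := mul_nonneg hε.le d3
  have p4 := mul_nonneg hε.le d4
  have p5 := mul_nonneg hε.le A1
  have p6 := mul_nonneg hε.le A2
  linarith

/-- Both sides of the estimate for test forms are continuous in the graph norm, so it passes to the
whole form domain. The finitely many local pairings vanish once `u` is orthogonal to the vectors
that represent them. -/
theorem hasDiscreteSpectrum_of_not_isDecoupled {Γ : Finset (ℕ × ℕ)} {m n : ℕ} (hm : 2 ≤ m) (hn : 2 ≤ n)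
    (hmΓ : (m, 0) ∈ Γ) (hnΓ : (0, n) ∈ Γ) (hΓ : ¬ IsDecoupled Γ) :
    HasDiscreteSpectrum (box (modelWeight Γ)) := by
  have hφ := contDiff_modelWeight Γ
  have hφ0 : ∀ p, 0 ≤ modelWeight Γ p := fun p => by
    rw [modelWeight_apply]
    positivity
  refine (isHilbertComplex_dbar hφ).hasDiscreteSpectrum fun ε hε => ?_
  obtain ⟨N, y, C, hy, hcpt⟩ := exists_compactness_testForm hm hn hmΓ hnΓ hΓ hε
  classical
  let Y : ℂ × ℂ → L2 (modelWeight Γ) := fun x => ((hy x).div_wt hφ).toL2 (modelWeight Γ)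
  refine ⟨N.image (fun x => WithLp.toLp 2 (Y x, 0)) ∪ N.image (fun x => WithLp.toLp 2 (0, Y x)),
    fun u g h hug huh hu => ?_⟩
  have o1 : ∀ x ∈ N, ∫ p, u.fst p * y x p = 0 := fun x hx => by
    have := hu _ (Finset.mem_union_left _ (Finset.mem_image_of_mem _ hx))
    rw [WithLp.prod_inner_apply] at this
    have h0 : inner ℂ (Y x) u.fst = 0 := by simpa using this
    rw [integral_mul_eq_inner hφ (hy x)]
    exact h0
  have o2 : ∀ x ∈ N, ∫ p, u.snd p * y x p = 0 := fun x hx => by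
    have := hu _ (Finset.mem_union_right _ (Finset.mem_image_of_mem _ hx))
    rw [WithLp.prod_inner_apply] at this
    have h0 : inner ℂ (Y x) u.snd = 0 := by simpa using this
    rw [integral_mul_eq_inner hφ (hy x)]
    exact h0
  choose f₁ f₂ h₁ h₂ a1 a2 a3 using fun k : ℕ =>
    exists_testForm_approx hφ hφ0 hug huh (ε := 1 / ((k : ℝ) + 1)) (by positivity)
  have hlim : ∀ {X : Type} [NormedAddCommGroup X] {s : ℕ → X} {x : X},
      (∀ k, ‖s k - x‖ ≤ 1 / ((k : ℝ) + 1)) → Tendsto s atTop (𝓝 x) := fun hs =>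
    tendsto_iff_norm_sub_tendsto_zero.2 (squeeze_zero (fun _ => norm_nonneg _) hs
      tendsto_one_div_add_atTop_nhds_zero_nat)
  have b1 := hlim a1
  have b2 := hlim a2
  have b3 := hlim a3
  have c1 : ∀ x, Tendsto (fun k => ‖∫ p, (testForm (modelWeight Γ) (h₁ k) (h₂ k)).fst p * y x p‖ ^ 2)
      atTop (𝓝 (‖∫ p, u.fst p * y x p‖ ^ 2)) := fun x =>
    (((continuous_integral_mul hφ (hy x)).comp continuous_fst_L2Form).norm.pow 2).tendsto u |>.comp b1
  have c2 : ∀ x, Tendsto (fun k => ‖∫ p, (testForm (modelWeight Γ) (h₁ k) (h₂ k)).snd p * y x p‖ ^ 2)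
      atTop (𝓝 (‖∫ p, u.snd p * y x p‖ ^ 2)) := fun x =>
    (((continuous_integral_mul hφ (hy x)).comp continuous_snd_L2Form).norm.pow 2).tendsto u |>.comp b1
  have key := le_of_tendsto_of_tendsto' (b1.norm.pow 2)
    (((((b1.norm.pow 2).add (b2.norm.pow 2)).add (b3.norm.pow 2)).const_mul ε).add
      ((tendsto_finsetSum N fun x _ => (c1 x).add (c2 x)).const_mul C))
    fun k => hcpt _ _ (h₁ k) (h₂ k)
  have hz : ∑ x ∈ N, (‖∫ p, u.fst p * y x p‖ ^ 2 + ‖∫ p, u.snd p * y x p‖ ^ 2) = 0 :=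
    Finset.sum_eq_zero fun x hx => by simp [o1 x hx, o2 x hx]
  rwa [hz, mul_zero, add_zero] at key

end DiscreteSpectrum

/-! ### Decoupled weights -/

section Decoupled

open Filter Topology

variable {φ : C(ℂ × ℂ, ℝ)} {f g a : ℂ × ℂ → ℂ}

theorem isTest_zero : IsTest fun _ => 0 := ⟨contDiff_const, HasCompactSupport.zero⟩

theorem coeFn_toLp (ha : MemLp a 2 (weightedMeasure φ)) : ∀ᵐ p, ha.toLp a p = a p :=
  ac_weightedMeasure.ae_le (MemLp.coeFn_toLp ha)

theorem norm_sq_toLp (ha : MemLp a 2 (weightedMeasure φ)) :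
    ‖ha.toLp a‖ ^ 2 = ∫ p, ‖a p‖ ^ 2 * wt φ p := by
  have h1 : ((‖ha.toLp a‖ ^ 2 : ℝ) : ℂ) = inner ℂ (ha.toLp a) (ha.toLp a) := by
    rw [inner_self_eq_norm_sq_to_K]
    norm_cast
  rw [inner_eq_integral] at h1
  rw [← ofReal_inj, h1, ofReal_integral_norm_sq]
  exact integral_congr_ae ((coeFn_toLp ha).mono fun p hp => by
    simp only [hp])

/-- A smooth `a dw̄` with `∂a/∂z̄ = 0` is `∂̄`-closed. -/
theorem toLp_mem_dbar1 (ha : MemLp a 2 (weightedMeasure φ)) (has : ContDiff ℝ ∞ a)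
    (hz : ∀ p, dbar (1, 0) a p = 0) :
    ((WithLp.toLp 2 (0, ha.toLp a) : L2Form φ), (0 : L2 φ)) ∈ (dbar1 φ).graph := by
  rw [dbar1_graph]
  refine (hasWeakDbarForm_iff _ _ _).2 fun η hη => ?_
  change (∫ p, ha.toLp a p * dbarZ η p) - (∫ p, (0 : L2 φ) p * dbarW η p) = -∫ p, (0 : L2 φ) p * η p
  rw [integral_zero_mul, integral_zero_mul, sub_zero, neg_zero,
    ← integral_dbar (hη.mul_left has) (1, 0)]
  refine integral_congr_ae ((coeFn_toLp ha).mono fun p hp => ?_)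
  simp only [hp]
  rw [dbar_mul (has.differentiable (by simp)) (hη.smooth.differentiable (by simp)), hz, dbarZ_eq]
  ring

/-- A smooth square integrable `a dw̄` with square integrable `δ_w a` is in the domain of `∂̄*`. -/
theorem toLp_mem_adjoint (hφ : ContDiff ℝ ∞ φ) (ha : MemLp a 2 (weightedMeasure φ))
    (has : ContDiff ℝ ∞ a) (hb : MemLp (delta φ (0, 1) a) 2 (weightedMeasure φ)) :
    ((WithLp.toLp 2 (0, ha.toLp a) : L2Form φ), hb.toLp _) ∈ ((dbar0 φ)†).graph := by
  have hcl : IsClosed (((dbar0 φ)†).graph : Set (L2Form φ × L2 φ)) :=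
    LinearPMap.adjoint_isClosed (dense_dbar0 φ)
  have hd : ∀ {h : ℂ × ℂ → ℂ}, ContDiff ℝ ∞ h → Differentiable ℝ h :=
    fun hh => hh.differentiable (by simp)
  refine hcl.closure_subset (Metric.mem_closure_iff.2 fun ε hε => ?_)
  have hε' : 0 < ε / 4 := by positivity
  obtain ⟨θ, C, hθ, c1, t1, -, -, c3, t3⟩ := exists_cutoff_seq
  have e1 := fun v : L2 φ => eventually_isSmall_mul v (m := fun k p => θ k p - 1)
    (fun k => (hθ k).smooth.continuous.sub continuous_const) c1 t1 hε'
  have e2 := eventually_isSmall_mul (ha.toLp a) (m := fun k => del (0, 1) (θ k))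
    (fun k => ((hθ k).del _).smooth.continuous) (c3 (0, 1)) (t3 (0, 1)) hε'
  obtain ⟨k, s1, s2, s3⟩ := ((e1 (ha.toLp a)).and ((e1 (hb.toLp _)).and e2)).exists
  -- Truncations of `a` are test functions; their images under `∂̄*` converge to `δ_w a`, and the
  -- graph of the adjoint is closed.
  have hT : IsTest fun p => θ k p * a p := (hθ k).mul_right has
  refine ⟨_, testForm_mem_adjoint hφ isTest_zero hT, ?_⟩
  have b1 : ‖hT.toL2 φ - ha.toLp a‖ ≤ ε / 4 := by
    rw [Lp.norm_def]
    refine ENNReal.toReal_le_of_le_ofReal hε'.le (le_trans (le_of_eq ?_) s1.eLpNorm_le)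
    refine eLpNorm_congr_ae ?_
    filter_upwards [Lp.coeFn_sub (hT.toL2 φ) (ha.toLp a),
      weightedMeasure_ac.ae_le (hT.coeFn_toL2 (φ := φ)), MemLp.coeFn_toLp ha] with p h1 h2 h3
    rw [h1, Pi.sub_apply, h2, h3]
    ring
  have hS := (isTest_zero.delta hφ (1, 0)).add (hT.delta hφ (0, 1))
  have b2 : ‖hS.toL2 φ - hb.toLp _‖ ≤ ε / 4 + ε / 4 := by
    have s4 := s2.sub s3
    rw [Lp.norm_def]
    refine ENNReal.toReal_le_of_le_ofReal s4.nonneg (le_trans (le_of_eq ?_) s4.eLpNorm_le)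
    refine eLpNorm_congr_ae ?_
    filter_upwards [Lp.coeFn_sub (hS.toL2 φ) (hb.toLp _),
      weightedMeasure_ac.ae_le (hS.coeFn_toL2 (φ := φ)), MemLp.coeFn_toLp ha,
      MemLp.coeFn_toLp hb] with p h1 h2 h3 h4
    rw [h1, Pi.sub_apply, h2, h3, h4]
    have h0 : delta φ (1, 0) (fun _ => 0) p = 0 := by simp [delta, del]
    rw [h0]
    simp only [delta]
    rw [del_mul (hd (hθ k).smooth) (hd has)]
    ring
  have b3 : ‖(WithLp.toLp 2 (0, ha.toLp a) : L2Form φ) - testForm φ isTest_zero hT‖ =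
      ‖hT.toL2 φ - ha.toLp a‖ := by
    have h0 : isTest_zero.toL2 φ = 0 := MemLp.toLp_zero _
    rw [← sq_eq_sq₀ (norm_nonneg _) (norm_nonneg _), WithLp.prod_norm_sq_eq_of_L2]
    change ‖0 - isTest_zero.toL2 φ‖ ^ 2 + ‖ha.toLp a - hT.toL2 φ‖ ^ 2 = _
    rw [h0, sub_zero, norm_zero, norm_sub_rev]
    ring
  rw [Prod.dist_eq]
  refine max_lt ?_ ?_
  · rw [dist_eq_norm, b3]
    linarith
  · rw [dist_comm, dist_eq_norm]
    linarith

/-- `F` is bounded by a polynomial. -/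
def PolyBounded (F : ℂ × ℂ → ℂ) : Prop := ∃ (C : ℝ) (N : ℕ), 0 ≤ C ∧ ∀ p, ‖F p‖ ≤ C * (1 + ‖p‖) ^ N

theorem polyBounded_const (c : ℂ) : PolyBounded fun _ => c := ⟨‖c‖, 0, norm_nonneg _, by simp⟩

theorem polyBounded_fst : PolyBounded fun p => p.1 :=
  ⟨1, 1, zero_le_one, fun p => by
    have := norm_fst_le p
    linarith⟩

theorem polyBounded_snd : PolyBounded fun p => p.2 :=
  ⟨1, 1, zero_le_one, fun p => by
    have := norm_snd_le p
    linarith⟩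

theorem PolyBounded.mul (hf : PolyBounded f) (hg : PolyBounded g) : PolyBounded fun p => f p * g p := by
  obtain ⟨C, N, hC, hN⟩ := hf
  obtain ⟨D, M, hD, hM⟩ := hg
  refine ⟨C * D, N + M, mul_nonneg hC hD, fun p => ?_⟩
  rw [norm_mul, pow_add, mul_mul_mul_comm]
  exact mul_le_mul (hN p) (hM p) (norm_nonneg _) (by positivity)

theorem PolyBounded.add (hf : PolyBounded f) (hg : PolyBounded g) : PolyBounded fun p => f p + g p := by
  obtain ⟨C, N, hC, hN⟩ := hf
  obtain ⟨D, M, hD, hM⟩ := hg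
  refine ⟨C + D, max N M, add_nonneg hC hD, fun p => ?_⟩
  have h1 : (1 : ℝ) ≤ 1 + ‖p‖ := by linarith [norm_nonneg p]
  rw [add_mul]
  refine (norm_add_le _ _).trans (add_le_add ((hN p).trans ?_) ((hM p).trans ?_))
  · gcongr
    exact le_max_left _ _
  · gcongr
    exact le_max_right _ _

theorem PolyBounded.pow (hf : PolyBounded f) (n : ℕ) : PolyBounded fun p => f p ^ n := by
  induction n with
  | zero => simpa using polyBounded_const 1
  | succ n ih => simpa only [pow_succ] using ih.mul hf

theorem PolyBounded.conj (hf : PolyBounded f) : PolyBounded fun p => conj (f p) := by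
  obtain ⟨C, N, hC, hN⟩ := hf
  exact ⟨C, N, hC, fun p => by simpa using hN p⟩

theorem polyBounded_sum {ι : Type*} {s : Finset ι} {F : ι → ℂ × ℂ → ℂ}
    (hF : ∀ i ∈ s, PolyBounded (F i)) : PolyBounded fun p => ∑ i ∈ s, F i p := by
  classical
  induction s using Finset.induction_on with
  | empty => simpa using polyBounded_const 0
  | insert i s hi ih =>
    simp only [Finset.sum_insert hi]
    exact (hF i (Finset.mem_insert_self _ _)).add (ih fun j hj => hF j (Finset.mem_insert_of_mem hj))

theorem polyBounded_eval_fst (P : Polynomial ℂ) : PolyBounded fun p => P.eval p.1 := by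
  simp only [Polynomial.eval_eq_sum, Polynomial.sum]
  exact polyBounded_sum fun i _ => (polyBounded_const _).mul (polyBounded_fst.pow i)

theorem polyBounded_mono (γ : ℕ × ℕ) : PolyBounded (mono γ) :=
  (polyBounded_fst.pow _).mul (polyBounded_snd.pow _)

theorem polyBounded_del_modelWeight (Γ : Finset (ℕ × ℕ)) :
    PolyBounded (del (0, 1) fun p => (modelWeight Γ p : ℂ)) := by
  rw [del_modelWeight]
  simp only [del_mono_snd]
  exact polyBounded_sum fun γ _ => ((((polyBounded_const _).mul (polyBounded_fst.pow _)).mul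
    (polyBounded_snd.pow _)).mul (polyBounded_mono γ).conj)

variable {Γ : Finset (ℕ × ℕ)} {m n : ℕ}

/-- The pure powers make the weight grow at least quadratically; the `-1` covers the region where a
coordinate is smaller than 1. -/
theorem norm_sq_sub_one_le_modelWeight (hm : 2 ≤ m) (hn : 2 ≤ n) (hmΓ : (m, 0) ∈ Γ)
    (hnΓ : (0, n) ∈ Γ) (p : ℂ × ℂ) : ‖p‖ ^ 2 - 1 ≤ modelWeight Γ p := by
  have h1 : ∀ (z : ℂ) (k : ℕ), 2 ≤ k → ‖z‖ ^ 2 - 1 ≤ ‖z ^ k‖ ^ 2 := fun z k hk => by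
    rcases le_total ‖z‖ 1 with h | h
    · have := pow_le_one₀ (n := 2) (norm_nonneg z) h
      have := sq_nonneg ‖z ^ k‖
      linarith
    · have := pow_le_pow_left₀ (norm_nonneg z) (le_self_pow₀ h (by omega : k ≠ 0)) 2
      rw [norm_pow]
      linarith
  have h2 : ∀ γ ∈ Γ, ‖mono γ p‖ ^ 2 ≤ modelWeight Γ p := fun γ hγ => by
    rw [modelWeight_apply]
    exact Finset.single_le_sum (f := fun γ => ‖mono γ p‖ ^ 2) (fun _ _ => by positivity) hγ
  have h3 := h2 _ hmΓ
  have h4 := h2 _ hnΓ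
  simp only [mono, pow_zero, mul_one, one_mul] at h3 h4
  have h5 := h1 p.1 m hm
  have h6 := h1 p.2 n hn
  rcases max_choice ‖p.1‖ ‖p.2‖ with h | h
  · rw [Prod.norm_def, h]
    linarith
  · rw [Prod.norm_def, h]
    linarith

/-- Quadratic growth gives `e^{-2φ} ≤ e^5 e^{-t}` with `t = 1 + ‖p‖`, which beats every polynomial.
-/
theorem PolyBounded.memLp (hm : 2 ≤ m) (hn : 2 ≤ n) (hmΓ : (m, 0) ∈ Γ) (hnΓ : (0, n) ∈ Γ)
    (hf : PolyBounded f) (hc : Continuous f) : MemLp f 2 (weightedMeasure (modelWeight Γ)) := by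
  have := isAddHaarMeasure_volume
  obtain ⟨C, N, hC, hN⟩ := hf
  rw [memLp_two_iff_integrable_sq_norm hc.aestronglyMeasurable,
    integrable_withDensity_iff_integrable_smul' (by fun_prop) (by simp)]
  have hfin : (Module.finrank ℝ (ℂ × ℂ) : ℝ) < 5 := by
    rw [Module.finrank_prod, Complex.finrank_real_complex]
    norm_num
  -- The exponent 5 is the first integer above the real dimension 4. The factorial comes from
  -- `e^{-t} ≤ k! / t^k` with `k = 2 N + 5`, of which `2 N` powers absorb `|f|²`.
  have hi := (integrable_one_add_norm (E := ℂ × ℂ) (μ := volume) hfin).const_mul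
    (C ^ 2 * (Real.exp 5 * (Nat.factorial (2 * N + 5))))
  simp only [ENNReal.toReal_ofReal (Real.exp_pos _).le]
  refine hi.mono' (Continuous.aestronglyMeasurable (by fun_prop)) (Eventually.of_forall fun p => ?_)
  rw [norm_smul, Real.norm_of_nonneg (Real.exp_pos _).le,
    Real.norm_of_nonneg (by positivity)]
  set t := 1 + ‖p‖ with ht
  have ht0 : 0 < t := by positivity
  have h1 : Real.exp (-2 * modelWeight Γ p) ≤ Real.exp 5 * Real.exp (-t) := by
    rw [← Real.exp_add]
    refine Real.exp_le_exp.2 ?_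
    have := norm_sq_sub_one_le_modelWeight hm hn hmΓ hnΓ p
    nlinarith [sq_nonneg (‖p‖ - 1), norm_nonneg p]
  have h2 : Real.exp (-t) ≤ (Nat.factorial (2 * N + 5)) / t ^ (2 * N + 5) := by
    have := Real.pow_div_factorial_le_exp t ht0.le (2 * N + 5)
    rw [Real.exp_neg, ← inv_div]
    gcongr
  have h3 : ‖f p‖ ^ 2 ≤ C ^ 2 * t ^ (2 * N) := by
    refine (pow_le_pow_left₀ (norm_nonneg _) (hN p) 2).trans_eq ?_
    rw [mul_pow, ← pow_mul, mul_comm N]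
  have h4 : t ^ (-(5 : ℝ)) = (t ^ 5)⁻¹ := by
    rw [Real.rpow_neg ht0.le]
    norm_cast
  rw [h4]
  calc Real.exp (-2 * modelWeight Γ p) * ‖f p‖ ^ 2 ≤
        (Real.exp 5 * ((Nat.factorial (2 * N + 5)) / t ^ (2 * N + 5))) * (C ^ 2 * t ^ (2 * N)) := by
        refine mul_le_mul (h1.trans (by gcongr)) h3 (by positivity) (by positivity)
    _ = _ := by
        rw [pow_add]
        field_simp

theorem modelWeight_of_isDecoupled (hΓ : IsDecoupled Γ) (z w : ℂ) :
    modelWeight Γ (z, w) = modelWeight Γ (z, 0) + modelWeight Γ (0, w) - modelWeight Γ (0, 0) := by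
  simp only [modelWeight_apply]
  rw [← Finset.sum_add_distrib, ← Finset.sum_sub_distrib]
  refine Finset.sum_congr rfl fun γ hγ => ?_
  rcases hΓ γ hγ with h | h <;> simp [mono, h]

theorem wt_of_isDecoupled (hΓ : IsDecoupled Γ) (z w : ℂ) :
    wt (modelWeight Γ) (z, w) = Real.exp (2 * modelWeight Γ (0, 0)) *
      (wt (modelWeight Γ) (z, 0) * wt (modelWeight Γ) (0, w)) := by
  rw [wt, wt, wt, ← Real.exp_add, ← Real.exp_add, modelWeight_of_isDecoupled hΓ]
  congr 1
  ring

theorem del_modelWeight_of_isDecoupled (hΓ : IsDecoupled Γ) (z w : ℂ) :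
    del (0, 1) (fun p => (modelWeight Γ p : ℂ)) (z, w) =
      del (0, 1) (fun p => (modelWeight Γ p : ℂ)) (0, w) := by
  simp only [del_modelWeight, del_mono_snd]
  refine Finset.sum_congr rfl fun γ hγ => ?_
  rcases hΓ γ hγ with h | h <;> simp [mono, h]

/-- Fubini for the product weight. The factor in front corrects for `φ(0, 0)`, counted in both `φ(z,
0)` and `φ(0, w)`. -/
theorem integral_norm_sq_mul_wt (hΓ : IsDecoupled Γ) (F G : ℂ → ℂ) :
    ∫ p : ℂ × ℂ, ‖F p.1 * G p.2‖ ^ 2 * wt (modelWeight Γ) p = Real.exp (2 * modelWeight Γ (0, 0)) *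
      ((∫ z, ‖F z‖ ^ 2 * wt (modelWeight Γ) (z, 0)) * ∫ w, ‖G w‖ ^ 2 * wt (modelWeight Γ) (0, w)) := by
  rw [← integral_prod_mul, ← integral_const_mul, Measure.volume_eq_prod]
  refine integral_congr_ae (Eventually.of_forall fun p => ?_)
  simp only
  rw [← Prod.mk.eta (p := p), wt_of_isDecoupled hΓ, norm_mul]
  ring

theorem differentiable_eval_fst (P : Polynomial ℂ) :
    Differentiable ℂ fun p : ℂ × ℂ => P.eval p.1 :=
  P.differentiable.comp differentiable_fst

theorem contDiff_eval_fst (P : Polynomial ℂ) : ContDiff ℝ ∞ fun p : ℂ × ℂ => P.eval p.1 :=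
  ((P.differentiable.contDiff (n := ∞)).restrict_scalars ℝ).comp contDiff_fst

theorem memLp_eval_fst (hm : 2 ≤ m) (hn : 2 ≤ n) (hmΓ : (m, 0) ∈ Γ) (hnΓ : (0, n) ∈ Γ)
    (P : Polynomial ℂ) :
    MemLp (fun p : ℂ × ℂ => P.eval p.1) 2 (weightedMeasure (modelWeight Γ)) :=
  (polyBounded_eval_fst P).memLp hm hn hmΓ hnΓ (contDiff_eval_fst P).continuous

/-- `P(z)` has no `w`-derivative and `∂φ/∂w` of a decoupled weight depends on `w` only, so `δ_w`
acts on `P(z)` as multiplication by a function of `w`. -/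
theorem delta_eval_fst (P : Polynomial ℂ) (hΓ : IsDecoupled Γ) (p : ℂ × ℂ) :
    delta (modelWeight Γ) (0, 1) (fun p : ℂ × ℂ => P.eval p.1) p =
      P.eval p.1 * (2 * del (0, 1) (fun p => (modelWeight Γ p : ℂ)) (0, p.2)) := by
  have h1 : HasFDerivAt (fun p : ℂ × ℂ => P.eval p.1) _ p :=
    (P.hasDerivAt p.1).comp_hasFDerivAt p (hasFDerivAt_fst (𝕜 := ℂ))
  have h0 : del (0, 1) (fun p : ℂ × ℂ => P.eval p.1) p = 0 := by
    rw [del_of_holomorphic (differentiable_eval_fst P), h1.fderiv]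
    simp
  rw [delta, h0, ← Prod.mk.eta (p := p), del_modelWeight_of_isDecoupled hΓ]
  ring

/-- The form `P(z) dw̄`. -/
def polyForm (hm : 2 ≤ m) (hn : 2 ≤ n) (hmΓ : (m, 0) ∈ Γ) (hnΓ : (0, n) ∈ Γ) :
    Polynomial ℂ →ₗ[ℂ] L2Form (modelWeight Γ) :=
  (WithLp.linearEquiv 2 ℂ (L2 (modelWeight Γ) × L2 (modelWeight Γ))).symm.toLinearMap ∘ₗ
    LinearMap.inr ℂ (L2 (modelWeight Γ)) (L2 (modelWeight Γ)) ∘ₗ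
    { toFun := fun P => (memLp_eval_fst hm hn hmΓ hnΓ P).toLp _
      map_add' := fun P Q => by
        rw [← MemLp.toLp_add]
        congr 1
        ext p
        simp
      map_smul' := fun c P => by
        rw [RingHom.id_apply, ← MemLp.toLp_const_smul]
        congr 1
        ext p
        simp }

theorem norm_sq_polyForm (hm : 2 ≤ m) (hn : 2 ≤ n) (hmΓ : (m, 0) ∈ Γ) (hnΓ : (0, n) ∈ Γ)
    (P : Polynomial ℂ) : ‖polyForm hm hn hmΓ hnΓ P‖ ^ 2 =
      ∫ p : ℂ × ℂ, ‖P.eval p.1‖ ^ 2 * wt (modelWeight Γ) p := by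
  rw [← norm_sq_toLp (memLp_eval_fst hm hn hmΓ hnΓ P), WithLp.prod_norm_sq_eq_of_L2]
  change ‖(0 : L2 (modelWeight Γ))‖ ^ 2 + _ = _
  rw [norm_zero, zero_pow two_ne_zero, zero_add]
  rfl

theorem polyForm_ne_zero (hm : 2 ≤ m) (hn : 2 ≤ n) (hmΓ : (m, 0) ∈ Γ) (hnΓ : (0, n) ∈ Γ)
    {P : Polynomial ℂ} (hP : P ≠ 0) : polyForm hm hn hmΓ hnΓ P ≠ 0 := by
  have := isAddHaarMeasure_volume
  intro h
  have h1 : (memLp_eval_fst hm hn hmΓ hnΓ P).toLp _ = 0 := congrArg WithLp.snd h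
  have h2 : (fun p : ℂ × ℂ => P.eval p.1) =ᵐ[volume] fun _ => 0 := by
    filter_upwards [coeFn_toLp (memLp_eval_fst hm hn hmΓ hnΓ P), coeFn_zero (φ := modelWeight Γ)]
      with p h3 h4
    rw [← h3, h1, h4]
  have h3 := (Continuous.ae_eq_iff_eq volume (contDiff_eval_fst P).continuous continuous_const).1 h2
  exact hP (Polynomial.funext fun z => by simpa using congrFun h3 (z, 0))

/-- Both `‖P dw̄‖²` and `‖∂̄*(P dw̄)‖²` are the same integral in `z` times an integral in `w` that
does not involve `P`. The constant is the quotient of the two `w`-integrals. -/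
theorem exists_polyForm_mem (hm : 2 ≤ m) (hn : 2 ≤ n) (hmΓ : (m, 0) ∈ Γ) (hnΓ : (0, n) ∈ Γ)
    (hΓ : IsDecoupled Γ) : ∃ C, 0 ≤ C ∧ ∀ P : Polynomial ℂ,
      (polyForm hm hn hmΓ hnΓ P, 0) ∈ (dbar1 (modelWeight Γ)).graph ∧
      ∃ h, (polyForm hm hn hmΓ hnΓ P, h) ∈ ((dbar0 (modelWeight Γ))†).graph ∧
        ‖h‖ ^ 2 ≤ C * ‖polyForm hm hn hmΓ hnΓ P‖ ^ 2 := by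
  let q : ℂ → ℂ := fun w => 2 * del (0, 1) (fun p => (modelWeight Γ p : ℂ)) (0, w)
  let B : ℝ := ∫ w, ‖(1 : ℂ)‖ ^ 2 * wt (modelWeight Γ) (0, w)
  let B' : ℝ := ∫ w, ‖q w‖ ^ 2 * wt (modelWeight Γ) (0, w)
  have hB0 : 0 ≤ B := integral_nonneg fun w => mul_nonneg (by positivity) (wt_pos _ _).le
  have hB0' : 0 ≤ B' := integral_nonneg fun w => mul_nonneg (by positivity) (wt_pos _ _).le
  have hnorm : ∀ P : Polynomial ℂ, ‖polyForm hm hn hmΓ hnΓ P‖ ^ 2 =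
      Real.exp (2 * modelWeight Γ (0, 0)) *
        ((∫ z, ‖P.eval z‖ ^ 2 * wt (modelWeight Γ) (z, 0)) * B) := fun P => by
    rw [norm_sq_polyForm, ← integral_norm_sq_mul_wt hΓ]
    simp only [mul_one]
  -- Otherwise the nonzero form `1 · dw̄` would have norm zero.
  have hB : B ≠ 0 := fun hB => by
    have h1 := hnorm 1
    rw [hB, mul_zero, mul_zero, sq_eq_zero_iff, norm_eq_zero] at h1
    exact polyForm_ne_zero hm hn hmΓ hnΓ one_ne_zero h1
  refine ⟨B' / B, by positivity, fun P => ⟨toLp_mem_dbar1 (memLp_eval_fst hm hn hmΓ hnΓ P)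
    (contDiff_eval_fst P) fun p => dbar_of_holomorphic (differentiable_eval_fst P) _ p, ?_⟩⟩
  have he := funext (delta_eval_fst P hΓ)
  have hb : MemLp (delta (modelWeight Γ) (0, 1) fun p : ℂ × ℂ => P.eval p.1) 2
      (weightedMeasure (modelWeight Γ)) := by
    have hpb : PolyBounded (delta (modelWeight Γ) (0, 1) fun p : ℂ × ℂ => P.eval p.1) := by
      have h1 := (polyBounded_eval_fst P).mul ((polyBounded_const 2).mul
        (polyBounded_del_modelWeight Γ))
      have h2 : (delta (modelWeight Γ) (0, 1) fun p : ℂ × ℂ => P.eval p.1) = fun p =>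
          P.eval p.1 * (2 * del (0, 1) (fun p => (modelWeight Γ p : ℂ)) p) := by
        rw [he]
        ext p
        rw [← del_modelWeight_of_isDecoupled hΓ p.1 p.2]
      rwa [h2]
    exact hpb.memLp hm hn hmΓ hnΓ
      (contDiff_delta (contDiff_modelWeight Γ) (contDiff_eval_fst P) _).continuous
  refine ⟨hb.toLp _, toLp_mem_adjoint (contDiff_modelWeight Γ)
    (memLp_eval_fst hm hn hmΓ hnΓ P) (contDiff_eval_fst P) hb, ?_⟩
  rw [norm_sq_toLp, hnorm, he, integral_norm_sq_mul_wt hΓ (fun z => P.eval z) q]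
  refine le_of_eq ?_
  change _ * (_ * B') = _
  field_simp

/-- On the infinite-dimensional space of forms `P(z) dw̄` the energy is at most a constant times the
squared norm. A finite-rank operator kills some nonzero form of this space, and the compactness
estimate fails for it. -/
theorem not_hasDiscreteSpectrum_of_isDecoupled (hm : 2 ≤ m) (hn : 2 ≤ n) (hmΓ : (m, 0) ∈ Γ)
    (hnΓ : (0, n) ∈ Γ) (hΓ : IsDecoupled Γ) :
    ¬ HasDiscreteSpectrum (box (modelWeight Γ)) := by
  intro hd
  obtain ⟨C, hC, hmem⟩ := exists_polyForm_mem hm hn hmΓ hnΓ hΓ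
  -- With this `ε` the estimate at a form killed by `F` becomes `x³ ≤ (1 + C) x² · ε x = x³ / 2`.
  obtain ⟨V, F, hV, hF, H⟩ := (isHilbertComplex_dbar (contDiff_modelWeight Γ)).exists_finiteRank hd
    (ε := 1 / (2 * (1 + C))) (by positivity)
  let A : Polynomial ℂ →ₗ[ℂ] V := (F.toLinearMap.codRestrict V hF) ∘ₗ polyForm hm hn hmΓ hnΓ
  have hA : ¬ Function.Injective A := fun hi => by
    have := Module.Finite.of_injective A hi
    exact Polynomial.not_finite this
  rw [← LinearMap.ker_eq_bot, Submodule.eq_bot_iff] at hA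
  push Not at hA
  obtain ⟨P, hP, hP0⟩ := hA
  have hFP : F (polyForm hm hn hmΓ hnΓ P) = 0 := congrArg Subtype.val (LinearMap.mem_ker.1 hP)
  obtain ⟨h1, h, h2, h3⟩ := hmem P
  have key := H _ _ _ h1 h2
  have hpos : 0 < ‖polyForm hm hn hmΓ hnΓ P‖ := norm_pos_iff.2 (polyForm_ne_zero hm hn hmΓ hnΓ hP0)
  set x := ‖polyForm hm hn hmΓ hnΓ P‖
  rw [hFP, norm_zero, norm_zero, add_zero, zero_pow two_ne_zero, add_zero] at key
  have h4 : (x ^ 2 + ‖h‖ ^ 2) * (1 / (2 * (1 + C)) * x) ≤ (1 + C) * x ^ 2 * (1 / (2 * (1 + C)) * x) := by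
    gcongr
    linarith
  have h5 : (1 + C) * x ^ 2 * (1 / (2 * (1 + C)) * x) = x ^ 3 / 2 := by
    field_simp
  have := pow_pos hpos 3
  linarith

end Decoupled

end KohnLaplacian

end

theorem mainTheorem2 (Γ : Finset (ℕ × ℕ))
    (hΓ : ∃ m n : ℕ, 2 ≤ m ∧ 2 ≤ n ∧ (m, 0) ∈ Γ ∧ (0, n) ∈ Γ) :
    KohnLaplacian.HasDiscreteSpectrum (KohnLaplacian.box (KohnLaplacian.modelWeight Γ)) ↔
      ¬ KohnLaplacian.IsDecoupled Γ := by
  obtain ⟨m, n, hm, hn, hmΓ, hnΓ⟩ := hΓ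
  exact ⟨fun hd h => KohnLaplacian.not_hasDiscreteSpectrum_of_isDecoupled hm hn hmΓ hnΓ h hd,
    KohnLaplacian.hasDiscreteSpectrum_of_not_isDecoupled hm hn hmΓ hnΓ⟩
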